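/- **DP-SGD.** Let $S=(X_1,\dots,X_n)$ be i.i.d. data points with values in a measurable space $\mathcal X$ and law $P$. Let $\mathcal Y$ be a measurable space of models and $\ell:\mathcal X\times\mathcal Y\to[0,1]$ a measurable loss, with true risk $R(\rho)=\mathbb E_{y\sim\rho}\mathbb E_{x\sim P}\,\ell(x,y)$ and training risk $\hat R(\rho)=\mathbb E_{y\sim\rho}\frac1n\sum_{i=1}^n\ell(X_i,y)$ for probability measures $\rho$ on $\mathcal Y$. DP-SGD with clipping threshold $\zeta>0$, noise strength $\sigma>0$, batch size $m\ge1$, $T\ge1$ steps per epoch, $E\ge1$ epochs, and learning rates $\eta_1,\dots,\eta_T$ works as follows on parameters in $\mathbb R^d$. It starts from an initialization $\theta_0$; in each epoch $e=1,\dots,E$ it chooses pairwise disjoint index sets $I_1,\dots,I_T\subset\{1,\dots,n\}$ of size $m$ (so $n\ge Tm$); in each step $t=1,\dots,T$ it computes $$u_t=\sum_{i\in I_t}\mathrm{clip}\bigl(\nabla_\theta \ell_{\mathrm{tr}}(X_i,\theta_{t-1}),\zeta\bigr)+\sigma z,\qquad z\sim\mathcal N(0,\mathrm I_d),$$ where $\mathrm{clip}(g,\zeta)$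 rescales $g$ to length $\zeta$ if $\|g\|>\zeta$ and $\ell_{\mathrm{tr}}:\mathcal X\times\mathbb R^d\to\mathbb R$ is the loss used for training (for $\mathcal Y=\mathbb R^d$ it may be $\ell$ itself), and then obtains $\theta_t$ from $u_t$ and $\eta_t$ by a deterministic measurable update rule that may use all previous parameters and update vectors (e.g. momentum or Adam) but no further information on the data. The next epoch continues from $\theta_T$. The Gaussian noise vectors are independent of each other; initialization and batches may be random; data, noise, and all remaining randomness $W$ (initialization, batches, post-processing) are independent. The output is the stream of all iterates $\theta_t$ of all epochs (or only the last one). **Theorem 2.** Let $\pi$ be a probability measure on $\mathcal Y$ obtained by measurable, possibly randomized, post-processing of the output of DP-SGD run on $S$ (that is, a Markov kernel applied to $W$ and the output). Let $\nu=m\frac{\zeta^2}{\sigma^2}$, $r_\nu=\sqrt{\frac1\nu+\frac14}-\frac12$, $F(x)=\frac{16\nu^2x^2+\nu x}{1-2\nu x}$, and for $\delta\in(0,1)$ $$\kappa=\frac12ET\nu+E\inf_{\lambda\in(0,r_\nu)}\frac1\lambda\Bigl[T\,F\Bigl(\frac{\lambda+\lambda^2}{2}\Bigr)+\log\frac{2E}{\delta}\Bigr].$$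 Then for every $\delta\in(0,1)$, with probability at least $1-\delta$ (over $S$ and the randomness of the algorithm), simultaneously for all probability measures $\rho$ on $\mathcal Y$, $$\mathrm{kl}\bigl(\hat R(\rho)\,\|\,R(\rho)\bigr)\le\frac{D_{\mathrm{KL}}(\rho\|\pi)+\kappa+\log\frac{4\sqrt n}{\delta}}{n},$$ where $\mathrm{kl}(a\|p)=a\log\frac ap+(1-a)\log\frac{1-a}{1-p}$ is the Kullback–Leibler divergence between Bernoulli distributions. Moreover $$\kappa\le ETm\frac{\zeta^2}{\sigma^2}\Bigl(1+3q+\frac12q^2\Bigr)+ET\sqrt m\,\frac\zeta\sigma\Bigl(\frac12+3q+\frac12q^2\Bigr),\qquad q=\sqrt{\frac2T\log\frac{2E}{\delta}}.$$ -/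

import Mathlib

open MeasureTheory ProbabilityTheory InformationTheory
open scoped ENNReal

noncomputable section

/-- Clipping of a vector `g` to maximal length `ζ`. -/
def clip {d : ℕ} (g : EuclideanSpace ℝ (Fin d)) (ζ : ℝ) : EuclideanSpace ℝ (Fin d) :=
  if ‖g‖ ≤ ζ then g else (ζ / ‖g‖) • g

/-- The inputs and subroutines of DP-SGD for datasets of size `n` over `𝒳` and parameters in `ℝᵈ`.

* `𝒲` carries the randomness of the algorithm other than the Gaussian noise (initialization,
  creation of batches).
* `𝒮` is the internal state of the algorithm: whatever *GradientUpdate* keeps in memory, for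
  instance all previous parameters and update vectors, or momentum and normalization buffers.
  The current parameter vector is `param s`.
* Epochs `e < E` and steps `t < T` are counted from `0`. The batches of one epoch are disjoint and
  of size `m`, so that `T * m ≤ n`; they are created without access to the data. -/
structure DPSGD (𝒳 𝒲 𝒮 : Type*) [MeasurableSpace 𝒳] [MeasurableSpace 𝒲] [MeasurableSpace 𝒮]
    (d n : ℕ) where
  /-- clipping threshold -/
  ζ : ℝ
  /-- noise strength -/
  σ : ℝ
  /-- batch size -/
  m : ℕ
  /-- number of steps per epoch -/
  T : ℕ
  /-- number of epochs -/
  E : ℕ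
  /-- learning rates -/
  η : ℕ → ℝ
  /-- the loss whose clipped gradients drive the training -/
  trainLoss : 𝒳 → EuclideanSpace ℝ (Fin d) → ℝ
  /-- initialization -/
  init : 𝒲 → 𝒮
  /-- current model parameters -/
  param : 𝒮 → EuclideanSpace ℝ (Fin d)
  /-- *CreateBatches*: the index set of the batch of epoch `e`, step `t` -/
  createBatches : 𝒲 → ℕ → ℕ → Finset (Fin n)
  /-- *GradientUpdate*: epoch, step, learning rate, update vector, old state `↦` new state -/
  gradientUpdate : ℕ → ℕ → ℝ → EuclideanSpace ℝ (Fin d) → 𝒮 → 𝒮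
  ζ_pos : 0 < ζ
  σ_pos : 0 < σ
  m_pos : 0 < m
  T_pos : 0 < T
  E_pos : 0 < E
  card_batch : ∀ w, ∀ e < E, ∀ t < T, (createBatches w e t).card = m
  disjoint_batch : ∀ w, ∀ e < E, ∀ t < T, ∀ t' < T, t ≠ t' →
    Disjoint (createBatches w e t) (createBatches w e t')
  measurable_gradient : Measurable
    (fun p : 𝒳 × EuclideanSpace ℝ (Fin d) => gradient (trainLoss p.1) p.2)
  measurable_init : Measurable init
  measurable_param : Measurable param
  measurableSet_batch : ∀ e t, ∀ i : Fin n, MeasurableSet {w | i ∈ createBatches w e t}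
  measurable_gradientUpdate : ∀ e t, Measurable
    (fun p : EuclideanSpace ℝ (Fin d) × 𝒮 => gradientUpdate e t (η t) p.1 p.2)

namespace DPSGD

variable {𝒳 𝒲 𝒮 : Type*} [MeasurableSpace 𝒳] [MeasurableSpace 𝒲] [MeasurableSpace 𝒮] {d n : ℕ}

/-- The update vector: sum of the clipped gradients over the batch, plus noise `σ z`. -/
def updateVector (A : DPSGD 𝒳 𝒲 𝒮 d n) (S : Fin n → 𝒳) (I : Finset (Fin n))
    (z θ : EuclideanSpace ℝ (Fin d)) : EuclideanSpace ℝ (Fin d) :=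
  (∑ i ∈ I, clip (gradient (A.trainLoss (S i)) θ) A.ζ) + A.σ • z

/-- The state after `t` steps of epoch `e`, when this epoch starts in the state `s`.
`z e t` is the standard Gaussian noise of epoch `e`, step `t`. -/
def stateInEpoch (A : DPSGD 𝒳 𝒲 𝒮 d n) (S : Fin n → 𝒳) (w : 𝒲)
    (z : ℕ → ℕ → EuclideanSpace ℝ (Fin d)) (e : ℕ) (s : 𝒮) : ℕ → 𝒮
  | 0 => s
  | t + 1 =>
    let s' := A.stateInEpoch S w z e s t
    A.gradientUpdate e t (A.η t)
      (A.updateVector S (A.createBatches w e t) (z e t) (A.param s')) s'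

/-- The state at the start of epoch `e`. -/
def epochStart (A : DPSGD 𝒳 𝒲 𝒮 d n) (S : Fin n → 𝒳) (w : 𝒲)
    (z : ℕ → ℕ → EuclideanSpace ℝ (Fin d)) : ℕ → 𝒮
  | 0 => A.init w
  | e + 1 => A.stateInEpoch S w z e (A.epochStart S w z e) A.T

/-- The output of streaming DP-SGD: the parameters after every step of every epoch.
The output of batch DP-SGD is the last of them. -/
def stream (A : DPSGD 𝒳 𝒲 𝒮 d n) (S : Fin n → 𝒳) (w : 𝒲)
    (z : ℕ → ℕ → EuclideanSpace ℝ (Fin d)) (e : Fin A.E) (t : Fin A.T) :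
    EuclideanSpace ℝ (Fin d) :=
  A.param (A.stateInEpoch S w z e (A.epochStart S w z e) (t + 1))

/-- `ν = m ζ² / σ²`. -/
def ν (A : DPSGD 𝒳 𝒲 𝒮 d n) : ℝ := A.m * (A.ζ ^ 2 / A.σ ^ 2)

end DPSGD

/-- `F(x) = (16 ν² x² + ν x) / (1 - 2 ν x)`. -/
def bernsteinF (ν x : ℝ) : ℝ := (16 * ν ^ 2 * x ^ 2 + ν * x) / (1 - 2 * ν * x)

/-- `r_ν = √(1/ν + 1/4) - 1/2`. -/
def rNu (ν : ℝ) : ℝ := √(1 / ν + 1 / 4) - 1 / 2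

namespace DPSGD

variable {𝒳 𝒲 𝒮 : Type*} [MeasurableSpace 𝒳] [MeasurableSpace 𝒲] [MeasurableSpace 𝒮] {d n : ℕ}

/-- The correction term `κ`. -/
def kappa (A : DPSGD 𝒳 𝒲 𝒮 d n) (δ : ℝ) : ℝ :=
  1 / 2 * A.E * A.T * A.ν +
    A.E * sInf ((fun l : ℝ => 1 / l *
      (A.T * bernsteinF A.ν ((l + l ^ 2) / 2) + Real.log (2 * A.E / δ))) '' Set.Ioo 0 (rNu A.ν))

/-- `q = √((2/T) log (2E/δ))`. -/
def q (A : DPSGD 𝒳 𝒲 𝒮 d n) (δ : ℝ) : ℝ := √(2 / A.T * Real.log (2 * A.E / δ))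

/-- The explicit relaxation of `κ`. -/
def kappaExplicit (A : DPSGD 𝒳 𝒲 𝒮 d n) (δ : ℝ) : ℝ :=
  A.E * A.T * A.m * (A.ζ ^ 2 / A.σ ^ 2) * (1 + 3 * A.q δ + 1 / 2 * A.q δ ^ 2) +
    A.E * A.T * √(A.m : ℝ) * (A.ζ / A.σ) * (1 / 2 + 3 * A.q δ + 1 / 2 * A.q δ ^ 2)

end DPSGD

/-- Training risk of a distribution `ρ` over models. -/
def empRisk {𝒳 𝒴 : Type*} [MeasurableSpace 𝒴] {n : ℕ} (loss : 𝒳 → 𝒴 → ℝ) (S : Fin n → 𝒳)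
    (ρ : Measure 𝒴) : ℝ :=
  ∫ y, ((1 / (n : ℝ)) * ∑ i, loss (S i) y) ∂ρ

/-- True risk of a distribution `ρ` over models, for the data distribution `P`. -/
def trueRisk {𝒳 𝒴 : Type*} [MeasurableSpace 𝒳] [MeasurableSpace 𝒴] (loss : 𝒳 → 𝒴 → ℝ)
    (P : Measure 𝒳) (ρ : Measure 𝒴) : ℝ :=
  ∫ y, ∫ x, loss x y ∂P ∂ρ

open scoped Classical in
/-- Kullback-Leibler divergence `kl(a‖p)` between the Bernoulli distributions with parameters
`a, p ∈ [0,1]`. It is infinite iff `Ber(a)` is not absolutely continuous with respect to `Ber(p)`;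
the conventions `0 log (0 / p) = 0` hold automatically. -/
def klBer (a p : ℝ) : ℝ≥0∞ :=
  if (p = 0 ∧ a ≠ 0) ∨ (p = 1 ∧ a ≠ 1) then ∞
  else ENNReal.ofReal (a * Real.log (a / p) + (1 - a) * Real.log ((1 - a) / (1 - p)))

end

/-! Fix the value w of the remaining randomness. Divided by σ, the update vectors form a path v of a
Gaussian process in K = ET steps. Its drift at step k is a sum, over the batch, of vectors of length
at most b = ζ/σ that depend on a data point and on the earlier part of the path. The iterates are
functions of v alone (`run_eq_replay`), and by Girsanov's formula in discrete time
(`lintegral_comp_driftUpTo`) the pair (S, v) has the density p = `lik` with respect to the product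
of the data law and white noise.

If v were independent of S, Maurer's bound (`lintegral_expKl_le`) would give mean at most 2√n to the
prior average of exp(n kl), and Markov's inequality with Donsker-Varadhan
(`klBer_le_of_lintegral_expKl_le`) would finish the proof for all posteriors at once. The dependence
is paid for by `HasRenyiBound.lintegral_le`: for a law with density q in v alone, the region p ≤ e^k
q costs a factor e^k in Markov's inequality, and the rest has probability at most e^(ψ - sk), where
ψ bounds s times the Rényi divergence of order 1 + s. With s = l/E and ψ = T(lν/2 + F((l + l²)/2)),
the resulting k is the expression under the infimum in κ. So all depends on this value of ψ, which
is `PathField.hasRenyiBound`.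

For E = 1 every batch is fresh when it is used. Compared with the process whose drift is averaged
over the data law, p^(1+s) q^(-s) is a Gaussian density times the exponential of squared centered
batch sums, and these are integrated out step by step (`hasRenyiBound_single_epoch`).

For E ≥ 2 the data are reused. The best q(v) is proportional to the L^(1+s) norm of p(·, v) over the
data, and the growth of L^a norms in a is governed by the entropy of p^a as a function of S. Entropy
is subadditive over independent coordinates (`entropy_le_sum_groups`), and the contribution of one
coordinate is bounded by squares of the log-likelihood gain of one data point (`expEntropy_le`). By
Gibbs' variational principle the norm is then at most the mean of p exp(cw), with w the sum of these
squares and c a constant, so that an exponential moment of w under the true process remains. There a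
gain is Gaussian noise projected to the gradient of a data point, plus a bounded term. Backward
induction over the steps handles the noise: each use of a point lowers the reciprocal of its weight
by ν, a point is used at most once per epoch, and the factors of the epochs telescope to one power
of order T/2 (`lintegral_lik_mul_exp_noise_sq_epochs_le`).

The bounded term is too large when sm is small. Then the points are resampled in about 1/(2s) groups
instead of one by one (`hasRenyiBound_groups`), and for m ≤ 2 a bound without any averaging is
enough (`hasRenyiBound_worstCase`). That one of these bounds always lies below the target is
elementary calculus (`hasRenyiBound_of_two_le`). -/

theorem lintegral_pi_le_of_update {ι X : Type*} [Fintype ι] [DecidableEq ι] [MeasurableSpace X]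
    (μ : Measure X) [SigmaFinite μ] (j : ι) {F G : (ι → X) → ℝ≥0∞} (hF : Measurable F)
    (hG : Measurable G)
    (h : ∀ v, ∫⁻ y, F (Function.update v j y) ∂μ ≤ ∫⁻ y, G (Function.update v j y) ∂μ) :
    ∫⁻ v, F v ∂(Measure.pi fun _ => μ) ≤ ∫⁻ v, G v ∂(Measure.pi fun _ => μ) := by
  refine lintegral_le_of_lmarginal_le (μ := fun _ => μ) {j} hF hG fun v => ?_
  simpa only [lmarginal_singleton] using h v

theorem lintegral_pi_eq_of_update {ι X : Type*} [Fintype ι] [DecidableEq ι] [MeasurableSpace X]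
    (μ : Measure X) [SigmaFinite μ] (j : ι) {F G : (ι → X) → ℝ≥0∞} (hF : Measurable F)
    (hG : Measurable G)
    (h : ∀ v, ∫⁻ y, F (Function.update v j y) ∂μ = ∫⁻ y, G (Function.update v j y) ∂μ) :
    ∫⁻ v, F v ∂(Measure.pi fun _ => μ) = ∫⁻ v, G v ∂(Measure.pi fun _ => μ) :=
  le_antisymm (lintegral_pi_le_of_update μ j hF hG fun v => (h v).le)
    (lintegral_pi_le_of_update μ j hG hF fun v => (h v).ge)

/-! ### Gaussian translations and exponential moments of quadratic polynomials -/

/-- Translation formula for the standard Gaussian on the line. -/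
theorem lintegral_gaussianReal_exp_mul_comp_sub (c : ℝ) {g : ℝ → ℝ≥0∞} (hg : Measurable g) :
    ∫⁻ t, ENNReal.ofReal (Real.exp (t * c - c ^ 2 / 2)) * g (t - c) ∂(gaussianReal 0 1) =
      ∫⁻ t, g t ∂(gaussianReal 0 1) := by
  rw [gaussianReal_of_var_ne_zero _ one_ne_zero,
    lintegral_withDensity_eq_lintegral_mul _ (measurable_gaussianPDF _ _) (by fun_prop),
    lintegral_withDensity_eq_lintegral_mul _ (measurable_gaussianPDF _ _) hg,
    ← lintegral_sub_right_eq_self (gaussianPDF 0 1 * g) c]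
  refine lintegral_congr fun t => ?_
  simp only [Pi.mul_apply]
  rw [← mul_assoc]
  congr 1
  rw [gaussianPDF, gaussianPDF, ← ENNReal.ofReal_mul (gaussianPDFReal_nonneg _ _ _)]
  congr 1
  simp only [gaussianPDFReal, mul_assoc, ← Real.exp_add]
  congr 2
  simp
  ring_nf

/-- One-dimensional Gaussian integral of the exponential of a quadratic polynomial. -/
theorem lintegral_gaussianReal_exp_quadratic (a : ℝ) {t : ℝ} (ht : t < 1) :
    ∫⁻ x, ENNReal.ofReal (Real.exp (a * x + t / 2 * x ^ 2)) ∂(gaussianReal 0 1) =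
      ENNReal.ofReal ((√(1 - t))⁻¹ * Real.exp (a ^ 2 / (2 * (1 - t)))) := by
  have h1 : 0 < 1 - t := by linarith
  set v : NNReal := ⟨(1 - t)⁻¹, (inv_pos.2 h1).le⟩ with hv
  have hvr : (v : ℝ) = (1 - t)⁻¹ := rfl
  have hv0 : v ≠ 0 := by
    intro h
    have : (v : ℝ) = 0 := by rw [h]; rfl
    rw [hvr] at this
    exact (inv_pos.2 h1).ne' this
  rw [gaussianReal_of_var_ne_zero _ one_ne_zero,
    lintegral_withDensity_eq_lintegral_mul _ (measurable_gaussianPDF _ _) (by fun_prop)]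
  have key : ∀ x, (gaussianPDF 0 1 * fun x => ENNReal.ofReal (Real.exp (a * x + t / 2 * x ^ 2))) x
      = ENNReal.ofReal ((√(1 - t))⁻¹ * Real.exp (a ^ 2 / (2 * (1 - t)))) *
        gaussianPDF (a / (1 - t)) v x := by
    intro x
    simp only [Pi.mul_apply]
    rw [gaussianPDF, gaussianPDF, ← ENNReal.ofReal_mul (gaussianPDFReal_nonneg _ _ _),
      ← ENNReal.ofReal_mul (by positivity)]
    congr 1
    simp only [gaussianPDFReal, hvr]
    have e1 : (√(2 * Real.pi * (1 - t)⁻¹))⁻¹ = √(1 - t) * (√(2 * Real.pi))⁻¹ := by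
      rw [Real.sqrt_mul (by positivity), Real.sqrt_inv, mul_inv, inv_inv, mul_comm]
    rw [e1]
    have e2 : (√(1 - t))⁻¹ * √(1 - t) = 1 := inv_mul_cancel₀ (Real.sqrt_pos.2 h1).ne'
    have e3 : Real.exp (-(x - 0) ^ 2 / (2 * ((1 : NNReal) : ℝ))) *
        Real.exp (a * x + t / 2 * x ^ 2) =
        Real.exp (a ^ 2 / (2 * (1 - t))) *
          Real.exp (-(x - a / (1 - t)) ^ 2 / (2 * (1 - t)⁻¹)) := by
      rw [← Real.exp_add, ← Real.exp_add]
      congr 1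
      simp
      field_simp
      ring
    calc (√(2 * Real.pi * ((1 : NNReal) : ℝ)))⁻¹ *
          Real.exp (-(x - 0) ^ 2 / (2 * ((1 : NNReal) : ℝ))) * Real.exp (a * x + t / 2 * x ^ 2)
        = (√(2 * Real.pi))⁻¹ * (Real.exp (-(x - 0) ^ 2 / (2 * ((1 : NNReal) : ℝ))) *
            Real.exp (a * x + t / 2 * x ^ 2)) := by simp [mul_assoc]
      _ = ((√(1 - t))⁻¹ * √(1 - t)) * ((√(2 * Real.pi))⁻¹ * (Real.exp (a ^ 2 / (2 * (1 - t))) *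
          Real.exp (-(x - a / (1 - t)) ^ 2 / (2 * (1 - t)⁻¹)))) := by rw [e2, e3, one_mul]
      _ = _ := by ring
  rw [lintegral_congr key, lintegral_const_mul _ (measurable_gaussianPDF _ _),
    lintegral_gaussianPDF_eq_one _ hv0, mul_one]

/-- The density of a standard Gaussian translated by `c`, with respect to the standard Gaussian. -/
noncomputable def gaussianShift {V : Type*} [NormedAddCommGroup V] [InnerProductSpace ℝ V]
    (y c : V) : ℝ≥0∞ := ENNReal.ofReal (Real.exp (inner ℝ y c - ‖c‖ ^ 2 / 2))

/-- Cameron-Martin formula for the standard Gaussian. -/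
theorem lintegral_gaussianShift_mul_comp_sub {d : ℕ} (c : EuclideanSpace ℝ (Fin d))
    {Ψ : EuclideanSpace ℝ (Fin d) → ℝ≥0∞} (hΨ : Measurable Ψ) :
    ∫⁻ y, gaussianShift y c * Ψ (y - c) ∂(stdGaussian (EuclideanSpace ℝ (Fin d))) =
      ∫⁻ y, Ψ y ∂(stdGaussian (EuclideanSpace ℝ (Fin d))) := by
  have hm1 : Measurable fun y => gaussianShift y c * Ψ (y - c) := by
    unfold gaussianShift; fun_prop
  rw [← map_pi_eq_stdGaussian, lintegral_map hm1 (by fun_prop), lintegral_map hΨ (by fun_prop)]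
  set Φ : (Fin d → ℝ) → ℝ≥0∞ := fun x => Ψ (WithLp.toLp 2 x) with hΦ
  have hΦm : Measurable Φ := by fun_prop
  -- The coordinates are shifted one at a time: those in `s` carry a density factor and the shift,
  -- and enlarging `s` by one is the formula on the line.
  have ind : ∀ s : Finset (Fin d),
      ∫⁻ x : Fin d → ℝ, (∏ i ∈ s, ENNReal.ofReal (Real.exp (x i * c i - c i ^ 2 / 2))) *
        Φ (fun i => if i ∈ s then x i - c i else x i) ∂(Measure.pi fun _ => gaussianReal 0 1) =
      ∫⁻ x, Φ x ∂(Measure.pi fun _ => gaussianReal 0 1) := by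
    intro s
    have hmeas : ∀ s : Finset (Fin d), Measurable fun x : Fin d → ℝ =>
        (∏ i ∈ s, ENNReal.ofReal (Real.exp (x i * c i - c i ^ 2 / 2))) *
        Φ (fun i => if i ∈ s then x i - c i else x i) := by
      intro s
      refine Measurable.mul (by fun_prop) (hΦm.comp (measurable_pi_lambda _ fun i => ?_))
      split_ifs <;> fun_prop
    induction s using Finset.induction_on with
    | empty => simp
    | insert j s hj ih =>
      rw [← ih]
      refine lintegral_pi_eq_of_update _ j (hmeas _) (hmeas _) fun x => ?_
      set x' : Fin d → ℝ := fun i => if i ∈ s then x i - c i else x i with hx'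
      have e1 : ∀ y : ℝ, (∏ i ∈ s, ENNReal.ofReal (Real.exp (Function.update x j y i * c i
          - c i ^ 2 / 2))) = ∏ i ∈ s, ENNReal.ofReal (Real.exp (x i * c i - c i ^ 2 / 2)) := by
        intro y
        refine Finset.prod_congr rfl fun i hi => ?_
        rw [Function.update_of_ne (ne_of_mem_of_not_mem hi hj)]
      have e2 : ∀ y : ℝ, (fun i => if i ∈ s then Function.update x j y i - c i
          else Function.update x j y i) = Function.update x' j y := by
        intro y
        funext i
        by_cases h : i = j
        · subst h; simp [hj]
        · simp [Function.update_of_ne h, hx']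
      have e3 : ∀ y : ℝ, (fun i => if i ∈ insert j s then Function.update x j y i - c i
          else Function.update x j y i) = Function.update x' j (y - c j) := by
        intro y
        funext i
        by_cases h : i = j
        · subst h; simp
        · simp [hx', h]
      simp only [Finset.prod_insert hj, e1, e2, e3, Function.update_self]
      have e4 := lintegral_gaussianReal_exp_mul_comp_sub (c j)
        (g := fun y => Φ (Function.update x' j y)) (by fun_prop)
      rw [lintegral_const_mul _ (by fun_prop), ← e4, ← lintegral_const_mul _ (by fun_prop)]
      refine lintegral_congr fun y => ?_
      ring
  have h := ind Finset.univ
  simp only [Finset.mem_univ, if_true] at h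
  rw [← h]
  refine lintegral_congr fun x => ?_
  congr 1
  rw [gaussianShift, ← ENNReal.ofReal_prod_of_nonneg (fun _ _ => (Real.exp_pos _).le),
    ← Real.exp_sum]
  congr 2
  rw [Finset.sum_sub_distrib, EuclideanSpace.norm_sq_eq, Finset.sum_div]
  congr 1
  · simp [PiLp.inner_apply, mul_comm]
  · simp

theorem lintegral_gaussianShift {d : ℕ} (c : EuclideanSpace ℝ (Fin d)) :
    ∫⁻ y, gaussianShift y c ∂(stdGaussian (EuclideanSpace ℝ (Fin d))) = 1 := by
  simpa using lintegral_gaussianShift_mul_comp_sub c (Ψ := fun _ => 1) measurable_const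

theorem lintegral_exp_inner_stdGaussian {d : ℕ} (c : EuclideanSpace ℝ (Fin d)) :
    ∫⁻ y, ENNReal.ofReal (Real.exp (inner ℝ y c)) ∂(stdGaussian (EuclideanSpace ℝ (Fin d))) =
      ENNReal.ofReal (Real.exp (‖c‖ ^ 2 / 2)) := by
  have h := lintegral_gaussianShift c
  have e : ∀ y : EuclideanSpace ℝ (Fin d), ENNReal.ofReal (Real.exp (inner ℝ y c)) =
      ENNReal.ofReal (Real.exp (‖c‖ ^ 2 / 2)) * gaussianShift y c := by
    intro y
    rw [gaussianShift, ← ENNReal.ofReal_mul (Real.exp_pos _).le, ← Real.exp_add]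
    congr 2; ring
  simp_rw [e]
  rw [lintegral_const_mul _ (by unfold gaussianShift; fun_prop), h, mul_one]

/-- Exponential moment of a linear plus a rank one quadratic form. -/
theorem lintegral_exp_inner_add_sq_stdGaussian {d : ℕ} (b u : EuclideanSpace ℝ (Fin d))
    (hu : ‖u‖ ≤ 1) {t : ℝ} (ht0 : 0 ≤ t) (ht : t < 1) :
    ∫⁻ z, ENNReal.ofReal (Real.exp (inner ℝ z b + t / 2 * inner ℝ z u ^ 2))
        ∂(stdGaussian (EuclideanSpace ℝ (Fin d))) ≤
      ENNReal.ofReal ((√(1 - t))⁻¹ * Real.exp (‖b‖ ^ 2 / (2 * (1 - t)))) := by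
  have h1 : 0 < 1 - t := by linarith
  -- Hubbard-Stratonovich: the exponential of a square is a mean of exponentials of linear functions
  -- over an auxiliary Gaussian `x`. The integral over `z` becomes a Laplace transform, and a
  -- quadratic integral on the line remains.
  have lin : ∀ z : EuclideanSpace ℝ (Fin d),
      ENNReal.ofReal (Real.exp (inner ℝ z b + t / 2 * inner ℝ z u ^ 2)) =
      ∫⁻ x, ENNReal.ofReal (Real.exp (inner ℝ z (b + (√t * x) • u))) ∂(gaussianReal 0 1) := by
    intro z
    have h0 := lintegral_gaussianReal_exp_quadratic (√t * inner ℝ z u) (t := 0) zero_lt_one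
    have e : ∀ x : ℝ, ENNReal.ofReal (Real.exp (inner ℝ z (b + (√t * x) • u))) =
        ENNReal.ofReal (Real.exp (inner ℝ z b)) *
          ENNReal.ofReal (Real.exp (√t * inner ℝ z u * x + 0 / 2 * x ^ 2)) := by
      intro x
      rw [← ENNReal.ofReal_mul (Real.exp_pos _).le, ← Real.exp_add, inner_add_right,
        inner_smul_right]
      congr 2; ring
    simp_rw [e]
    rw [lintegral_const_mul _ (by fun_prop), h0, ← ENNReal.ofReal_mul (Real.exp_pos _).le]
    simp only [sub_zero, Real.sqrt_one, inv_one, one_mul]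
    rw [← Real.exp_add, mul_pow, Real.sq_sqrt ht0]
    congr 2; ring
  simp_rw [lin]
  rw [lintegral_lintegral_swap (by fun_prop)]
  simp_rw [lintegral_exp_inner_stdGaussian]
  have bd : ∀ x : ℝ, ENNReal.ofReal (Real.exp (‖b + (√t * x) • u‖ ^ 2 / 2)) ≤
      ENNReal.ofReal (Real.exp (‖b‖ ^ 2 / 2)) *
      ENNReal.ofReal (Real.exp (√t * inner ℝ b u * x + t / 2 * x ^ 2)) := by
    intro x
    rw [← ENNReal.ofReal_mul (Real.exp_pos _).le, ← Real.exp_add]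
    refine ENNReal.ofReal_le_ofReal (Real.exp_le_exp.2 ?_)
    rw [norm_add_sq_real, norm_smul, inner_smul_right, mul_pow, Real.norm_eq_abs, sq_abs, mul_pow,
      Real.sq_sqrt ht0]
    have hu2 : ‖u‖ ^ 2 ≤ 1 := by
      have := norm_nonneg u
      nlinarith
    have : t * x ^ 2 * ‖u‖ ^ 2 ≤ t * x ^ 2 * 1 := by gcongr
    linarith
  refine (lintegral_mono bd).trans ?_
  rw [lintegral_const_mul _ (by fun_prop), lintegral_gaussianReal_exp_quadratic _ ht,
    ← ENNReal.ofReal_mul (Real.exp_pos _).le]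
  refine ENNReal.ofReal_le_ofReal ?_
  rw [mul_left_comm, ← Real.exp_add]
  refine mul_le_mul_of_nonneg_left (Real.exp_le_exp.2 ?_) (by positivity)
  rw [mul_pow, Real.sq_sqrt ht0]
  have hbu : inner ℝ b u ^ 2 ≤ ‖b‖ ^ 2 := by
    have h2 := abs_real_inner_le_norm b u
    have h3 : |inner ℝ b u| ≤ ‖b‖ := h2.trans (by nlinarith [norm_nonneg b])
    exact sq_le_sq' (by linarith [abs_le.1 h3]) (by linarith [abs_le.1 h3])
  have : ‖b‖ ^ 2 / 2 + t * inner ℝ b u ^ 2 / (2 * (1 - t)) ≤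
      ‖b‖ ^ 2 / 2 + t * ‖b‖ ^ 2 / (2 * (1 - t)) := by gcongr
  refine this.trans (le_of_eq ?_)
  field_simp
  ring

theorem mul_le_half_sq_add_sq_div {N : ℝ} (hN : 0 < N) (a b : ℝ) :
    a * b ≤ N / 2 * a ^ 2 + b ^ 2 / (2 * N) := by
  have : N / 2 * a ^ 2 + b ^ 2 / (2 * N) - a * b = (N * a - b) ^ 2 / (2 * N) := by
    field_simp; ring
  rw [← sub_nonneg, this]
  positivity

set_option maxHeartbeats 1000000 in
/-- Exponential moment of a random nonnegative quadratic polynomial of a standard Gaussian whose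
quadratic part has trace at most `ν`. -/
theorem lintegral_exp_integral_sq_stdGaussian {d : ℕ} {Ξ : Type*} [MeasurableSpace Ξ]
    (μ : Measure Ξ) [IsFiniteMeasure μ] {a : Ξ → ℝ} {f : Ξ → EuclideanSpace ℝ (Fin d)}
    (ha : Measurable a) (hf : Measurable f) {C : ℝ} (haC : ∀ x, |a x| ≤ C) (hfC : ∀ x, ‖f x‖ ≤ C)
    {s ν : ℝ} (hs : 0 ≤ s) (hν : ∫ x, ‖f x‖ ^ 2 ∂μ ≤ ν) (hsν : s * ν < 1) :
    ∫⁻ z, ENNReal.ofReal (Real.exp (s / 2 * ∫ x, (a x + inner ℝ z (f x)) ^ 2 ∂μ))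
        ∂(stdGaussian (EuclideanSpace ℝ (Fin d))) ≤
      ENNReal.ofReal ((√(1 - s * ν))⁻¹ * Real.exp (s / (2 * (1 - s * ν)) * ∫ x, a x ^ 2 ∂μ)) := by
  set N := ∫ x, ‖f x‖ ^ 2 ∂μ with hN
  set A := ∫ x, a x ^ 2 ∂μ with hA
  clear_value N A
  have hN0 : 0 ≤ N := hN ▸ integral_nonneg fun x => by positivity
  have hA0 : 0 ≤ A := hA ▸ integral_nonneg fun x => by positivity
  have hsN : s * N < 1 := (mul_le_mul_of_nonneg_left hν hs).trans_lt hsν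
  have bddint : ∀ {g : Ξ → ℝ} (_ : Measurable g) (D : ℝ), (∀ x, |g x| ≤ D) → Integrable g μ :=
    fun hg D hD => Integrable.of_bound hg.aestronglyMeasurable D
      (Filter.Eventually.of_forall fun x => by simpa using hD x)
  have ia2 : Integrable (fun x => a x ^ 2) μ := bddint (by fun_prop) (C ^ 2) fun x => by
    rw [abs_pow]; exact pow_le_pow_left₀ (abs_nonneg _) (haC x) 2
  have if2 : Integrable (fun x => ‖f x‖ ^ 2) μ := bddint (by fun_prop) (C ^ 2) fun x => by
    rw [abs_pow, abs_norm]; exact pow_le_pow_left₀ (norm_nonneg _) (hfC x) 2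
  have hinner : ∀ z x, |inner ℝ z (f x)| ≤ ‖z‖ * C := fun z x =>
    (abs_real_inner_le_norm _ _).trans (by gcongr; exact hfC x)
  have iz2 : ∀ z, Integrable (fun x => inner ℝ z (f x) ^ 2) μ := fun z =>
    bddint (by fun_prop) ((‖z‖ * C) ^ 2) fun x => by
      rw [abs_pow]; exact pow_le_pow_left₀ (abs_nonneg _) (hinner z x) 2
  have iaz : ∀ z, Integrable (fun x => a x * inner ℝ z (f x)) μ := fun z =>
    bddint (by fun_prop) (C * (‖z‖ * C)) fun x => by
      rw [abs_mul]
      exact mul_le_mul (haC x) (hinner z x) (abs_nonneg _) ((abs_nonneg _).trans (haC x))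
  have iaf : Integrable (fun x => a x • f x) μ :=
    Integrable.of_bound (by fun_prop) (C * C) (Filter.Eventually.of_forall fun x => by
      rw [norm_smul]
      exact mul_le_mul (haC x) (hfC x) (norm_nonneg _) ((abs_nonneg _).trans (haC x)))
  set b := ∫ x, a x • f x ∂μ with hb
  clear_value b
  have hzb : ∀ z, inner ℝ z b = ∫ x, a x * inner ℝ z (f x) ∂μ := fun z => by
    rw [hb, ← integral_inner iaf]
    simp_rw [inner_smul_right]
  have expand : ∀ z, ∫ x, (a x + inner ℝ z (f x)) ^ 2 ∂μ =
      A + 2 * inner ℝ z b + ∫ x, inner ℝ z (f x) ^ 2 ∂μ := fun z => by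
    have i12 : Integrable (fun x => a x ^ 2 + 2 * (a x * inner ℝ z (f x))) μ :=
      ia2.add ((iaz z).const_mul 2)
    rw [hzb, hA, ← integral_const_mul, ← integral_add ia2 ((iaz z).const_mul 2),
      ← integral_add i12 (iz2 z)]
    congr 1; funext x; ring
  have mono : ENNReal.ofReal ((√(1 - s * N))⁻¹ * Real.exp (s / (2 * (1 - s * N)) * A)) ≤
      ENNReal.ofReal ((√(1 - s * ν))⁻¹ * Real.exp (s / (2 * (1 - s * ν)) * A)) := by
    have h1 : 0 < 1 - s * ν := by linarith
    gcongr
  refine le_trans ?_ mono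
  have h1 : 0 < 1 - s * N := by linarith
  -- For N = 0 the field `f` vanishes almost everywhere; the tilt below divides by N.
  rcases hN0.eq_or_lt with h0 | hNpos
  · have hz : ∀ᵐ x ∂μ, ‖f x‖ ^ 2 = 0 :=
      (integral_eq_zero_iff_of_nonneg (fun x => sq_nonneg ‖f x‖) if2).1
        (by rw [← hN]; exact h0.symm)
    have : ∀ z : EuclideanSpace ℝ (Fin d), ∫ x, (a x + inner ℝ z (f x)) ^ 2 ∂μ = A := fun z => by
      rw [hA]
      refine integral_congr_ae ?_
      filter_upwards [hz] with x hx
      have : f x = 0 := by simpa using hx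
      simp [this]
    simp_rw [this]
    simp [← h0]
  -- Cauchy-Schwarz for b = ∫ a f: pair with `b` and apply Young's inequality with weight N, which
  -- returns half of ‖b‖².
  have hbN : ‖b‖ ^ 2 ≤ N * A := by
    have e1 : ‖b‖ ^ 2 = ∫ x, a x * inner ℝ b (f x) ∂μ := by
      rw [← real_inner_self_eq_norm_sq]; exact hzb b
    have e2 : ∫ x, a x * inner ℝ b (f x) ∂μ ≤
        ∫ x, (N / 2 * a x ^ 2 + ‖b‖ ^ 2 / (2 * N) * ‖f x‖ ^ 2) ∂μ := by
      refine integral_mono (iaz b) ((ia2.const_mul _).add (if2.const_mul _)) fun x => ?_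
      have h2 : inner ℝ b (f x) ^ 2 ≤ ‖b‖ ^ 2 * ‖f x‖ ^ 2 := by
        rw [← mul_pow, ← sq_abs]
        exact pow_le_pow_left₀ (abs_nonneg _) (abs_real_inner_le_norm _ _) 2
      have h3 : a x * inner ℝ b (f x) ≤ N / 2 * a x ^ 2 + inner ℝ b (f x) ^ 2 / (2 * N) := by
        exact mul_le_half_sq_add_sq_div hNpos _ _
      have h4 : inner ℝ b (f x) ^ 2 / (2 * N) ≤ ‖b‖ ^ 2 * ‖f x‖ ^ 2 / (2 * N) :=
        div_le_div_of_nonneg_right h2 (mul_pos two_pos hNpos).le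
      calc _ ≤ _ := h3
        _ ≤ N / 2 * a x ^ 2 + ‖b‖ ^ 2 * ‖f x‖ ^ 2 / (2 * N) := by linarith
        _ = _ := by ring
    rw [integral_add (ia2.const_mul _) (if2.const_mul _), integral_const_mul, integral_const_mul,
      ← e1, ← hA, ← hN] at e2
    have : ‖b‖ ^ 2 / (2 * N) * N = ‖b‖ ^ 2 / 2 := by field_simp
    linarith
  -- the tilted probability measure for Jensen
  set ρ : Measure Ξ := μ.withDensity fun x => ENNReal.ofReal (‖f x‖ ^ 2 / N) with hρ
  have hρm : Measurable fun x => ENNReal.ofReal (‖f x‖ ^ 2 / N) := by fun_prop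
  have : IsProbabilityMeasure ρ := by
    constructor
    rw [hρ, withDensity_apply _ MeasurableSet.univ, Measure.restrict_univ,
      ← ofReal_integral_eq_lintegral_ofReal (if2.div_const N)
        (Filter.Eventually.of_forall fun x => by positivity), integral_div, ← hN,
      div_self hNpos.ne', ENNReal.ofReal_one]
  set u : Ξ → EuclideanSpace ℝ (Fin d) := fun x => ‖f x‖⁻¹ • f x with hu
  have hum : Measurable u := by fun_prop
  have hu1 : ∀ x, ‖u x‖ ≤ 1 := fun x => by
    rw [hu]; simp only [norm_smul, norm_inv, norm_norm]; exact inv_mul_le_one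
  have hzu : ∀ z x, |inner ℝ z (u x)| ≤ ‖z‖ := fun z x =>
    (abs_real_inner_le_norm _ _).trans (mul_le_of_le_one_right (norm_nonneg _) (hu1 x))
  have hρint : ∀ z, ∫ x, inner ℝ z (f x) ^ 2 ∂μ = N * ∫ x, inner ℝ z (u x) ^ 2 ∂ρ := fun z => by
    rw [hρ, integral_withDensity_eq_integral_toReal_smul hρm
      (Filter.Eventually.of_forall fun x => ENNReal.ofReal_lt_top), ← integral_const_mul]
    congr 1; funext x
    rw [ENNReal.toReal_ofReal (by positivity), hu]
    simp only [inner_smul_right, smul_eq_mul]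
    rcases eq_or_ne (f x) 0 with h | h
    · simp [h]
    · have : ‖f x‖ ≠ 0 := norm_ne_zero_iff.2 h
      field_simp
  have iu2 : ∀ z, Integrable (fun x => inner ℝ z (u x) ^ 2) ρ := fun z =>
    Integrable.of_bound (by fun_prop) (‖z‖ ^ 2) (Filter.Eventually.of_forall fun x => by
      rw [Real.norm_eq_abs, abs_pow]; exact pow_le_pow_left₀ (abs_nonneg _) (hzu z x) 2)
  -- The quadratic form of trace N is the mean under `ρ` of rank one forms N⟨z, u⟩² with ‖u‖ ≤ 1.
  -- Convexity of exp moves this mean outside, so the rank one case suffices.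
  have jensen : ∀ z, ENNReal.ofReal (Real.exp (s / 2 * ∫ x, (a x + inner ℝ z (f x)) ^ 2 ∂μ)) ≤
      ENNReal.ofReal (Real.exp (s / 2 * A)) * ∫⁻ x, ENNReal.ofReal (Real.exp (inner ℝ z (s • b) +
        s * N / 2 * inner ℝ z (u x) ^ 2)) ∂ρ := fun z => by
    have ie : Integrable (fun x => Real.exp (inner ℝ z (s • b) +
        s * N / 2 * inner ℝ z (u x) ^ 2)) ρ := by
      refine Integrable.of_bound (by fun_prop)
        (Real.exp (inner ℝ z (s • b) + s * N / 2 * ‖z‖ ^ 2))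
        (Filter.Eventually.of_forall fun x => ?_)
      rw [Real.norm_eq_abs, Real.abs_exp]
      refine Real.exp_le_exp.2 (add_le_add le_rfl (mul_le_mul_of_nonneg_left ?_ (by positivity)))
      rw [← sq_abs]; exact pow_le_pow_left₀ (abs_nonneg _) (hzu z x) 2
    have ii : Integrable (fun x => inner ℝ z (s • b) + s * N / 2 * inner ℝ z (u x) ^ 2) ρ :=
      (integrable_const _).add ((iu2 z).const_mul _)
    rw [← ofReal_integral_eq_lintegral_ofReal ie
      (Filter.Eventually.of_forall fun x => (Real.exp_pos _).le),
      ← ENNReal.ofReal_mul (Real.exp_pos _).le]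
    refine ENNReal.ofReal_le_ofReal ?_
    have hj := convexOn_exp.map_integral_le (μ := ρ) Real.continuous_exp.continuousOn isClosed_univ
      (Filter.Eventually.of_forall fun x => Set.mem_univ _) ii ie
    rw [integral_add (integrable_const _) ((iu2 z).const_mul _), integral_const_mul] at hj
    simp only [integral_const, probReal_univ, one_smul] at hj
    refine le_trans (le_of_eq ?_) (mul_le_mul_of_nonneg_left hj (Real.exp_pos _).le)
    rw [← Real.exp_add, expand, hρint, inner_smul_right]
    congr 1; ring
  refine (lintegral_mono jensen).trans ?_
  rw [lintegral_const_mul' _ _ ENNReal.ofReal_ne_top, lintegral_lintegral_swap (by fun_prop)]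
  have hb2 : ∀ x, ∫⁻ z, ENNReal.ofReal (Real.exp (inner ℝ z (s • b) +
      s * N / 2 * inner ℝ z (u x) ^ 2)) ∂(stdGaussian (EuclideanSpace ℝ (Fin d))) ≤
      ENNReal.ofReal ((√(1 - s * N))⁻¹ * Real.exp (‖s • b‖ ^ 2 / (2 * (1 - s * N)))) := fun x =>
    lintegral_exp_inner_add_sq_stdGaussian _ _ (hu1 x) (by positivity) hsN
  refine (mul_le_mul_right (lintegral_mono hb2) _).trans ?_
  rw [lintegral_const, measure_univ, mul_one, ← ENNReal.ofReal_mul (Real.exp_pos _).le,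
    mul_left_comm, ← Real.exp_add]
  refine ENNReal.ofReal_le_ofReal
    (mul_le_mul_of_nonneg_left (Real.exp_le_exp.2 ?_) (by positivity))
  rw [norm_smul, mul_pow, Real.norm_eq_abs, sq_abs]
  have : s / 2 * A + s ^ 2 * ‖b‖ ^ 2 / (2 * (1 - s * N)) ≤
      s / 2 * A + s ^ 2 * (N * A) / (2 * (1 - s * N)) := by gcongr
  refine this.trans (le_of_eq ?_)
  field_simp
  ring

/-! ### Gaussian processes with predictable drift -/

/-- A supermartingale argument. The left side of `step` does not see `v k`, and `step` holds for
every `v`; averaging it over that coordinate allows `F k` to depend on `v k`. -/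
theorem lintegral_pi_chain {K : ℕ} {X : Type*} [MeasurableSpace X] (μ : Measure X)
    [IsProbabilityMeasure μ] {F : ℕ → (Fin K → X) → ℝ≥0∞} (hF : ∀ k, Measurable (F k))
    (step : ∀ (k : Fin K) v, ∫⁻ y, F (k + 1) (Function.update v k y) ∂μ ≤ F k v) :
    ∫⁻ v, F K v ∂(Measure.pi fun _ => μ) ≤ ∫⁻ v, F 0 v ∂(Measure.pi fun _ => μ) := by
  have key : ∀ j ≤ K, ∫⁻ v, F j v ∂(Measure.pi fun _ => μ) ≤
      ∫⁻ v, F 0 v ∂(Measure.pi fun _ => μ) := by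
    intro j
    induction j with
    | zero => exact fun _ => le_rfl
    | succ j ih =>
      intro hj
      refine le_trans (lintegral_pi_le_of_update μ ⟨j, hj⟩ (hF _) (hF j) fun v => ?_)
        (ih (by omega))
      have : ∀ y', ∫⁻ y, F (j + 1) (Function.update v ⟨j, hj⟩ y) ∂μ ≤
          F j (Function.update v ⟨j, hj⟩ y') := fun y' => by
        simpa using step ⟨j, hj⟩ (Function.update v ⟨j, hj⟩ y')
      calc ∫⁻ y, F (j + 1) (Function.update v ⟨j, hj⟩ y) ∂μ
          = ∫⁻ _, (∫⁻ y, F (j + 1) (Function.update v ⟨j, hj⟩ y) ∂μ) ∂μ := by simp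
        _ ≤ _ := lintegral_mono this
  exact key K le_rfl

/-- `g` depends at time `k` only on the coordinates before `k`. -/
def DependsOnPast {K : ℕ} {V β : Type*} (g : Fin K → (Fin K → V) → β) : Prop :=
  ∀ k v v', (∀ j < k, v j = v' j) → g k v = g k v'

theorem DependsOnPast.update {K : ℕ} {V β : Type*} {g : Fin K → (Fin K → V) → β}
    (hg : DependsOnPast g) {k j : Fin K} (hkj : k ≤ j) (v : Fin K → V) (y : V) :
    g k (Function.update v j y) = g k v :=
  hg k _ _ fun _ hi => Function.update_of_ne (ne_of_lt (lt_of_lt_of_le hi hkj)) _ _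

theorem filter_lt_succ {K : ℕ} (k : Fin K) :
    (Finset.univ.filter fun i : Fin K => i.val < k.val + 1) =
      insert k (Finset.univ.filter fun i : Fin K => i.val < k.val) := by
  ext i
  simp only [Finset.mem_filter, Finset.mem_univ, true_and, Finset.mem_insert, Fin.ext_iff]
  omega

section Gauss

variable {d K : ℕ}

local notation "V" => EuclideanSpace ℝ (Fin d)

@[fun_prop]
theorem Measurable.gaussianShift {X : Type*} [MeasurableSpace X] {g h : X → V}
    (hg : Measurable g) (hh : Measurable h) :
    Measurable fun x => _root_.gaussianShift (g x) (h x) := by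
  unfold _root_.gaussianShift; fun_prop

/-- The density of the first `j` steps of the Gaussian process with drift `c`. -/
noncomputable def likUpTo (c : Fin K → (Fin K → V) → V) (j : ℕ) (v : Fin K → V) : ℝ≥0∞ :=
  ∏ k ∈ Finset.univ.filter (fun k : Fin K => k.val < j), gaussianShift (v k) (c k v)

/-- The density of the Gaussian process with predictable drift `c`, with respect to white noise. -/
noncomputable def lik (c : Fin K → (Fin K → V) → V) (v : Fin K → V) : ℝ≥0∞ :=
  ∏ k, gaussianShift (v k) (c k v)

/-- White noise on `K` steps. -/
noncomputable abbrev whiteNoise (d K : ℕ) : Measure (Fin K → EuclideanSpace ℝ (Fin d)) :=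
  Measure.pi fun _ => stdGaussian (EuclideanSpace ℝ (Fin d))

theorem likUpTo_zero (c : Fin K → (Fin K → V) → V) (v : Fin K → V) : likUpTo c 0 v = 1 := by
  simp [likUpTo]

theorem likUpTo_self (c : Fin K → (Fin K → V) → V) (v : Fin K → V) : likUpTo c K v = lik c v := by
  simp [likUpTo, lik]

theorem likUpTo_succ_update {c : Fin K → (Fin K → V) → V} (hc : DependsOnPast c) (k : Fin K)
    (v : Fin K → V) (y : V) : likUpTo c (k + 1) (Function.update v k y) =
      gaussianShift y (c k v) * likUpTo c k v := by
  rw [likUpTo, filter_lt_succ, Finset.prod_insert (by simp), Function.update_self,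
    hc.update le_rfl, likUpTo]
  congr 1
  refine Finset.prod_congr rfl fun i hi => ?_
  have hi' : i < k := by simpa using hi
  rw [hc.update hi'.le, Function.update_of_ne hi'.ne]

theorem likUpTo_update_self {c : Fin K → (Fin K → V) → V} (hc : DependsOnPast c) (k : Fin K)
    (v : Fin K → V) (y : V) : likUpTo c k (Function.update v k y) = likUpTo c k v := by
  refine Finset.prod_congr rfl fun i hi => ?_
  have hi' : i < k := by simpa using hi
  rw [hc.update hi'.le, Function.update_of_ne hi'.ne]

theorem measurable_likUpTo {c : Fin K → (Fin K → V) → V} (hm : ∀ k, Measurable (c k)) (j : ℕ) :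
    Measurable (likUpTo c j) :=
  Finset.measurable_fun_prod _ fun k _ => Measurable.gaussianShift (by fun_prop) (hm k)

theorem measurable_lik {c : Fin K → (Fin K → V) → V} (hm : ∀ k, Measurable (c k)) :
    Measurable (lik c) :=
  Finset.measurable_fun_prod _ fun k _ => Measurable.gaussianShift (by fun_prop) (hm k)

theorem lintegral_comp_add_stdGaussian (c : V) {Ψ : V → ℝ≥0∞} (hΨ : Measurable Ψ) :
    ∫⁻ z, Ψ (z + c) ∂(stdGaussian V) = ∫⁻ y, gaussianShift y c * Ψ y ∂(stdGaussian V) := by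
  rw [← lintegral_gaussianShift_mul_comp_sub c (Ψ := fun z => Ψ (z + c)) (by fun_prop)]
  simp

/-- Backward induction for the Gaussian process with drift `c`. -/
theorem lintegral_lik_mul_le {c : Fin K → (Fin K → V) → V} (hc : DependsOnPast c)
    (hm : ∀ k, Measurable (c k)) {G : ℕ → (Fin K → V) → ℝ≥0∞} (hG : ∀ k, Measurable (G k))
    (step : ∀ (k : Fin K) v,
      ∫⁻ z, G (k + 1) (Function.update v k (z + c k v)) ∂(stdGaussian V) ≤ G k v) :
    ∫⁻ v, lik c v * G K v ∂(whiteNoise d K) ≤ ∫⁻ v, G 0 v ∂(whiteNoise d K) := by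
  have h := lintegral_pi_chain (stdGaussian V) (F := fun j v => likUpTo c j v * G j v)
    (fun j => (measurable_likUpTo hm j).mul (hG j)) fun k v => by
      have hΨ : Measurable fun y => G (k + 1) (Function.update v k y) := by fun_prop
      simp only [likUpTo_succ_update hc]
      have e := lintegral_comp_add_stdGaussian (c k v) hΨ
      have e2 : ∀ y, gaussianShift y (c k v) * likUpTo c k v * G (k + 1) (Function.update v k y) =
          likUpTo c k v * (gaussianShift y (c k v) * G (k + 1) (Function.update v k y)) :=
        fun y => by ring
      simp only [e2]
      rw [lintegral_const_mul _ (by fun_prop), ← e]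
      exact mul_le_mul_right (step k v) _
  simpa only [likUpTo_self, likUpTo_zero, one_mul] using h

theorem lintegral_lik_le {c : Fin K → (Fin K → V) → V} (hc : DependsOnPast c)
    (hm : ∀ k, Measurable (c k)) : ∫⁻ v, lik c v ∂(whiteNoise d K) ≤ 1 := by
  simpa using lintegral_lik_mul_le hc hm (G := fun _ _ => 1) (fun _ => measurable_const)
    (fun k v => by simp)

/-- Adding the drift of step `k`. -/
def driftStep (c : Fin K → (Fin K → V) → V) (k : Fin K) (v : Fin K → V) : Fin K → V :=
  Function.update v k (v k + c k v)

/-- Adding the drift of the first `j` steps: the Gaussian process driven by the noise `v`. -/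
def driftUpTo (c : Fin K → (Fin K → V) → V) : ℕ → (Fin K → V) → (Fin K → V)
  | 0, v => v
  | j + 1, v => if h : j < K then driftStep c ⟨j, h⟩ (driftUpTo c j v) else driftUpTo c j v

theorem measurable_driftStep {c : Fin K → (Fin K → V) → V} (hm : ∀ k, Measurable (c k))
    (k : Fin K) : Measurable (driftStep c k) := by
  have := hm k
  unfold driftStep
  refine measurable_pi_lambda _ fun i => ?_
  by_cases h : i = k
  · subst h; simp only [Function.update_self]; fun_prop
  · simp only [Function.update_of_ne h]; fun_prop

/-- Girsanov's formula in discrete time. -/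
theorem lintegral_comp_driftUpTo {c : Fin K → (Fin K → V) → V} (hc : DependsOnPast c)
    (hm : ∀ k, Measurable (c k)) {F : (Fin K → V) → ℝ≥0∞} (hF : Measurable F) :
    ∫⁻ v, F (driftUpTo c K v) ∂(whiteNoise d K) = ∫⁻ v, lik c v * F v ∂(whiteNoise d K) := by
  -- Step `j` is added last and can be absorbed into `F`, so `F` has to vary in the induction. The
  -- shift of coordinate `j` alone then produces the next density factor.
  have key : ∀ j ≤ K, ∀ F : (Fin K → V) → ℝ≥0∞, Measurable F →
      ∫⁻ v, F (driftUpTo c j v) ∂(whiteNoise d K) =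
        ∫⁻ v, likUpTo c j v * F v ∂(whiteNoise d K) := by
    intro j
    induction j with
    | zero => intro _ F _; simp [driftUpTo, likUpTo_zero]
    | succ j ih =>
      intro hj F hF
      have hj' : j < K := hj
      have hFs : Measurable fun v => F (driftStep c ⟨j, hj⟩ v) :=
        hF.comp (measurable_driftStep hm _)
      simp only [driftUpTo, hj', dif_pos]
      rw [ih (by omega) (fun v => F (driftStep c ⟨j, hj⟩ v)) hFs]
      refine lintegral_pi_eq_of_update _ ⟨j, hj⟩ ((measurable_likUpTo hm j).mul hFs)
        ((measurable_likUpTo hm _).mul hF) fun v => ?_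
      have e1 := fun y => likUpTo_succ_update hc ⟨j, hj⟩ v y
      have e2 := fun y => likUpTo_update_self hc ⟨j, hj⟩ v y
      simp only at e1 e2
      have e3 : ∀ y, driftStep c ⟨j, hj⟩ (Function.update v ⟨j, hj⟩ y) =
          Function.update v ⟨j, hj⟩ (y + c ⟨j, hj⟩ v) := fun y => by
        simp [driftStep, hc.update le_rfl]
      simp only [e1, e2, e3]
      have hΨ : Measurable fun y => F (Function.update v ⟨j, hj⟩ y) := by fun_prop
      have e := lintegral_comp_add_stdGaussian (c ⟨j, hj⟩ v) hΨ
      rw [lintegral_const_mul _ (by fun_prop), e, ← lintegral_const_mul _ (by fun_prop)]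
      refine lintegral_congr fun y => by ring
  rw [key K le_rfl F hF]
  simp only [likUpTo_self]

/-- A coordinate changes only when its own step is added, and by then all earlier coordinates are
final. As the drift sees only these, it can be evaluated at the finished path; this is the recursion
that the algorithm follows. -/
theorem driftUpTo_apply {c : Fin K → (Fin K → V) → V} (hc : DependsOnPast c) (z : Fin K → V)
    (k : Fin K) : driftUpTo c K z k = z k + c k (driftUpTo c K z) := by
  have later : ∀ j, ∀ i : Fin K, j ≤ i.val → driftUpTo c j z i = z i := by
    intro j
    induction j with
    | zero => intro i _; rfl
    | succ j ih =>
      intro i hi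
      simp only [driftUpTo]
      split_ifs with h
      · rw [driftStep, Function.update_of_ne (by simp [Fin.ext_iff]; omega), ih i (by omega)]
      · exact ih i (by omega)
  have stable : ∀ j, ∀ i : Fin K, i.val < j → ∀ l, driftUpTo c (j + l) z i = driftUpTo c j z i := by
    intro j i hi l
    induction l with
    | zero => rfl
    | succ l ih =>
      rw [← add_assoc]
      simp only [driftUpTo]
      split_ifs with h
      · rw [driftStep, Function.update_of_ne (by simp [Fin.ext_iff]; omega), ih]
      · exact ih
  have stable' : ∀ i : Fin K, ∀ j, i.val < j → j ≤ K → driftUpTo c K z i = driftUpTo c j z i := by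
    intro i j hij hj
    obtain ⟨l, rfl⟩ := Nat.exists_eq_add_of_le hj
    exact stable j i hij l
  have h1 := stable' k (k + 1) (by omega) (by omega)
  rw [h1]
  simp only [driftUpTo, k.isLt, dif_pos, driftStep, Function.update_self]
  rw [later k k le_rfl]
  congr 1
  refine hc k _ _ fun i hi => ?_
  exact (stable' i k hi k.isLt.le).symm

end Gauss

/-! ### Exponential moments of squared noise projections -/

theorem measurable_integral_right {α β : Type*} [MeasurableSpace α] [MeasurableSpace β]
    (ν : Measure β) [SFinite ν] {f : α → β → ℝ} (hf : Measurable (Function.uncurry f)) :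
    Measurable fun x => ∫ y, f x y ∂ν :=
  (hf.stronglyMeasurable.integral_prod_right (ν := ν)).measurable

theorem integrable_of_abs_le {Ξ : Type*} [MeasurableSpace Ξ] (μ : Measure Ξ) [IsFiniteMeasure μ]
    {g : Ξ → ℝ} (hg : Measurable g) (D : ℝ) (hD : ∀ x, |g x| ≤ D) : Integrable g μ :=
  Integrable.of_bound hg.aestronglyMeasurable D (Filter.Eventually.of_forall hD)

section

variable {d : ℕ}

local notation "V" => EuclideanSpace ℝ (Fin d)

/-- Exponential moment of a weighted sum of squares of affine functions of a standard Gaussian. -/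
theorem lintegral_exp_sum_integral_sq_stdGaussian {ι Ξ : Type*} [Countable ι] [MeasurableSpace Ξ]
    (I : Finset ι) (κ : ι → Measure Ξ) [∀ i, IsProbabilityMeasure (κ i)] {a : ι → Ξ → ℝ}
    {f : ι → Ξ → V} (ha : ∀ i, Measurable (a i)) (hf : ∀ i, Measurable (f i)) {C : ℝ}
    (haC : ∀ i x, |a i x| ≤ C) (hfC : ∀ i x, ‖f i x‖ ≤ C)
    {s ν : ℝ} (hs : 0 ≤ s) (hν : ∑ i ∈ I, ∫ x, ‖f i x‖ ^ 2 ∂(κ i) ≤ ν) (hsν : s * ν < 1) :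
    ∫⁻ z, ENNReal.ofReal (Real.exp (s / 2 *
        ∑ i ∈ I, ∫ x, (a i x + inner ℝ z (f i x)) ^ 2 ∂(κ i))) ∂(stdGaussian V) ≤
      ENNReal.ofReal ((√(1 - s * ν))⁻¹ *
        Real.exp (s / (2 * (1 - s * ν)) * ∑ i ∈ I, ∫ x, a i x ^ 2 ∂(κ i))) := by
  let _ : MeasurableSpace ι := ⊤
  have : MeasurableSingletonClass ι := ⟨fun _ => trivial⟩
  -- One finite measure on pairs turns the sum of integrals into a single integral.
  set μ : Measure (ι × Ξ) := ∑ i ∈ I, (κ i).map (Prod.mk i) with hμ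
  have hfin : IsFiniteMeasure μ := by
    constructor
    rw [hμ, Measure.finsetSum_apply]
    exact ENNReal.sum_lt_top.2 fun i _ => measure_lt_top _ _
  have hmu : ∀ {E : Type} [MeasurableSpace E] {g : ι → Ξ → E}, (∀ i, Measurable (g i)) →
      Measurable fun p : ι × Ξ => g p.1 p.2 := fun hg => measurable_from_prod_countable_right hg
  have hint : ∀ {g : ι × Ξ → ℝ} (_ : Measurable g) (D : ℝ) (_ : ∀ x, |g x| ≤ D),
      ∫ p, g p ∂μ = ∑ i ∈ I, ∫ x, g (i, x) ∂(κ i) := by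
    intro g hg D hD
    rw [hμ, integral_finsetSum_measure fun i _ => integrable_of_abs_le _ hg D hD]
    refine Finset.sum_congr rfl fun i _ => ?_
    rw [integral_map (by fun_prop) hg.aestronglyMeasurable]
  have ham : Measurable fun p : ι × Ξ => a p.1 p.2 := hmu ha
  have hfm : Measurable fun p : ι × Ξ => f p.1 p.2 := hmu hf
  have hsq : ∀ {x y : ℝ}, |x| ≤ y → |x ^ 2| ≤ y ^ 2 := fun h => by
    rw [abs_pow]; exact pow_le_pow_left₀ (abs_nonneg _) h 2
  have e1 : ∫ p, ‖f p.1 p.2‖ ^ 2 ∂μ = ∑ i ∈ I, ∫ x, ‖f i x‖ ^ 2 ∂(κ i) :=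
    hint (g := fun p => ‖f p.1 p.2‖ ^ 2) (by fun_prop) (C ^ 2)
      fun x => hsq (by rw [abs_norm]; exact hfC _ _)
  have e2 : ∫ p, a p.1 p.2 ^ 2 ∂μ = ∑ i ∈ I, ∫ x, a i x ^ 2 ∂(κ i) :=
    hint (g := fun p => a p.1 p.2 ^ 2) (by fun_prop) (C ^ 2) fun x => hsq (haC _ _)
  have e3 : ∀ z : V, ∫ p, (a p.1 p.2 + inner ℝ z (f p.1 p.2)) ^ 2 ∂μ =
      ∑ i ∈ I, ∫ x, (a i x + inner ℝ z (f i x)) ^ 2 ∂(κ i) := fun z =>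
    hint (g := fun p => (a p.1 p.2 + inner ℝ z (f p.1 p.2)) ^ 2) (by fun_prop)
      ((C + ‖z‖ * C) ^ 2) fun x => hsq ((abs_add_le _ _).trans (add_le_add (haC _ _)
        ((abs_real_inner_le_norm _ _).trans (by gcongr; exact hfC _ _))))
  have h := lintegral_exp_integral_sq_stdGaussian μ ham hfm (fun p => haC p.1 p.2)
    (fun p => hfC p.1 p.2) hs (e1.trans_le hν) hsν
  simpa only [e2, e3] using h

end

/-- A family of bounded vector fields, one for each step, that depend on a data point and on the
previous path. -/
structure PathField (𝒳 : Type*) [MeasurableSpace 𝒳] (d K : ℕ) (b : ℝ) where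
  /-- the vector field of a step -/
  toFun : Fin K → 𝒳 → (Fin K → EuclideanSpace ℝ (Fin d)) → EuclideanSpace ℝ (Fin d)
  past : ∀ x, DependsOnPast fun k => toFun k x
  meas : ∀ k, Measurable fun p : 𝒳 × (Fin K → EuclideanSpace ℝ (Fin d)) => toFun k p.1 p.2
  bound : ∀ k x v, ‖toFun k x v‖ ≤ b

namespace PathField

variable {𝒳 : Type*} [MeasurableSpace 𝒳] {d K n : ℕ} {b : ℝ}

local notation "V" => EuclideanSpace ℝ (Fin d)

/-- The sum of the vector fields over batches of data points. -/
noncomputable def drift (o : PathField 𝒳 d K b) (I : Fin K → Finset (Fin n)) (S : Fin n → 𝒳) (k : Fin K)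
    (v : Fin K → V) : V := ∑ i ∈ I k, o.toFun k (S i) v

theorem past_drift (o : PathField 𝒳 d K b) (I : Fin K → Finset (Fin n)) (S : Fin n → 𝒳) :
    DependsOnPast (o.drift I S) :=
  fun k v v' h => Finset.sum_congr rfl fun i _ => o.past (S i) k v v' h

@[fun_prop]
theorem measurable_toFun (o : PathField 𝒳 d K b) (k : Fin K) {X : Type*} [MeasurableSpace X]
    {g : X → 𝒳} {h : X → Fin K → V} (hg : Measurable g) (hh : Measurable h) :
    Measurable fun p => o.toFun k (g p) (h p) := (o.meas k).comp (hg.prodMk hh)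

@[fun_prop]
theorem measurable_drift (o : PathField 𝒳 d K b) (I : Fin K → Finset (Fin n)) (k : Fin K)
    {X : Type*} [MeasurableSpace X] {g : X → Fin n → 𝒳} {h : X → Fin K → V}
    (hg : Measurable g) (hh : Measurable h) : Measurable fun p => o.drift I (g p) k (h p) := by
  unfold drift
  fun_prop

/-- The noise of the steps `k < j` with `i ∈ I k`, projected to the vector field at `x`. -/
noncomputable def noise (o : PathField 𝒳 d K b) (c : Fin K → (Fin K → V) → V) (I : Fin K → Finset (Fin n))
    (j : ℕ) (i : Fin n) (x : 𝒳) (v : Fin K → V) : ℝ :=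
  ∑ k ∈ Finset.univ.filter (fun k : Fin K => k.val < j),
    if i ∈ I k then inner ℝ (v k - c k v) (o.toFun k x v) else 0

theorem measurable_noise (o : PathField 𝒳 d K b) {c : Fin K → (Fin K → V) → V}
    (hm : ∀ k, Measurable (c k)) (I : Fin K → Finset (Fin n)) (j : ℕ) (i : Fin n) :
    Measurable fun p : (Fin K → V) × 𝒳 => o.noise c I j i p.2 p.1 := by
  unfold noise
  refine Finset.measurable_fun_sum _ fun k _ => ?_
  have := hm k
  split_ifs <;> fun_prop

theorem measurable_noise_left (o : PathField 𝒳 d K b) (c : Fin K → (Fin K → V) → V)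
    (I : Fin K → Finset (Fin n)) (j : ℕ) (i : Fin n) (v : Fin K → V) :
    Measurable fun x => o.noise c I j i x v := by
  unfold noise
  refine Finset.measurable_fun_sum _ fun k _ => ?_
  split_ifs <;> fun_prop

theorem abs_noise_le (o : PathField 𝒳 d K b) (c : Fin K → (Fin K → V) → V)
    (I : Fin K → Finset (Fin n)) (j : ℕ) (i : Fin n) (x : 𝒳) (v : Fin K → V) :
    |o.noise c I j i x v| ≤ ∑ k, ‖v k - c k v‖ * |b| := by
  unfold noise
  refine (Finset.abs_sum_le_sum_abs _ _).trans ((Finset.sum_le_sum fun k _ => ?_).trans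
    (Finset.sum_le_sum_of_subset_of_nonneg (Finset.subset_univ _) fun k _ _ => by positivity))
  split_ifs
  · refine (abs_real_inner_le_norm _ _).trans ?_
    gcongr
    exact (o.bound _ _ _).trans (le_abs_self b)
  · simp; positivity

/-- The new coordinate is written as noise plus drift, so centering it leaves exactly `z`; the
earlier summands depend only on earlier coordinates. -/
theorem noise_succ_update (o : PathField 𝒳 d K b) {c : Fin K → (Fin K → V) → V}
    (hc : DependsOnPast c) (I : Fin K → Finset (Fin n)) (k : Fin K) (i : Fin n) (x : 𝒳)
    (v : Fin K → V) (z : V) :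
    o.noise c I (k + 1) i x (Function.update v k (z + c k v)) =
      o.noise c I k i x v + if i ∈ I k then inner ℝ z (o.toFun k x v) else 0 := by
  have hp := o.past x
  rw [noise, filter_lt_succ, Finset.sum_insert (by simp), Function.update_self,
    hc.update le_rfl, hp.update le_rfl, add_sub_cancel_right, add_comm, noise]
  congr 1
  refine Finset.sum_congr rfl fun j hj => ?_
  have hj' : j < k := by simpa using hj
  rw [hc.update hj'.le, Function.update_of_ne hj'.ne, hp.update hj'.le]

set_option maxHeartbeats 1000000 in
/-- Exponential moment of a weighted sum of the squared noise projections. -/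
theorem lintegral_lik_mul_exp_noise_sq_le (o : PathField 𝒳 d K b) {c : Fin K → (Fin K → V) → V}
    (hc : DependsOnPast c) (hm : ∀ k, Measurable (c k)) (I : Fin K → Finset (Fin n))
    (κ : Fin n → Measure 𝒳) [∀ i, IsProbabilityMeasure (κ i)] {ν : ℝ}
    (hν : ∀ k, (I k).card * b ^ 2 ≤ ν) (s : ℕ → Fin n → ℝ) (τ : Fin K → ℝ)
    (hτ0 : ∀ k, 0 ≤ τ k) (hτ : ∀ k, τ k * ν < 1)
    (hs1 : ∀ (k : Fin K), ∀ i ∈ I k, s (k + 1) i ≤ τ k)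
    (hs2 : ∀ (k : Fin K), ∀ i ∈ I k, τ k / (1 - τ k * ν) ≤ s k i)
    (hs3 : ∀ (k : Fin K), ∀ i ∉ I k, s (k + 1) i ≤ s k i) :
    ∫⁻ v, lik c v * ENNReal.ofReal (Real.exp (1 / 2 *
        ∑ i, s K i * ∫ x, o.noise c I K i x v ^ 2 ∂(κ i))) ∂(whiteNoise d K) ≤
      ENNReal.ofReal (∏ k, (√(1 - τ k * ν))⁻¹) := by
  -- The functions of the backward induction: the factors of the steps from `j` on, times the
  -- exponential with the weights of time `j`. Going back over step `k`, the weight `τ k` of a point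
  -- in the batch becomes τ/(1 - τν) at the cost of a factor (1 - τν)^(-1/2), where ν bounds the
  -- trace of the quadratic form; for the other points monotone weights are enough.
  have h := lintegral_lik_mul_le hc hm (G := fun j v => ENNReal.ofReal
    ((∏ k ∈ Finset.univ.filter (fun k : Fin K => j ≤ k.val), (√(1 - τ k * ν))⁻¹) *
      Real.exp (1 / 2 * ∑ i, s j i * ∫ x, o.noise c I j i x v ^ 2 ∂(κ i)))) ?_ ?_
  · have e0 : (Finset.univ.filter fun k : Fin K => K ≤ k.val) = ∅ := by
      ext k; simp
    simpa [e0, noise] using h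
  · intro j
    have h1 : ∀ i, Measurable fun v => ∫ x, o.noise c I j i x v ^ 2 ∂(κ i) := fun i =>
      measurable_integral_right (κ i) (f := fun v x => o.noise c I j i x v ^ 2)
        ((o.measurable_noise hm I j i).pow_const 2)
    fun_prop
  · intro k v
    simp only [o.noise_succ_update hc]
    set D := ∑ k, ‖v k - c k v‖ * |b| with hD
    have hD0 : 0 ≤ D := by positivity
    have hprod : (∏ l ∈ Finset.univ.filter (fun l : Fin K => k.val ≤ l.val),
        (√(1 - τ l * ν))⁻¹) = (√(1 - τ k * ν))⁻¹ *
        ∏ l ∈ Finset.univ.filter (fun l : Fin K => k.val + 1 ≤ l.val), (√(1 - τ l * ν))⁻¹ := by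
      have : (Finset.univ.filter fun l : Fin K => k.val ≤ l.val) =
          insert k (Finset.univ.filter fun l : Fin K => k.val + 1 ≤ l.val) := by
        ext l
        simp only [Finset.mem_filter, Finset.mem_univ, true_and, Finset.mem_insert, Fin.ext_iff]
        omega
      rw [this, Finset.prod_insert (by simp)]
    rw [hprod]
    set Q := ∏ l ∈ Finset.univ.filter (fun l : Fin K => k.val + 1 ≤ l.val), (√(1 - τ l * ν))⁻¹
      with hQ
    have hQ0 : 0 ≤ Q := Finset.prod_nonneg fun _ _ => by positivity
    set a : Fin n → 𝒳 → ℝ := fun i x => o.noise c I k i x v with ha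
    set J := (I k)ᶜ with hJ
    set R := ∑ i ∈ J, s k i * ∫ x, a i x ^ 2 ∂(κ i) with hR
    have split : ∀ g : Fin n → ℝ, ∑ i, g i = ∑ i ∈ I k, g i + ∑ i ∈ J, g i := fun g =>
      (Finset.sum_add_sum_compl _ _).symm
    have bd : ∀ z : V, 1 / 2 * ∑ i, s (k + 1) i *
        ∫ x, (o.noise c I k i x v + if i ∈ I k then inner ℝ z (o.toFun k x v) else 0) ^ 2 ∂(κ i) ≤
        1 / 2 * R + τ k / 2 * ∑ i ∈ I k, ∫ x, (a i x + inner ℝ z (o.toFun k x v)) ^ 2 ∂(κ i) := by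
      intro z
      rw [split]
      have h1 : ∑ i ∈ I k, s (k + 1) i *
          ∫ x, (o.noise c I k i x v + if i ∈ I k then inner ℝ z (o.toFun k x v) else 0) ^ 2
            ∂(κ i) ≤ τ k * ∑ i ∈ I k, ∫ x, (a i x + inner ℝ z (o.toFun k x v)) ^ 2 ∂(κ i) := by
        rw [Finset.mul_sum]
        refine Finset.sum_le_sum fun i hi => ?_
        simp only [hi, if_true]
        exact mul_le_mul_of_nonneg_right (hs1 k i hi) (integral_nonneg fun x => sq_nonneg _)
      have h2 : ∑ i ∈ J, s (k + 1) i *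
          ∫ x, (o.noise c I k i x v + if i ∈ I k then inner ℝ z (o.toFun k x v) else 0) ^ 2
            ∂(κ i) ≤ R := by
        refine Finset.sum_le_sum fun i hi => ?_
        have hi' : i ∉ I k := by simpa [hJ] using hi
        simp only [hi', if_false, add_zero]
        exact mul_le_mul_of_nonneg_right (hs3 k i hi') (integral_nonneg fun x => sq_nonneg _)
      linarith
    have ham : ∀ i, Measurable (a i) := fun i =>
      o.measurable_noise_left c I k i v
    have hmain := lintegral_exp_sum_integral_sq_stdGaussian (I k) κ (a := a)
      (f := fun _ x => o.toFun k x v) (C := D + |b|)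
      ham (fun i => by fun_prop)
      (fun i x => (o.abs_noise_le c I k i x v).trans (by linarith [abs_nonneg b]))
      (fun i x => (o.bound _ _ _).trans (by linarith [le_abs_self b])) (hτ0 k) (ν := ν)
      (by
        refine le_trans ?_ (hν k)
        rw [← nsmul_eq_mul]
        refine Finset.sum_le_card_nsmul _ _ _ fun i _ => ?_
        have hb : ∀ x, ‖o.toFun k x v‖ ^ 2 ≤ b ^ 2 := fun x =>
          pow_le_pow_left₀ (norm_nonneg _) (o.bound _ _ _) 2
        refine (integral_mono_of_nonneg (Filter.Eventually.of_forall fun x => sq_nonneg _)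
          (integrable_const (b ^ 2)) (Filter.Eventually.of_forall hb)).trans ?_
        simp) (hτ k)
    have h1t : 0 < 1 - τ k * ν := by linarith [hτ k]
    calc _ ≤ ∫⁻ z : V, ENNReal.ofReal (Q * Real.exp (1 / 2 * R)) * ENNReal.ofReal (Real.exp
            (τ k / 2 * ∑ i ∈ I k, ∫ x, (a i x + inner ℝ z (o.toFun k x v)) ^ 2 ∂(κ i)))
            ∂(stdGaussian V) := by
          refine lintegral_mono fun z => ?_
          rw [← ENNReal.ofReal_mul (by positivity), mul_assoc, ← Real.exp_add]
          exact ENNReal.ofReal_le_ofReal (mul_le_mul_of_nonneg_left (Real.exp_le_exp.2 (bd z)) hQ0)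
      _ ≤ ENNReal.ofReal (Q * Real.exp (1 / 2 * R)) * ENNReal.ofReal ((√(1 - τ k * ν))⁻¹ *
            Real.exp (τ k / (2 * (1 - τ k * ν)) * ∑ i ∈ I k, ∫ x, a i x ^ 2 ∂(κ i))) := by
          rw [lintegral_const_mul' _ _ ENNReal.ofReal_ne_top]
          exact mul_le_mul_right hmain _
      _ ≤ _ := by
          rw [← ENNReal.ofReal_mul (by positivity)]
          refine ENNReal.ofReal_le_ofReal ?_
          rw [split]
          have h3 : τ k / (2 * (1 - τ k * ν)) * ∑ i ∈ I k, ∫ x, a i x ^ 2 ∂(κ i) ≤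
              1 / 2 * ∑ i ∈ I k, s k i * ∫ x, a i x ^ 2 ∂(κ i) := by
            rw [Finset.mul_sum, Finset.mul_sum]
            refine Finset.sum_le_sum fun i hi => ?_
            have h4 : τ k / (2 * (1 - τ k * ν)) = 1 / 2 * (τ k / (1 - τ k * ν)) := by
              rw [div_mul_eq_div_div, div_right_comm]; ring
            rw [h4, mul_assoc]
            exact mul_le_mul_of_nonneg_left (mul_le_mul_of_nonneg_right (hs2 k i hi)
              (integral_nonneg fun x => sq_nonneg _)) (by norm_num)
          calc _ = (√(1 - τ k * ν))⁻¹ * Q * Real.exp (1 / 2 * R + τ k / (2 * (1 - τ k * ν)) *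
                ∑ i ∈ I k, ∫ x, a i x ^ 2 ∂(κ i)) := by rw [Real.exp_add]; ring
            _ ≤ _ := by
              refine mul_le_mul_of_nonneg_left (Real.exp_le_exp.2 ?_) (by positivity)
              rw [mul_add]
              linarith

end PathField

theorem prod_range_mul_div {M : Type*} [CommMonoid M] (φ : ℕ → M) (E : ℕ) {T : ℕ} (hT : 0 < T) :
    ∏ k ∈ Finset.range (E * T), φ (k / T) = (∏ e ∈ Finset.range E, φ e) ^ T := by
  induction E with
  | zero => simp
  | succ E ih =>
    rw [Nat.succ_mul, Finset.prod_range_add, ih, Finset.prod_range_succ, mul_pow]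
    congr 1
    rw [Finset.prod_congr rfl (g := fun _ => φ E)]
    · simp
    · intro x hx
      have : (E * T + x) / T = E := by
        rw [mul_comm, Nat.mul_add_div hT, Nat.div_eq_of_lt (Finset.mem_range.1 hx), add_zero]
      rw [this]

namespace PathField

variable {𝒳 : Type*} [MeasurableSpace 𝒳] {d K n : ℕ} {b : ℝ}

local notation "V" => EuclideanSpace ℝ (Fin d)

/-- Exponential moment of the squared noise projections when every data point is used at most once
per epoch of `T` steps. -/
theorem lintegral_lik_mul_exp_noise_sq_epochs_le (o : PathField 𝒳 d K b)
    {c : Fin K → (Fin K → V) → V} (hc : DependsOnPast c) (hm : ∀ k, Measurable (c k))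
    (I : Fin K → Finset (Fin n)) (κ : Fin n → Measure 𝒳) [∀ i, IsProbabilityMeasure (κ i)] {ν : ℝ}
    (hν0 : 0 ≤ ν) (hν : ∀ k, (I k).card * b ^ 2 ≤ ν) {T E : ℕ} (hT : 0 < T) (hK : K = E * T)
    (hI : ∀ k k' : Fin K, k ≠ k' → k.val / T = k'.val / T → Disjoint (I k) (I k')) {s : ℝ}
    (hs : 0 ≤ s) (hsν : s * E * ν < 1) :
    ∫⁻ v, lik c v * ENNReal.ofReal (Real.exp (s / 2 *
        ∑ i, ∫ x, o.noise c I K i x v ^ 2 ∂(κ i))) ∂(whiteNoise d K) ≤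
      ENNReal.ofReal (Real.exp (-(T / 2) * Real.log (1 - s * E * ν))) := by
  classical
  obtain ⟨ep, hepd⟩ : ∃ ep : ℕ → ℕ, ∀ j, ep j = j / T := ⟨_, fun _ => rfl⟩
  simp only [← hepd] at hI
  -- For the weight τ = s / g(r), the raised weight τ/(1 - τν) is s / g(r + 1): each use of a point
  -- lowers the reciprocal of its weight by ν.
  set g : ℝ → ℝ := fun r => 1 - s * ν * r with hg
  have hgpos : ∀ r : ℝ, r ≤ E → 0 < g r := fun r hr => by
    have : s * ν * r ≤ s * ν * E := by gcongr
    simp only [hg]; nlinarith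
  have hgmono : ∀ r r' : ℝ, r ≤ r' → g r' ≤ g r := fun r r' h => by
    have : s * ν * r ≤ s * ν * r' := by gcongr
    simp only [hg]; linarith
  -- A bound on the uses of point `i` from step `j` on: one for each later epoch, and one for the
  -- current epoch if the point is still to come in it. After the last step it is zero, by truncated
  -- subtraction.
  set r : ℕ → Fin n → ℕ := fun j i =>
    if ∃ k : Fin K, j ≤ k.val ∧ ep k = ep j ∧ i ∈ I k then E - ep j else E - ep j - 1
    with hr
  have hep : ∀ k : Fin K, ep k + 1 ≤ E := fun k => by
    rw [hepd]; exact Nat.div_lt_of_lt_mul (by rw [mul_comm, ← hK]; exact k.isLt)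
  have hrE : ∀ j i, r j i ≤ E := fun j i => by simp only [hr]; split_ifs <;> omega
  have hdiv : ∀ j : ℕ, ep (j + 1) = ep j ∨ ep (j + 1) = ep j + 1 := fun j => by
    rw [hepd, hepd, Nat.succ_div]; split_ifs <;> simp
  have hτeq : ∀ k : Fin K, 1 - s / g (E - ep k - 1 : ℕ) * ν =
      g (E - ep k : ℕ) / g (E - ep k - 1 : ℕ) := fun k => by
    have h1 : g (E - ep k - 1 : ℕ) ≠ 0 := (hgpos _ (by norm_cast; omega)).ne'
    have h2 : ((E - ep k : ℕ) : ℝ) = ((E - ep k - 1 : ℕ) : ℝ) + 1 := by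
      have := hep k
      norm_cast; omega
    rw [eq_div_iff h1, sub_mul, one_mul, mul_right_comm, div_mul_cancel₀ _ h1, h2]
    simp only [hg]; ring
  have hgk : ∀ k : Fin K, 0 < g (E - ep k : ℕ) := fun k => hgpos _ (by norm_cast; omega)
  have hgk1 : ∀ k : Fin K, 0 < g (E - ep k - 1 : ℕ) := fun k =>
    hgpos _ (by norm_cast; omega)
  have key := o.lintegral_lik_mul_exp_noise_sq_le hc hm I κ hν
    (fun j i => s / g (r j i)) (fun k => s / g (E - ep k - 1 : ℕ))
    (fun k => div_nonneg hs (hgk1 k).le)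
    (fun k => by
      have := hτeq k
      have := div_pos (hgk k) (hgk1 k)
      linarith)
    (fun k i hi => by
      have h1 : r (k + 1) i ≤ E - ep k - 1 := by
        simp only [hr]
        split_ifs with h
        · obtain ⟨k', h1, h2, h3⟩ := h
          rcases hdiv k.val with h4 | h4
          · exact absurd h3 (Finset.disjoint_left.1 (hI k k' (by
              intro h; subst h; omega) (by omega)) hi)
          · omega
        · rcases hdiv k.val with h4 | h4 <;> omega
      exact div_le_div_of_nonneg_left hs (hgk1 k) (hgmono _ _ (by exact_mod_cast h1)))
    (fun k i hi => by
      have h1 : r k i = E - ep k := by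
        simp only [hr]
        rw [if_pos ⟨k, le_rfl, rfl, hi⟩]
      rw [hτeq, h1, div_div_div_cancel_right₀ (hgk1 k).ne'])
    (fun k i hi => by
      have h1 : r (k + 1) i ≤ r k i := by
        simp only [hr]
        rcases hdiv k.val with h4 | h4
        · rw [h4]
          by_cases h : ∃ k' : Fin K, k.val + 1 ≤ k'.val ∧ ep k' = ep k ∧ i ∈ I k'
          · obtain ⟨k', h1, h2, h3⟩ := h
            rw [if_pos ⟨k', h1, h2, h3⟩, if_pos ⟨k', by omega, h2, h3⟩]
          · rw [if_neg h]
            split_ifs <;> omega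
        · rw [h4]
          split_ifs <;> omega
      exact div_le_div_of_nonneg_left hs (hgpos _ (by exact_mod_cast hrE _ _))
        (hgmono _ _ (by exact_mod_cast h1)))
  refine le_trans (lintegral_mono fun v => ?_) (key.trans (ENNReal.ofReal_le_ofReal (le_of_eq ?_)))
  · refine mul_le_mul_right (ENNReal.ofReal_le_ofReal (Real.exp_le_exp.2 ?_)) _
    rw [div_mul_eq_mul_div, one_div, ← div_eq_inv_mul, Finset.mul_sum]
    refine div_le_div_of_nonneg_right (Finset.sum_le_sum fun i _ => mul_le_mul_of_nonneg_right ?_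
      (integral_nonneg fun x => sq_nonneg _)) (by norm_num)
    refine (div_one s).symm.le.trans
      (div_le_div_of_nonneg_left hs (hgpos _ (by exact_mod_cast hrE _ _)) ?_)
    simp only [hg]
    have : 0 ≤ s * ν * (r K i : ℝ) := by positivity
    linarith
  · have hE1 : 0 < 1 - s * E * ν := by linarith
    simp only [hτeq, Real.sqrt_div (hgk _).le]
    set φ : ℕ → ℝ := fun e => (√(g (E - e : ℕ)) / √(g (E - e - 1 : ℕ)))⁻¹ with hφ
    have e1 : ∏ k : Fin K, (√(g (E - ep k : ℕ)) / √(g (E - ep k - 1 : ℕ)))⁻¹ =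
        ∏ k ∈ Finset.range (E * T),
          φ (k / T) := by
      subst hK
      simp only [hepd, hφ]
      exact Fin.prod_univ_eq_prod_range
        (fun k => (√(g (E - k / T : ℕ)) / √(g (E - k / T - 1 : ℕ)))⁻¹) (E * T)
    rw [e1, prod_range_mul_div φ _ hT]
    -- All steps of an epoch have the same factor, and the factors of successive epochs telescope
    -- from g(E) to g(0) = 1. This is why the exponent is T/2 and not ET/2.
    have e2 : ∀ N ≤ E, ∏ e ∈ Finset.range N, (√(g (E - e : ℕ)) / √(g (E - e - 1 : ℕ)))⁻¹ =
        √(g (E - N : ℕ)) / √(g (E : ℕ)) := by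
      intro N
      induction N with
      | zero =>
        intro _
        simp only [Finset.range_zero, Finset.prod_empty, Nat.sub_zero]
        rw [div_self (Real.sqrt_pos.2 (hgpos _ le_rfl)).ne']
      | succ N ih =>
        intro hN
        rw [Finset.prod_range_succ, ih (by omega)]
        have h1 : 0 < √(g (E - N : ℕ)) := Real.sqrt_pos.2 (hgpos _ (by norm_cast; omega))
        rw [Nat.sub_sub]
        field_simp
    rw [e2 E le_rfl, Nat.sub_self]
    have e3 : g ((0 : ℕ) : ℝ) = 1 := by simp [hg]
    have e4 : g (E : ℕ) = 1 - s * E * ν := by simp only [hg]; ring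
    rw [e3, e4, Real.sqrt_one, one_div]
    have h5 : √(1 - s * E * ν) = Real.exp (Real.log (1 - s * E * ν) / 2) := by
      rw [Real.exp_half, Real.exp_log hE1]
    rw [h5, ← Real.exp_neg, ← Real.exp_nat_mul]
    congr 1; ring

end PathField

/-! ### Log-likelihood gains of single data points -/

/-- The logarithm of `lik`. -/
noncomputable def logLik {d K : ℕ}
    (c : Fin K → (Fin K → EuclideanSpace ℝ (Fin d)) → EuclideanSpace ℝ (Fin d))
    (v : Fin K → EuclideanSpace ℝ (Fin d)) : ℝ :=
  ∑ k, (inner ℝ (v k) (c k v) - ‖c k v‖ ^ 2 / 2)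

theorem lik_eq_exp_logLik {d K : ℕ}
    (c : Fin K → (Fin K → EuclideanSpace ℝ (Fin d)) → EuclideanSpace ℝ (Fin d))
    (v : Fin K → EuclideanSpace ℝ (Fin d)) : lik c v = ENNReal.ofReal (Real.exp (logLik c v)) := by
  rw [lik, logLik, Real.exp_sum, ENNReal.ofReal_prod_of_nonneg fun _ _ => (Real.exp_pos _).le]
  rfl

theorem add_sq_le_weighted {η : ℝ} (hη : 0 < η) (M D : ℝ) :
    (M + D) ^ 2 ≤ (1 + η) * M ^ 2 + (1 + 1 / η) * D ^ 2 := by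
  have : (1 + η) * M ^ 2 + (1 + 1 / η) * D ^ 2 - (M + D) ^ 2 = (η * M - D) ^ 2 / η := by
    field_simp; ring
  rw [← sub_nonneg, this]
  positivity

namespace PathField

variable {𝒳 : Type*} [MeasurableSpace 𝒳] {d K n : ℕ} {b : ℝ}

local notation "V" => EuclideanSpace ℝ (Fin d)

/-- The log-likelihood gain of a path by the data points with indices in `G`. -/
noncomputable def gain (o : PathField 𝒳 d K b) (I : Fin K → Finset (Fin n)) (G : Finset (Fin n))
    (S : Fin n → 𝒳) (v : Fin K → V) : ℝ :=
  logLik (o.drift I S) v - logLik (o.drift (fun k => I k \ G) S) v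

theorem drift_sdiff_add_inter (o : PathField 𝒳 d K b) (I : Fin K → Finset (Fin n))
    (G : Finset (Fin n)) (S : Fin n → 𝒳) (k : Fin K) (v : Fin K → V) :
    o.drift I S k v = o.drift (fun k => I k \ G) S k v + o.drift (fun k => I k ∩ G) S k v := by
  simp only [drift]
  rw [add_comm, Finset.sum_inter_add_sum_sdiff]

theorem inner_add_sub_norm_sq (v c F : V) :
    inner ℝ v (c + F) - ‖c + F‖ ^ 2 / 2 - (inner ℝ v c - ‖c‖ ^ 2 / 2) =
      inner ℝ (v - (c + F)) F + ‖F‖ ^ 2 / 2 := by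
  rw [norm_add_sq_real, inner_add_right, inner_sub_left, inner_add_left,
    real_inner_self_eq_norm_sq]
  ring

/-- Centering the path at the full drift turns the gain into a linear function of the noise plus
half a squared length. -/
theorem gain_eq (o : PathField 𝒳 d K b) (I : Fin K → Finset (Fin n)) (G : Finset (Fin n))
    (S : Fin n → 𝒳) (v : Fin K → V) :
    o.gain I G S v = ∑ k, (inner ℝ (v k - o.drift I S k v) (o.drift (fun k => I k ∩ G) S k v) +
      ‖o.drift (fun k => I k ∩ G) S k v‖ ^ 2 / 2) := by
  rw [gain, logLik, logLik, ← Finset.sum_sub_distrib]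
  refine Finset.sum_congr rfl fun k _ => ?_
  rw [o.drift_sdiff_add_inter I G S k v, inner_add_sub_norm_sq]

theorem drift_congr (o : PathField 𝒳 d K b) (I : Fin K → Finset (Fin n)) {S S' : Fin n → 𝒳}
    (h : ∀ k, ∀ i ∈ I k, S i = S' i) : o.drift I S = o.drift I S' := by
  funext k v
  exact Finset.sum_congr rfl fun i hi => by rw [h k i hi]

/-- The part of the gain of a data point `x` at position `i` that does not come from the noise. -/
noncomputable def gainDrift (o : PathField 𝒳 d K b) (I : Fin K → Finset (Fin n)) (i : Fin n)
    (S : Fin n → 𝒳) (x : 𝒳) (v : Fin K → V) : ℝ :=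
  ∑ k, if i ∈ I k then inner ℝ (o.toFun k (S i) v) (o.toFun k x v) - ‖o.toFun k x v‖ ^ 2 / 2 else 0

/-- In the application the path is produced by `S`, so its noise is centered at the drift of `S`,
not of the updated data. In the steps that use point `i` the two drifts differ by the fields at `S
i` and at `x`; this difference is what `gainDrift` collects, and it turns the sign of the half
square. -/
theorem gain_update_eq (o : PathField 𝒳 d K b) (I : Fin K → Finset (Fin n)) (i : Fin n)
    (S : Fin n → 𝒳) (x : 𝒳) (v : Fin K → V) :
    o.gain I {i} (Function.update S i x) v =
      o.noise (o.drift I S) I K i x v + o.gainDrift I i S x v := by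
  rw [gain_eq, noise, gainDrift]
  have e0 : (Finset.univ.filter fun k : Fin K => k.val < K) = Finset.univ := by ext k; simp
  rw [e0, ← Finset.sum_add_distrib]
  refine Finset.sum_congr rfl fun k _ => ?_
  rw [o.drift_sdiff_add_inter I {i} (Function.update S i x) k v,
    o.drift_sdiff_add_inter I {i} S k v]
  have e1 : o.drift (fun k => I k \ {i}) (Function.update S i x) =
      o.drift (fun k => I k \ {i}) S := o.drift_congr _ fun k j hj => by
    have : j ≠ i := by simp at hj; exact hj.2
    rw [Function.update_of_ne this]
  rw [e1]
  by_cases h : i ∈ I k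
  · have e2 : ∀ S : Fin n → 𝒳, o.drift (fun k => I k ∩ {i}) S k v = o.toFun k (S i) v := fun S => by
      simp [drift, Finset.inter_singleton_of_mem h]
    rw [e2, e2, if_pos h, if_pos h, Function.update_self]
    simp only [inner_sub_left, inner_add_left, real_inner_self_eq_norm_sq]
    ring
  · have e2 : ∀ S : Fin n → 𝒳, o.drift (fun k => I k ∩ {i}) S k v = 0 := fun S => by
      simp [drift, Finset.inter_singleton_of_notMem h]
    simp [e2, h]

theorem abs_gainDrift_le (o : PathField 𝒳 d K b) (I : Fin K → Finset (Fin n)) (i : Fin n)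
    (S : Fin n → 𝒳) (x : 𝒳) (v : Fin K → V) :
    |o.gainDrift I i S x v| ≤
      3 / 2 * b ^ 2 * (Finset.univ.filter fun k => i ∈ I k).card := by
  rw [gainDrift, ← Finset.sum_filter]
  refine (Finset.abs_sum_le_sum_abs _ _).trans ?_
  rw [mul_comm, ← nsmul_eq_mul]
  refine Finset.sum_le_card_nsmul _ _ _ fun k _ => ?_
  have h1 := o.bound k (S i) v
  have h2 := o.bound k x v
  have h3 := abs_le.1 (abs_real_inner_le_norm (o.toFun k (S i) v) (o.toFun k x v))
  have h4 := norm_nonneg (o.toFun k (S i) v)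
  have h5 := norm_nonneg (o.toFun k x v)
  rw [abs_le]
  constructor <;> nlinarith

/-- At `x = S i` the inner product is the full square, so half a square remains and the constant
improves from `3/2` to `1/2`. -/
theorem abs_gainDrift_self_le (o : PathField 𝒳 d K b) (I : Fin K → Finset (Fin n)) (i : Fin n)
    (S : Fin n → 𝒳) (v : Fin K → V) :
    |o.gainDrift I i S (S i) v| ≤
      1 / 2 * b ^ 2 * (Finset.univ.filter fun k => i ∈ I k).card := by
  rw [gainDrift, ← Finset.sum_filter]
  refine (Finset.abs_sum_le_sum_abs _ _).trans ?_
  rw [mul_comm, ← nsmul_eq_mul]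
  refine Finset.sum_le_card_nsmul _ _ _ fun k _ => ?_
  have h1 := o.bound k (S i) v
  have h4 := norm_nonneg (o.toFun k (S i) v)
  rw [real_inner_self_eq_norm_sq, abs_le]
  constructor <;> nlinarith

/-- A weight that controls the entropy of the likelihood as a function of the data. -/
noncomputable def infoWeight (o : PathField 𝒳 d K b) (P : Measure 𝒳) (I : Fin K → Finset (Fin n))
    (S : Fin n → 𝒳) (v : Fin K → V) : ℝ :=
  ∑ i, (1 / 6 * ∫ x, o.gain I {i} (Function.update S i x) v ^ 2 ∂P + 1 / 3 * o.gain I {i} S v ^ 2)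

/-- A point lies in at most one batch per epoch, hence in at most `E` batches, and all uses together
number `E * T * m`. One factor of each square is bounded by `E`. -/
theorem sum_card_filter_sq_le (I : Fin K → Finset (Fin n)) {T E m : ℕ}
    (hK : K = E * T) (hcard : ∀ k, (I k).card = m)
    (hI : ∀ k k' : Fin K, k ≠ k' → k.val / T = k'.val / T → Disjoint (I k) (I k')) :
    ∑ i, ((Finset.univ.filter fun k => i ∈ I k).card : ℝ) ^ 2 ≤ E * (E * T * m) := by
  have h1 : ∀ i, (Finset.univ.filter fun k => i ∈ I k).card ≤ E := fun i => by
    rw [← Finset.card_range E]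
    refine Finset.card_le_card_of_injOn (fun k => k.val / T) (fun k _ => ?_) fun k hk k' hk' h => ?_
    · simp only [Finset.coe_range, Set.mem_Iio]
      exact Nat.div_lt_of_lt_mul (by rw [mul_comm, ← hK]; exact k.isLt)
    · by_contra hne
      exact Finset.disjoint_left.1 (hI k k' hne h) (by simpa using hk) (by simpa using hk')
  have h2 : ∑ i, (Finset.univ.filter fun k => i ∈ I k).card = E * T * m := by
    simp only [Finset.card_filter]
    rw [Finset.sum_comm]
    simp [hcard, hK]
  have h3 : ∑ i, ((Finset.univ.filter fun k => i ∈ I k).card : ℝ) ^ 2 ≤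
      ∑ i, (E : ℝ) * (Finset.univ.filter fun k => i ∈ I k).card :=
    Finset.sum_le_sum fun i _ => by
      rw [sq]
      exact mul_le_mul_of_nonneg_right (by exact_mod_cast h1 i) (by positivity)
  refine h3.trans (le_of_eq ?_)
  rw [← Finset.mul_sum]
  norm_cast
  rw [h2]

set_option maxHeartbeats 1000000 in
-- A gain is a noise projection plus a term of order b² times the number of uses of the point.
-- Young's inequality with parameter `η` separates them: the squared noise has the exponential
-- moment over epochs, and the bounded squares add up to the second term of the exponent.
theorem lintegral_lik_mul_exp_infoWeight_le (o : PathField 𝒳 d K b) (P : Measure 𝒳)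
    [IsProbabilityMeasure P] (I : Fin K → Finset (Fin n)) (S : Fin n → 𝒳) {T E m : ℕ} (hT : 0 < T)
    (hK : K = E * T) (hcard : ∀ k, (I k).card = m)
    (hI : ∀ k k' : Fin K, k ≠ k' → k.val / T = k'.val / T → Disjoint (I k) (I k')) {κ η ν : ℝ}
    (hν : ν = m * b ^ 2) (hκ : 0 ≤ κ) (hη : 0 < η) (hlt : κ * (1 + η) * E * ν < 1) :
    ∫⁻ v, lik (o.drift I S) v * ENNReal.ofReal (Real.exp (κ * o.infoWeight P I S v))
        ∂(whiteNoise d K) ≤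
      ENNReal.ofReal (Real.exp (-(T / 2) * Real.log (1 - κ * (1 + η) * E * ν) +
        κ * (1 + 1 / η) * (11 / 24) * (E * b ^ 2 * (E * T * ν)))) := by
  have hν0 : 0 ≤ ν := hν ▸ by positivity
  set c := o.drift I S with hc
  have hcm : ∀ k, Measurable (c k) := fun k => by rw [hc]; fun_prop
  -- Half of this mixture has the weights 1/6 and 1/3 of `infoWeight`, so that redrawn and actual
  -- points are treated in one exponential moment.
  set κ' : Fin n → Measure 𝒳 := fun i =>
    ENNReal.ofReal (1 / 3) • P + ENNReal.ofReal (2 / 3) • Measure.dirac (S i) with hκ'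
  have hprob : ∀ i, IsProbabilityMeasure (κ' i) := fun i => by
    constructor
    simp only [hκ', Measure.coe_add, Measure.coe_smul, Pi.add_apply, Pi.smul_apply, measure_univ,
      smul_eq_mul, mul_one]
    rw [← ENNReal.ofReal_add (by norm_num) (by norm_num)]
    norm_num
  have main := o.lintegral_lik_mul_exp_noise_sq_epochs_le (o.past_drift I S) hcm I κ' hν0
    (fun k => by rw [hcard, hν]) hT hK hI (s := κ * (1 + η)) (by positivity) hlt
  -- 11/24 = 1/6 · (3/2)² + 1/3 · (1/2)², from the two bounds on `gainDrift`.
  set L := κ * (1 + 1 / η) * (11 / 24) * (E * b ^ 2 * (E * T * ν)) with hL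
  have hint : ∀ i v, ∫ x, o.noise c I K i x v ^ 2 ∂(κ' i) =
      1 / 3 * ∫ x, o.noise c I K i x v ^ 2 ∂P + 2 / 3 * o.noise c I K i (S i) v ^ 2 := fun i v => by
    have hm : Measurable fun x => o.noise c I K i x v ^ 2 :=
      (o.measurable_noise_left c I K i v).pow_const 2
    have hb : ∀ x, |o.noise c I K i x v ^ 2| ≤ (∑ k, ‖v k - c k v‖ * |b|) ^ 2 := fun x => by
      rw [abs_pow]; exact pow_le_pow_left₀ (abs_nonneg _) (o.abs_noise_le c I K i x v) 2
    simp only [hκ']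
    rw [integral_add_measure ((integrable_of_abs_le _ hm _ hb).smul_measure ENNReal.ofReal_ne_top)
      ((integrable_of_abs_le _ hm _ hb).smul_measure ENNReal.ofReal_ne_top),
      integral_smul_measure, integral_smul_measure, integral_dirac' _ _ hm.stronglyMeasurable,
      ENNReal.toReal_ofReal (by norm_num), ENNReal.toReal_ofReal (by norm_num)]
    simp
  have bd : ∀ v, κ * o.infoWeight P I S v ≤
      κ * (1 + η) / 2 * ∑ i, ∫ x, o.noise c I K i x v ^ 2 ∂(κ' i) + L := by
    intro v
    set N : Fin n → ℝ := fun i => (Finset.univ.filter fun k => i ∈ I k).card with hN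
    have hsq : ∀ {x y : ℝ}, |x| ≤ y → x ^ 2 ≤ y ^ 2 := fun h => by
      rw [← sq_abs]; exact pow_le_pow_left₀ (abs_nonneg _) h 2
    have h1 : ∀ i, ∫ x, o.gain I {i} (Function.update S i x) v ^ 2 ∂P ≤
        (1 + η) * ∫ x, o.noise c I K i x v ^ 2 ∂P + (1 + 1 / η) * (3 / 2 * b ^ 2 * N i) ^ 2 := by
      intro i
      have hm : Measurable fun x => o.noise c I K i x v ^ 2 :=
        (o.measurable_noise_left c I K i v).pow_const 2
      have hb : ∀ x, |o.noise c I K i x v ^ 2| ≤ (∑ k, ‖v k - c k v‖ * |b|) ^ 2 := fun x => by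
        rw [abs_pow]; exact pow_le_pow_left₀ (abs_nonneg _) (o.abs_noise_le c I K i x v) 2
      have hi := integrable_of_abs_le P hm _ hb
      have hpt : ∀ x, o.gain I {i} (Function.update S i x) v ^ 2 ≤
          (1 + η) * o.noise c I K i x v ^ 2 + (1 + 1 / η) * (3 / 2 * b ^ 2 * N i) ^ 2 := fun x => by
        rw [o.gain_update_eq]
        refine (add_sq_le_weighted hη _ _).trans ?_
        have := hsq (o.abs_gainDrift_le I i S x v)
        gcongr
      refine (integral_mono_of_nonneg (Filter.Eventually.of_forall fun x => sq_nonneg _)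
        ((hi.const_mul _).add (integrable_const _)) (Filter.Eventually.of_forall hpt)).trans ?_
      rw [integral_add' (hi.const_mul _) (integrable_const _), integral_const_mul]
      simp
    have h2 : ∀ i, o.gain I {i} S v ^ 2 ≤
        (1 + η) * o.noise c I K i (S i) v ^ 2 + (1 + 1 / η) * (1 / 2 * b ^ 2 * N i) ^ 2 := by
      intro i
      have e := o.gain_update_eq I i S (S i) v
      rw [Function.update_eq_self] at e
      rw [e]
      refine (add_sq_le_weighted hη _ _).trans ?_
      have := hsq (o.abs_gainDrift_self_le I i S v)
      gcongr
    have h3 : o.infoWeight P I S v ≤ ∑ i, ((1 + η) / 2 * ∫ x, o.noise c I K i x v ^ 2 ∂(κ' i) +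
        (1 + 1 / η) * (11 / 24) * b ^ 4 * N i ^ 2) := by
      refine Finset.sum_le_sum fun i _ => ?_
      rw [hint]
      have := h1 i
      have := h2 i
      nlinarith
    rw [Finset.sum_add_distrib, ← Finset.mul_sum, ← Finset.mul_sum] at h3
    have h4 := sum_card_filter_sq_le I hK hcard hI
    have h5 : (1 + 1 / η) * (11 / 24) * b ^ 4 * ∑ i, N i ^ 2 ≤
        (1 + 1 / η) * (11 / 24) * b ^ 4 * (E * (E * T * m)) := by gcongr
    have h6 := mul_le_mul_of_nonneg_left (h3.trans (add_le_add le_rfl h5)) hκ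
    refine h6.trans (le_of_eq ?_)
    rw [hL, hν]; ring
  calc _ ≤ ∫⁻ v, ENNReal.ofReal (Real.exp L) * (lik c v * ENNReal.ofReal (Real.exp
          (κ * (1 + η) / 2 * ∑ i, ∫ x, o.noise c I K i x v ^ 2 ∂(κ' i)))) ∂(whiteNoise d K) := by
        refine lintegral_mono fun v => ?_
        rw [mul_left_comm, ← ENNReal.ofReal_mul (Real.exp_pos _).le, ← Real.exp_add]
        exact mul_le_mul_right (ENNReal.ofReal_le_ofReal (Real.exp_le_exp.2
          ((bd v).trans (le_of_eq (add_comm _ _))))) _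
    _ = ENNReal.ofReal (Real.exp L) * _ := lintegral_const_mul' _ _ ENNReal.ofReal_ne_top
    _ ≤ ENNReal.ofReal (Real.exp L) * _ := mul_le_mul_right main _
    _ = _ := by
        rw [← ENNReal.ofReal_mul (Real.exp_pos _).le, ← Real.exp_add, add_comm L]

end PathField

/-! ### Partial averages and subadditivity of entropy on a product space -/

section

variable {𝒳 : Type*} [MeasurableSpace 𝒳] {n : ℕ} (P : Measure 𝒳) [IsProbabilityMeasure P]

theorem measurePreserving_update (i : Fin n) :
    MeasurePreserving (fun p : (Fin n → 𝒳) × 𝒳 => Function.update p.1 i p.2)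
      ((Measure.pi fun _ => P).prod P) (Measure.pi fun _ => P) := by
  have hm : Measurable fun p : (Fin n → 𝒳) × 𝒳 => Function.update p.1 i p.2 := by
    refine measurable_pi_lambda _ fun j => ?_
    by_cases h : j = i
    · subst h; simp only [Function.update_self]; fun_prop
    · simp only [Function.update_of_ne h]; fun_prop
  refine ⟨hm, Measure.ext_of_lintegral _ fun F hF => ?_⟩
  have hFm : Measurable fun p : (Fin n → 𝒳) × 𝒳 => F (Function.update p.1 i p.2) := hF.comp hm
  rw [lintegral_map hF hm, lintegral_prod _ hFm.aemeasurable]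
  refine lintegral_pi_eq_of_update P i hFm.lintegral_prod_right' hF fun v => ?_
  simp

theorem integral_pi_update (i : Fin n) {f : (Fin n → 𝒳) → ℝ}
    (hf : Integrable f (Measure.pi fun _ => P)) :
    ∫ S, f S ∂(Measure.pi fun _ => P) =
      ∫ S, ∫ x, f (Function.update S i x) ∂P ∂(Measure.pi fun _ => P) := by
  have h := measurePreserving_update P i
  have h1 : Integrable (fun p : (Fin n → 𝒳) × 𝒳 => f (Function.update p.1 i p.2))
    ((Measure.pi fun _ => P).prod P) := h.integrable_comp_of_integrable hf
  rw [← integral_prod (fun p : (Fin n → 𝒳) × 𝒳 => f (Function.update p.1 i p.2)) h1]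
  conv_lhs => rw [← h.map_eq]
  rw [integral_map h.measurable.aemeasurable (by rw [h.map_eq]; exact hf.aestronglyMeasurable)]

theorem lmarginal_bounds {F : (Fin n → 𝒳) → ℝ≥0∞} {C : ℝ} (h1 : ∀ S, ENNReal.ofReal (Real.exp (-C)) ≤ F S)
    (h2 : ∀ S, F S ≤ ENNReal.ofReal (Real.exp C)) (s : Finset (Fin n)) (S : Fin n → 𝒳) :
    ENNReal.ofReal (Real.exp (-C)) ≤ (∫⋯∫⁻_s, F ∂fun _ => P) S ∧
      (∫⋯∫⁻_s, F ∂fun _ => P) S ≤ ENNReal.ofReal (Real.exp C) := by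
  have hc : ∀ c : ℝ≥0∞, (∫⋯∫⁻_s, (fun _ => c) ∂fun _ : Fin n => P) S = c := fun c => by
    simp [lmarginal]
  constructor
  · rw [← hc (ENNReal.ofReal (Real.exp (-C)))]
    exact lmarginal_mono (fun S => h1 S) S
  · rw [← hc (ENNReal.ofReal (Real.exp C))]
    exact lmarginal_mono (fun S => h2 S) S

/-- Mean of `exp φ` over the coordinates in `s`. -/
noncomputable def expMean (φ : (Fin n → 𝒳) → ℝ) (s : Finset (Fin n)) (S : Fin n → 𝒳) : ℝ :=
  ((∫⋯∫⁻_s, (fun S => ENNReal.ofReal (Real.exp (φ S))) ∂fun _ => P) S).toReal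

variable {P} {φ : (Fin n → 𝒳) → ℝ} (hφ : Measurable φ) {C : ℝ} (hC : ∀ S, |φ S| ≤ C)

include hC in
theorem ofReal_expMean (s : Finset (Fin n)) (S : Fin n → 𝒳) :
    ENNReal.ofReal (expMean P φ s S) =
      (∫⋯∫⁻_s, (fun S => ENNReal.ofReal (Real.exp (φ S))) ∂fun _ => P) S := by
  refine ENNReal.ofReal_toReal (ne_top_of_le_ne_top ENNReal.ofReal_ne_top
    (lmarginal_bounds P (C := C) (fun S => ?_) (fun S => ?_) s S).2) <;>
  exact ENNReal.ofReal_le_ofReal (Real.exp_le_exp.2 (by linarith [abs_le.1 (hC S)]))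

include hC in
theorem expMean_mem (s : Finset (Fin n)) (S : Fin n → 𝒳) :
    Real.exp (-C) ≤ expMean P φ s S ∧ expMean P φ s S ≤ Real.exp C := by
  have h := lmarginal_bounds P (F := fun S => ENNReal.ofReal (Real.exp (φ S))) (C := C)
    (fun S => ENNReal.ofReal_le_ofReal (Real.exp_le_exp.2 (by linarith [abs_le.1 (hC S)])))
    (fun S => ENNReal.ofReal_le_ofReal (Real.exp_le_exp.2 (by linarith [abs_le.1 (hC S)]))) s S
  rw [← ofReal_expMean hC, ENNReal.ofReal_le_ofReal_iff (Real.exp_pos _).le] at h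
  refine ⟨?_, h.2⟩
  have h0 : 0 ≤ expMean P φ s S := ENNReal.toReal_nonneg
  exact (ENNReal.ofReal_le_ofReal_iff h0).1 h.1

include hC in
theorem expMean_pos (s : Finset (Fin n)) (S : Fin n → 𝒳) : 0 < expMean P φ s S :=
  (Real.exp_pos _).trans_le (expMean_mem hC s S).1

include hC in
theorem abs_log_expMean_le (s : Finset (Fin n)) (S : Fin n → 𝒳) :
    |Real.log (expMean P φ s S)| ≤ C := by
  have h := expMean_mem (P := P) hC s S
  have h0 := expMean_pos (P := P) hC s S
  exact abs_le.2 ⟨(Real.le_log_iff_exp_le h0).2 h.1, (Real.log_le_iff_le_exp h0).2 h.2⟩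

include hφ in
@[fun_prop]
theorem measurable_expMean (s : Finset (Fin n)) : Measurable (expMean P φ s) :=
  (Measurable.lmarginal _ (by fun_prop)).ennreal_toReal

include hC hφ in
-- Write M_r for the average over the coordinates in r and u = M_s M_t / M_(t∪s). Neither M_t nor
-- M_(t∪s) depends on the coordinates in t, and over these M_s averages to M_(t∪s); so u and exp φ
-- have the same integral. Now apply log x ≤ x - 1 to x = u / exp φ.
theorem integral_exp_mul_log_sub_le {s t : Finset (Fin n)} (hst : Disjoint s t) :
    ∫ S, Real.exp (φ S) * (Real.log (expMean P φ s S) - Real.log (expMean P φ (t ∪ s) S))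
        ∂(Measure.pi fun _ => P) ≤
      ∫ S, Real.exp (φ S) * (φ S - Real.log (expMean P φ t S)) ∂(Measure.pi fun _ => P) := by
  set F : (Fin n → 𝒳) → ℝ≥0∞ := fun S => ENNReal.ofReal (Real.exp (φ S)) with hF
  have hFm : Measurable F := by fun_prop
  have hp := fun s S => expMean_pos (P := P) hC s S
  have hbd := fun s S => expMean_mem (P := P) hC s S
  have hmm := fun s => measurable_expMean (P := P) hφ s
  have hlog : ∀ s, Measurable fun S => Real.log (expMean P φ s S) := fun s => (hmm s).log
  have hint : ∀ {g : (Fin n → 𝒳) → ℝ}, Measurable g → ∀ D, (∀ S, |g S| ≤ D) →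
      Integrable (fun S => Real.exp (φ S) * g S) (Measure.pi fun _ => P) := fun hg D hD =>
    integrable_of_abs_le _ (by fun_prop) (Real.exp C * D) fun S => by
      rw [abs_mul, Real.abs_exp]
      exact mul_le_mul (Real.exp_le_exp.2 (le_of_abs_le (hC S))) (hD S) (abs_nonneg _)
        (Real.exp_pos _).le
  set u : (Fin n → 𝒳) → ℝ := fun S =>
    expMean P φ s S * expMean P φ t S / expMean P φ (t ∪ s) S with hu
  have hum : Measurable u := by
    have h1 := hmm s; have h2 := hmm t; have h3 := hmm (t ∪ s)
    fun_prop
  have hu0 : ∀ S, 0 < u S := fun S => div_pos (mul_pos (hp s S) (hp t S)) (hp _ S)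
  have hub : ∀ S, |u S| ≤ Real.exp C * Real.exp C / Real.exp (-C) := fun S => by
    rw [abs_of_pos (hu0 S)]
    have h1 := (hbd s S).2
    have h2 := (hbd t S).2
    have h3 := (hbd (t ∪ s) S).1
    have h4 := hp s S
    have h5 := hp t S
    simp only [hu]
    gcongr
  have iu : Integrable u (Measure.pi fun _ => P) := integrable_of_abs_le _ hum _ hub
  have ie : Integrable (fun S => Real.exp (φ S)) (Measure.pi fun _ => P) := by
    simpa using hint (g := fun _ => 1) measurable_const 1 (by simp)
  have key : ∫ S, u S ∂(Measure.pi fun _ => P) = ∫ S, Real.exp (φ S) ∂(Measure.pi fun _ => P) := by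
    rw [integral_eq_lintegral_of_nonneg_ae (Filter.Eventually.of_forall fun S => (hu0 S).le)
      hum.aestronglyMeasurable, integral_eq_lintegral_of_nonneg_ae
      (Filter.Eventually.of_forall fun S => (Real.exp_pos _).le) ie.aestronglyMeasurable]
    congr 1
    refine lintegral_eq_of_lmarginal_eq (μ := fun _ => P) t (by fun_prop) hFm (funext fun S => ?_)
    have e1 : ∀ y, ENNReal.ofReal (u (Function.updateFinset S t y)) =
        ENNReal.ofReal (expMean P φ t S / expMean P φ (t ∪ s) S) *
          (∫⋯∫⁻_s, F ∂fun _ => P) (Function.updateFinset S t y) := fun y => by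
      have e2 : ∀ r, t ⊆ r → expMean P φ r (Function.updateFinset S t y) = expMean P φ r S := by
        intro r hr
        rw [expMean, expMean]
        congr 1
        refine lmarginal_congr _ _ fun i hi => ?_
        have : i ∉ t := fun h => hi (hr h)
        simp [Function.updateFinset, this]
      rw [← ofReal_expMean hC, ← ENNReal.ofReal_mul (div_pos (hp _ _) (hp _ _)).le]
      simp only [hu]
      rw [e2 t subset_rfl, e2 (t ∪ s) Finset.subset_union_left]
      congr 1; ring
    rw [lmarginal]
    simp_rw [e1]
    rw [lintegral_const_mul' _ _ ENNReal.ofReal_ne_top]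
    have e3 : ∫⁻ y, (∫⋯∫⁻_s, F ∂fun _ => P) (Function.updateFinset S t y)
        ∂(Measure.pi fun _ => P) = (∫⋯∫⁻_(t ∪ s), F ∂fun _ => P) S := by
      rw [lmarginal_union _ _ hFm hst.symm]
      rfl
    rw [e3, ← ofReal_expMean hC, ← ENNReal.ofReal_mul (div_pos (hp _ _) (hp _ _)).le,
      div_mul_cancel₀ _ (hp _ _).ne', ofReal_expMean hC]
  have pt : ∀ S, Real.exp (φ S) *
      (Real.log (expMean P φ s S) - Real.log (expMean P φ (t ∪ s) S)) +
        (Real.exp (φ S) - u S) ≤ Real.exp (φ S) * (φ S - Real.log (expMean P φ t S)) := fun S => by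
    have h1 := Real.log_le_sub_one_of_pos (div_pos (hu0 S) (Real.exp_pos (φ S)))
    rw [Real.log_div (hu0 S).ne' (Real.exp_pos _).ne', Real.log_exp,
      Real.log_div (mul_pos (hp s S) (hp t S)).ne' (hp _ S).ne',
      Real.log_mul (hp s S).ne' (hp t S).ne'] at h1
    have h2 := mul_le_mul_of_nonneg_left h1 (Real.exp_pos (φ S)).le
    have h3 : Real.exp (φ S) * (u S / Real.exp (φ S) - 1) = u S - Real.exp (φ S) := by
      field_simp
    rw [h3] at h2
    linarith
  have i1 := hint ((hlog s).sub (hlog (t ∪ s))) (C + C) fun S =>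
    (abs_sub _ _).trans (add_le_add (abs_log_expMean_le hC _ _) (abs_log_expMean_le hC _ _))
  have i2 := hint (hφ.sub (hlog t)) (C + C) fun S =>
    (abs_sub _ _).trans (add_le_add (hC S) (abs_log_expMean_le hC _ _))
  have h := integral_mono (i1.add (ie.sub iu)) i2 pt
  rw [integral_add' i1 (ie.sub iu), integral_sub' ie iu, key, sub_self, add_zero] at h
  exact h

include hC hφ in
/-- Subadditivity of the entropy, for a partition of the coordinates into groups. -/
theorem entropy_le_sum_groups {g : ℕ} (col : Fin n → Fin g) :
    ∫ S, Real.exp (φ S) * φ S ∂(Measure.pi fun _ => P) -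
        (∫ S, Real.exp (φ S) ∂(Measure.pi fun _ => P)) *
          Real.log (∫ S, Real.exp (φ S) ∂(Measure.pi fun _ => P)) ≤
      ∑ r, ∫ S, Real.exp (φ S) * (φ S - Real.log
        (expMean P φ (Finset.univ.filter fun i => col i = r) S)) ∂(Measure.pi fun _ => P) := by
  -- Growing unions of groups: the entropy telescopes along the logarithms of the averages, from φ
  -- itself for the empty union to the logarithm of the full integral.
  set s : ℕ → Finset (Fin n) := fun j => Finset.univ.filter fun i => (col i).val < j with hs
  have hint : ∀ {g : (Fin n → 𝒳) → ℝ}, Measurable g → ∀ D, (∀ S, |g S| ≤ D) →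
      Integrable (fun S => Real.exp (φ S) * g S) (Measure.pi fun _ => P) := fun hg D hD =>
    integrable_of_abs_le _ (by fun_prop) (Real.exp C * D) fun S => by
      rw [abs_mul, Real.abs_exp]
      exact mul_le_mul (Real.exp_le_exp.2 (le_of_abs_le (hC S))) (hD S) (abs_nonneg _)
        (Real.exp_pos _).le
  have ilog : ∀ s, Integrable (fun S => Real.exp (φ S) * Real.log (expMean P φ s S))
      (Measure.pi fun _ => P) := fun s =>
    hint (measurable_expMean hφ s).log C (abs_log_expMean_le hC s)
  have step : ∀ r : Fin g, ∫ S, Real.exp (φ S) * Real.log (expMean P φ (s r) S)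
        ∂(Measure.pi fun _ => P) - ∫ S, Real.exp (φ S) * Real.log (expMean P φ (s (r + 1)) S)
        ∂(Measure.pi fun _ => P) ≤ ∫ S, Real.exp (φ S) * (φ S - Real.log
        (expMean P φ (Finset.univ.filter fun i => col i = r) S)) ∂(Measure.pi fun _ => P) := by
    intro r
    have e : s (r + 1) = (Finset.univ.filter fun i => col i = r) ∪ s r := by
      ext i
      simp only [hs, Finset.mem_filter, Finset.mem_univ, true_and, Finset.mem_union, Fin.ext_iff]
      omega
    rw [← integral_sub (ilog _) (ilog _), e]
    simp_rw [← mul_sub]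
    refine integral_exp_mul_log_sub_le hφ hC (Finset.disjoint_left.2 fun i hi hi' => ?_)
    simp only [hs, Finset.mem_filter, Finset.mem_univ, true_and, Fin.ext_iff] at hi hi'
    omega
  refine le_trans (le_of_eq ?_) (Finset.sum_le_sum fun r _ => step r)
  rw [Fin.sum_univ_eq_sum_range (fun r => ∫ S, Real.exp (φ S) * Real.log (expMean P φ (s r) S)
        ∂(Measure.pi fun _ => P) - ∫ S, Real.exp (φ S) * Real.log (expMean P φ (s (r + 1)) S)
        ∂(Measure.pi fun _ => P)), Finset.sum_range_sub']
  have h0 : s 0 = ∅ := by simp [hs]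
  have hg : s g = Finset.univ := by ext i; simp [hs]
  have e0 : ∀ S, expMean P φ ∅ S = Real.exp (φ S) := fun S => by
    simp [expMean, ENNReal.toReal_ofReal (Real.exp_pos _).le]
  have eg : ∀ S, expMean P φ Finset.univ S = ∫ S, Real.exp (φ S) ∂(Measure.pi fun _ => P) :=
    fun S => by
      rw [expMean, lmarginal_univ, integral_eq_lintegral_of_nonneg_ae
        (Filter.Eventually.of_forall fun S => (Real.exp_pos _).le) (by fun_prop)]
  rw [h0, hg]
  simp only [e0, eg, Real.log_exp]
  rw [integral_mul_const]

end

/-! ### From entropy bounds to bounds on L^α norms -/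

section

variable {Ω : Type*} [MeasurableSpace Ω] (Q : Measure Ω) [IsProbabilityMeasure Q]

theorem integrable_exp_mul_of_abs_le {φ g : Ω → ℝ} (hφ : Measurable φ) (hg : Measurable g)
    {C D : ℝ} (hC : ∀ x, |φ x| ≤ C) (hD : ∀ x, |g x| ≤ D) :
    Integrable (fun x => Real.exp (φ x) * g x) Q :=
  integrable_of_abs_le _ (by fun_prop) (Real.exp C * D) fun x => by
    rw [abs_mul, Real.abs_exp]
    exact mul_le_mul (Real.exp_le_exp.2 (le_of_abs_le (hC x))) (hD x) (abs_nonneg _)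
      (Real.exp_pos _).le

theorem integrable_exp_of_abs_le {φ : Ω → ℝ} (hφ : Measurable φ)
    {C : ℝ} (hC : ∀ x, |φ x| ≤ C) : Integrable (fun x => Real.exp (φ x)) Q := by
  simpa using integrable_exp_mul_of_abs_le Q hφ (g := fun _ => 1) measurable_const hC (D := 1)
    (by simp)

/-- Gibbs variational principle, one direction. -/
theorem log_integral_exp_add_le {φ X : Ω → ℝ} (hφ : Measurable φ) (hX : Measurable X) {C : ℝ}
    (hC : ∀ x, |φ x| ≤ C) (hXC : ∀ x, |X x| ≤ C) :
    Real.log (∫ x, Real.exp (φ x) ∂Q) +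
        (∫ x, Real.exp (φ x) * (X x - φ x) ∂Q) / ∫ x, Real.exp (φ x) ∂Q ≤
      Real.log (∫ x, Real.exp (X x) ∂Q) := by
  have ie := integrable_exp_of_abs_le Q hφ hC
  have iX := integrable_exp_of_abs_le Q hX hXC
  have hZ : 0 < ∫ x, Real.exp (φ x) ∂Q := integral_exp_pos ie
  set Z := ∫ x, Real.exp (φ x) ∂Q with hZd
  set J := ∫ x, Real.exp (φ x) * (X x - φ x) ∂Q with hJ
  set t := J / Z with ht
  have iJ := integrable_exp_mul_of_abs_le Q hφ (hX.sub hφ) hC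
    (fun x => (abs_sub _ _).trans (add_le_add (hXC x) (hC x)))
  -- This is exp y ≥ 1 + y at y = X - φ - t; the mean `t` of X - φ under the tilted law is the best
  -- constant.
  have pt : ∀ x, Real.exp t * ((1 - t) * Real.exp (φ x) + Real.exp (φ x) * (X x - φ x)) ≤
      Real.exp (X x) := fun x => by
    have h1 := Real.add_one_le_exp (X x - φ x - t)
    have h2 := mul_le_mul_of_nonneg_left h1 (Real.exp_pos (t + φ x)).le
    rw [← Real.exp_add, Real.exp_add t] at h2
    have e : t + φ x + (X x - φ x - t) = X x := by ring
    rw [e] at h2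
    refine le_trans (le_of_eq ?_) h2
    ring
  have h := integral_mono (((ie.const_mul (1 - t)).add iJ).const_mul (Real.exp t)) iX pt
  rw [integral_const_mul, integral_add' (ie.const_mul _) iJ, integral_const_mul] at h
  have e : (1 - t) * Z + J = Z := by
    have : t * Z = J := div_mul_cancel₀ _ hZ.ne'
    linarith
  have h' : Real.exp t * Z ≤ ∫ x, Real.exp (X x) ∂Q := by
    refine le_trans (le_of_eq ?_) h
    simp only [Pi.sub_apply] at *
    rw [← hZd, ← hJ, e]
  rw [← Real.log_exp t, add_comm, ← Real.log_mul (Real.exp_pos _).ne' hZ.ne']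
  exact Real.log_le_log (by positivity) h'

/-- The entropy of `exp φ`. -/
noncomputable def expEntropy (φ : Ω → ℝ) : ℝ :=
  ∫ x, Real.exp (φ x) * φ x ∂Q - (∫ x, Real.exp (φ x) ∂Q) * Real.log (∫ x, Real.exp (φ x) ∂Q)

variable {Q} {H w : Ω → ℝ} (hH : Measurable H) (hw : Measurable w) {C : ℝ}
  (hHC : ∀ x, |H x| ≤ C) (hwC : ∀ x, |w x| ≤ C)

include hH hw hHC hwC in
-- Gibbs' principle with the law tilted by `a H` and the exponent `H + κ w`. The tilted mean of `w`
-- is bounded below by the entropy. For κ = a(a - 1) the entropy drops out and a norm bound is left;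
-- for larger κ the entropy itself, hence the derivative of the norm in a, is bounded.
theorem log_integral_exp_ge_of_expEntropy_le {a κ : ℝ} (ha : 0 < a) (hκ : 0 ≤ κ)
    (hent : expEntropy Q (fun x => a * H x) ≤ a ^ 2 * ∫ x, Real.exp (a * H x) * w x ∂Q) :
    Real.log (∫ x, Real.exp (a * H x) ∂Q) / a + (κ - a * (a - 1)) *
        (expEntropy Q (fun x => a * H x) / (∫ x, Real.exp (a * H x) ∂Q) / a ^ 2) ≤
      Real.log (∫ x, Real.exp (H x + κ * w x) ∂Q) := by
  have haH : ∀ x, |a * H x| ≤ a * C := fun x => by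
    rw [abs_mul, abs_of_pos ha]; exact mul_le_mul_of_nonneg_left (hHC x) ha.le
  have hX : ∀ x, |H x + κ * w x| ≤ C + κ * C := fun x => by
    refine (abs_add_le _ _).trans (add_le_add (hHC x) ?_)
    rw [abs_mul, abs_of_nonneg hκ]; exact mul_le_mul_of_nonneg_left (hwC x) hκ
  have ie := integrable_exp_of_abs_le Q (hH.const_mul a) haH
  have hZ : 0 < ∫ x, Real.exp (a * H x) ∂Q := integral_exp_pos ie
  have h := log_integral_exp_add_le Q (φ := fun x => a * H x) (X := fun x => H x + κ * w x)
    (C := max (a * C) (C + κ * C)) (by fun_prop) (by fun_prop)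
    (fun x => (haH x).trans (le_max_left _ _)) (fun x => (hX x).trans (le_max_right _ _))
  have iH := integrable_exp_mul_of_abs_le Q (hH.const_mul a) hH haH hHC
  have iw := integrable_exp_mul_of_abs_le Q (hH.const_mul a) hw haH hwC
  have e1 : ∫ x, Real.exp (a * H x) * (H x + κ * w x - a * H x) ∂Q =
      (1 - a) * (∫ x, Real.exp (a * H x) * H x ∂Q) + κ * ∫ x, Real.exp (a * H x) * w x ∂Q := by
    rw [← integral_const_mul, ← integral_const_mul,
      ← integral_add (iH.const_mul _) (iw.const_mul _)]
    congr 1; funext x; ring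
  have e2 : ∫ x, Real.exp (a * H x) * (a * H x) ∂Q = a * ∫ x, Real.exp (a * H x) * H x ∂Q := by
    rw [← integral_const_mul]
    congr 1; funext x; ring
  rw [e1] at h
  set Z := ∫ x, Real.exp (a * H x) ∂Q with hZd
  set J := ∫ x, Real.exp (a * H x) * H x ∂Q
  set B := ∫ x, Real.exp (a * H x) * w x ∂Q
  have e3 : expEntropy Q (fun x => a * H x) = a * J - Z * Real.log Z := by
    rw [expEntropy, e2]
  rw [e3] at hent ⊢
  refine le_trans ?_ h
  rw [← sub_nonneg]
  have e4 : Real.log Z + ((1 - a) * J + κ * B) / Z - (Real.log Z / a + (κ - a * (a - 1)) *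
      ((a * J - Z * Real.log Z) / Z / a ^ 2)) =
      κ * (a ^ 2 * B - (a * J - Z * Real.log Z)) / (Z * a ^ 2) := by
    field_simp
    ring
  rw [e4]
  have : 0 ≤ a ^ 2 * B - (a * J - Z * Real.log Z) := by linarith
  positivity

include hH hw hHC hwC in
/-- A bound on an entropy gives a bound on an `L^α` norm. -/
theorem log_integral_exp_mul_div_le {α : ℝ} (hα : 1 ≤ α)
    (hent : expEntropy Q (fun x => α * H x) ≤ α ^ 2 * ∫ x, Real.exp (α * H x) * w x ∂Q) :
    Real.log (∫ x, Real.exp (α * H x) ∂Q) / α ≤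
      Real.log (∫ x, Real.exp (H x + α * (α - 1) * w x) ∂Q) := by
  have h := log_integral_exp_ge_of_expEntropy_le hH hw hHC hwC (a := α) (κ := α * (α - 1))
    (by linarith) (mul_nonneg (by linarith) (by linarith)) hent
  simpa using h

theorem expEntropy_nonneg {φ : Ω → ℝ} (hφ : Measurable φ) {C : ℝ} (hC : ∀ x, |φ x| ≤ C) :
    0 ≤ expEntropy Q φ := by
  have ie := integrable_exp_of_abs_le Q hφ hC
  have hZ : 0 < ∫ x, Real.exp (φ x) ∂Q := integral_exp_pos ie
  have h := log_integral_exp_add_le Q (φ := φ) (X := fun _ => 0) hφ measurable_const hC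
    (fun x => by simpa using (abs_nonneg _).trans (hC x))
  have e : ∫ x, Real.exp (φ x) * (0 - φ x) ∂Q = - ∫ x, Real.exp (φ x) * φ x ∂Q := by
    rw [← integral_neg]; congr 1; funext x; ring
  rw [e] at h
  simp only [Real.exp_zero, integral_const, probReal_univ, smul_eq_mul, mul_one, Real.log_one] at h
  have h2 := mul_le_mul_of_nonneg_right h hZ.le
  rw [add_mul, div_mul_cancel₀ _ hZ.ne', zero_mul] at h2
  rw [expEntropy]
  linarith

include hH hw hHC hwC in
/-- Interpolated bound on an `L^α` norm from entropy bounds for all smaller exponents. -/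
theorem log_integral_exp_mul_div_le_interpolate {α κ ω : ℝ} (hα : 1 < α)
    (hκ : α * (α - 1) < κ) (hω : α - 1 ≤ ω * (κ - α * (α - 1)))
    (hent : ∀ a, 1 ≤ a → a ≤ α →
      expEntropy Q (fun x => a * H x) ≤ a ^ 2 * ∫ x, Real.exp (a * H x) * w x ∂Q) :
    Real.log (∫ x, Real.exp (α * H x) ∂Q) / α ≤
      (1 - ω) * Real.log (∫ x, Real.exp (H x) ∂Q) +
        ω * Real.log (∫ x, Real.exp (H x + κ * w x) ∂Q) := by
  have hκ0 : 0 ≤ κ := le_trans (mul_nonneg (by linarith) (by linarith)) hκ.le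
  have haH : ∀ a, 0 < a → ∀ x, |a * H x| ≤ a * C := fun a ha x => by
    rw [abs_mul, abs_of_pos ha]; exact mul_le_mul_of_nonneg_left (hHC x) ha.le
  have hset : integrableExpSet H Q = Set.univ := by
    refine Set.eq_univ_of_forall fun a => ?_
    refine integrable_exp_of_abs_le Q (φ := fun x => a * H x) (by fun_prop) (C := |a| * C) fun x => ?_
    rw [abs_mul]; exact mul_le_mul_of_nonneg_left (hHC x) (abs_nonneg _)
  set G : ℝ → ℝ := fun a => Real.log (∫ x, Real.exp (a * H x) ∂Q) / a with hG
  set k : ℝ → ℝ := fun a =>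
    expEntropy Q (fun x => a * H x) / (∫ x, Real.exp (a * H x) ∂Q) / a ^ 2 with hk
  set N := Real.log (∫ x, Real.exp (H x + κ * w x) ∂Q) with hN
  have hZ : ∀ a, 0 < ∫ x, Real.exp (a * H x) ∂Q := fun a => integral_exp_pos (by
    have : a ∈ integrableExpSet H Q := by rw [hset]; trivial
    exact this)
  -- The logarithm of the L^a norm has the normalized entropy, divided by a², as its derivative.
  have hd : ∀ a, 0 < a → HasDerivAt G (k a) a := by
    intro a ha
    have h1 : HasDerivAt (mgf H Q) (∫ x, H x * Real.exp (a * H x) ∂Q) a :=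
      hasDerivAt_mgf (by rw [hset, interior_univ]; trivial)
    have h2 := (h1.log (hZ a).ne').div (hasDerivAt_id a) ha.ne'
    refine h2.congr_deriv ?_
    have e2 : ∫ x, Real.exp (a * H x) * (a * H x) ∂Q = a * ∫ x, H x * Real.exp (a * H x) ∂Q := by
      rw [← integral_const_mul]
      congr 1; funext x; ring
    simp only [hk, expEntropy, e2, id, mgf]
    have := hZ a
    generalize (∫ x, H x * Real.exp (a * H x) ∂Q) = J
    generalize (∫ x, Real.exp (a * H x) ∂Q) = Z at this ⊢
    field_simp
  have hk0 : ∀ a, 0 < a → 0 ≤ k a := fun a ha =>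
    div_nonneg (div_nonneg (expEntropy_nonneg (by fun_prop) (haH a ha)) (hZ a).le) (by positivity)
  have hcont : ContinuousOn G (Set.Icc 1 α) := fun a ha =>
    (hd a (by linarith [ha.1])).continuousAt.continuousWithinAt
  have hmono : MonotoneOn G (Set.Icc 1 α) := by
    refine monotoneOn_of_deriv_nonneg (convex_Icc _ _) hcont (fun a ha => ?_) fun a ha => ?_
    · rw [interior_Icc] at ha
      exact (hd a (by linarith [ha.1])).differentiableAt.differentiableWithinAt
    · rw [interior_Icc] at ha
      rw [(hd a (by linarith [ha.1])).deriv]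
      exact hk0 a (by linarith [ha.1])
  -- The norm increases with a, and a(a - 1) is largest at α; so the derivative has one bound on all
  -- of [1, α], to be used in the mean value inequality.
  have hbound : ∀ a, 1 ≤ a → a ≤ α → (κ - α * (α - 1)) * k a ≤ N - G 1 := fun a h1 h2 => by
    have h := log_integral_exp_ge_of_expEntropy_le hH hw hHC hwC (a := a) (by linarith) hκ0
      (hent a h1 h2)
    have h3 : G 1 ≤ G a := hmono ⟨le_rfl, hα.le⟩ ⟨h1, h2⟩ h1
    have h4 : a * (a - 1) ≤ α * (α - 1) := by nlinarith
    have h5 := mul_le_mul_of_nonneg_right (sub_le_sub_left h4 κ) (hk0 a (by linarith))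
    change G a + (κ - a * (a - 1)) * k a ≤ N at h
    linarith
  have hgap : 0 < κ - α * (α - 1) := by linarith
  have hN1 : 0 ≤ N - G 1 :=
    (mul_nonneg hgap.le (hk0 1 one_pos)).trans (hbound 1 le_rfl hα.le)
  have hmvt := (convex_Icc 1 α).image_sub_le_mul_sub_of_deriv_le hcont
    (fun a ha => by
      rw [interior_Icc] at ha
      exact (hd a (by linarith [ha.1])).differentiableAt.differentiableWithinAt)
    (C := (N - G 1) / (κ - α * (α - 1))) (fun a ha => by
      rw [interior_Icc] at ha
      rw [(hd a (by linarith [ha.1])).deriv, le_div_iff₀ hgap, mul_comm]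
      exact hbound a ha.1.le ha.2.le) 1 ⟨le_rfl, hα.le⟩ α ⟨hα.le, le_rfl⟩ hα.le
  have h6 : (N - G 1) / (κ - α * (α - 1)) * (α - 1) ≤ ω * (N - G 1) := by
    rw [div_mul_eq_mul_div, div_le_iff₀ hgap]
    have := mul_le_mul_of_nonneg_left hω hN1
    linarith
  have hG1 : G 1 = Real.log (∫ x, Real.exp (H x) ∂Q) := by simp [hG]
  rw [← hG1]
  change G α ≤ _
  linarith

end

/-! ### Entropy bounded by squared increments -/

/-- The coefficients 1/6 and 1/3 are those for which all lower terms cancel in the derivative,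
leaving y³/9 times an exponential; the minimum is therefore at y = 0. -/
theorem one_le_exp_mul_quadratic (y : ℝ) :
    1 ≤ Real.exp (y + y ^ 2 / 6) * (y ^ 2 / 3 - y + 1) := by
  set φ : ℝ → ℝ := fun y => Real.exp (y + y ^ 2 / 6) * (y ^ 2 / 3 - y + 1) with hφ
  have hd : ∀ y, HasDerivAt φ (Real.exp (y + y ^ 2 / 6) * (y ^ 3 / 9)) y := fun y => by
    have h1 : HasDerivAt (fun y : ℝ => y + y ^ 2 / 6) (1 + 2 * y / 6) y := 
      ((hasDerivAt_id' y).add ((hasDerivAt_pow 2 y).div_const 6)).congr_deriv (by norm_num)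
    have h2 : HasDerivAt (fun y : ℝ => y ^ 2 / 3 - y + 1) (2 * y / 3 - 1) y := 
      ((((hasDerivAt_pow 2 y).div_const 3).sub (hasDerivAt_id' y)).add_const 1).congr_deriv
        (by norm_num)
    refine (h1.exp.mul h2).congr_deriv ?_
    ring
  have h0 : φ 0 = 1 := by simp [hφ]
  have hc : Continuous φ := by fun_prop
  change 1 ≤ φ y
  refine h0.symm.trans_le ?_
  rcases le_total 0 y with hy | hy
  · refine monotoneOn_of_deriv_nonneg (convex_Ici 0) hc.continuousOn
      (fun x _ => (hd x).differentiableAt.differentiableWithinAt) (fun x hx => ?_)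
      Set.self_mem_Ici hy hy
    rw [interior_Ici, Set.mem_Ioi] at hx
    rw [(hd x).deriv]; positivity
  · refine antitoneOn_of_deriv_nonpos (convex_Iic 0) hc.continuousOn
      (fun x _ => (hd x).differentiableAt.differentiableWithinAt) (fun x hx => ?_)
      hy Set.self_mem_Iic hy
    rw [interior_Iic, Set.mem_Iio] at hx
    rw [(hd x).deriv]
    have : x ^ 3 ≤ 0 := by nlinarith [sq_nonneg x]
    exact mul_nonpos_of_nonneg_of_nonpos (Real.exp_pos _).le (by linarith)

/-- As a function of c the first term is smallest at c = exp(-y²/6), with value -exp(-y²/6), and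
there the inequality is the preceding one. The free c will be the integral of exp y. -/
theorem entropy_pointwise_ineq (y : ℝ) {c : ℝ} (hc : 0 < c) :
    0 ≤ c * (y ^ 2 / 6 + Real.log c - 1) + Real.exp y * (y ^ 2 / 3 - y + 1) := by
  have h1 := Real.one_sub_inv_le_log_of_pos (mul_pos hc (Real.exp_pos (y ^ 2 / 6)))
  rw [Real.log_mul hc.ne' (Real.exp_pos _).ne', Real.log_exp, mul_inv, ← Real.exp_neg] at h1
  have h2 := mul_le_mul_of_nonneg_left h1 hc.le
  have h3 : c * (1 - c⁻¹ * Real.exp (-(y ^ 2 / 6))) = c - Real.exp (-(y ^ 2 / 6)) := by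
    field_simp
  have h4 := mul_le_mul_of_nonneg_left (one_le_exp_mul_quadratic y) (Real.exp_pos (-(y ^ 2 / 6))).le
  rw [Real.exp_add, ← mul_assoc, mul_comm (Real.exp y), ← mul_assoc, ← Real.exp_add] at h4
  simp only [neg_add_cancel, Real.exp_zero, one_mul, mul_one] at h4
  rw [h3] at h2
  linarith

theorem expMean_singleton {𝒳 : Type*} [MeasurableSpace 𝒳] (P : Measure 𝒳) {n : ℕ}
    {φ : (Fin n → 𝒳) → ℝ} (hφ : Measurable φ) (i : Fin n) (S : Fin n → 𝒳) :
    expMean P φ {i} S = ∫ x, Real.exp (φ (Function.update S i x)) ∂P := by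
  rw [expMean, lmarginal_singleton, integral_eq_lintegral_of_nonneg_ae
    (Filter.Eventually.of_forall fun x => (Real.exp_pos _).le)
    (by have : Measurable fun x => Real.exp (φ (Function.update S i x)) := by fun_prop
        exact this.aestronglyMeasurable)]

section

variable {𝒳 : Type*} [MeasurableSpace 𝒳] (P : Measure 𝒳) [IsProbabilityMeasure P]

/-- Integrate the pointwise inequality with c = ∫ exp y. No size restriction on y is needed, and
besides the density exp y only squares of y occur, which makes the factor a² appear for y = a h. -/
theorem expEntropy_le {y : 𝒳 → ℝ} (hy : Measurable y) {C : ℝ} (hC : ∀ x, |y x| ≤ C) :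
    expEntropy P y ≤ (∫ x, Real.exp (y x) ∂P) * (1 / 6 * ∫ x, y x ^ 2 ∂P) +
      1 / 3 * ∫ x, Real.exp (y x) * y x ^ 2 ∂P := by
  have ie := integrable_exp_of_abs_le P hy hC
  have hZ : 0 < ∫ x, Real.exp (y x) ∂P := integral_exp_pos ie
  have hb : ∀ x, |y x ^ 2| ≤ C ^ 2 := fun x => by
    rw [abs_pow]; exact pow_le_pow_left₀ (abs_nonneg _) (hC x) 2
  have i2 := integrable_of_abs_le P (hy.pow_const 2) _ hb
  have ie2 := integrable_exp_mul_of_abs_le P hy (hy.pow_const 2) hC hb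
  have ie1 := integrable_exp_mul_of_abs_le P hy hy hC hC
  set Z := ∫ x, Real.exp (y x) ∂P with hZd
  have h : 0 ≤ ∫ x, (Z / 6 * y x ^ 2 + Z * (Real.log Z - 1) +
      (1 / 3 * (Real.exp (y x) * y x ^ 2) - Real.exp (y x) * y x + Real.exp (y x))) ∂P :=
    integral_nonneg fun x => by
      have := entropy_pointwise_ineq (y x) hZ
      simp only [Pi.zero_apply]
      refine this.trans (le_of_eq ?_)
      ring
  have i3 : Integrable (fun x => Z / 6 * y x ^ 2 + Z * (Real.log Z - 1)) P :=
    (i2.const_mul _).add (integrable_const _)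
  have i4 : Integrable (fun x => 1 / 3 * (Real.exp (y x) * y x ^ 2) - Real.exp (y x) * y x) P :=
    (ie2.const_mul _).sub ie1
  have i5 : Integrable (fun x => 1 / 3 * (Real.exp (y x) * y x ^ 2) - Real.exp (y x) * y x +
    Real.exp (y x)) P := i4.add ie
  rw [integral_add i3 i5, integral_add (i2.const_mul _) (integrable_const _), integral_add i4 ie,
    integral_sub (ie2.const_mul _) ie1, integral_const_mul (Z / 6), integral_const_mul (1 / 3)] at h
  simp only [integral_const, probReal_univ, one_smul] at h
  rw [expEntropy, ← hZd]
  linarith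

variable {n : ℕ}

/-- Bound on the entropy of `exp (a * H)` on a product space by the squares of the increments of
`H` over each coordinate. -/
theorem expEntropy_const_mul_le {H : (Fin n → 𝒳) → ℝ} {h base : Fin n → (Fin n → 𝒳) → ℝ}
    (hH : Measurable H) (hh : ∀ i, Measurable (h i)) {C : ℝ} (hHC : ∀ S, |H S| ≤ C)
    (hhC : ∀ i S, |h i S| ≤ C) (hdec : ∀ i S, H S = base i S + h i S)
    (hbase : ∀ i S x, base i (Function.update S i x) = base i S) (a : ℝ) :
    expEntropy (Measure.pi fun _ => P) (fun S => a * H S) ≤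
      a ^ 2 * ∫ S, Real.exp (a * H S) * (∑ i, (1 / 6 * ∫ x, h i (Function.update S i x) ^ 2 ∂P +
        1 / 3 * h i S ^ 2)) ∂(Measure.pi fun _ => P) := by
  have hφ : Measurable fun S => a * H S := hH.const_mul a
  have hφC : ∀ S, |a * H S| ≤ |a| * C := fun S => by
    rw [abs_mul]; exact mul_le_mul_of_nonneg_left (hHC S) (abs_nonneg _)
  have hsqC : ∀ i S, |h i S ^ 2| ≤ C ^ 2 := fun i S => by
    rw [abs_pow]; exact pow_le_pow_left₀ (abs_nonneg _) (hhC i S) 2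
  have hmean_m : ∀ i, Measurable fun S => ∫ x, h i (Function.update S i x) ^ 2 ∂P := fun i =>
    measurable_integral_right P (f := fun S x => h i (Function.update S i x) ^ 2)
      (((hh i).comp (measurePreserving_update P i).measurable).pow_const 2)
  have hmean_b : ∀ i S, |∫ x, h i (Function.update S i x) ^ 2 ∂P| ≤ C ^ 2 := fun i S => by
    refine abs_integral_le_integral_abs.trans ?_
    refine (integral_mono_of_nonneg (Filter.Eventually.of_forall fun x => abs_nonneg _)
      (integrable_const (C ^ 2)) (Filter.Eventually.of_forall fun x => hsqC i _)).trans ?_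
    simp
  have hw_m : ∀ i, Measurable fun S => 1 / 6 * ∫ x, h i (Function.update S i x) ^ 2 ∂P +
      1 / 3 * h i S ^ 2 := fun i => by
    have := hmean_m i
    have := hh i
    fun_prop
  have hw_b : ∀ i S, |1 / 6 * ∫ x, h i (Function.update S i x) ^ 2 ∂P + 1 / 3 * h i S ^ 2| ≤
      1 / 6 * C ^ 2 + 1 / 3 * C ^ 2 := fun i S => by
    refine (abs_add_le _ _).trans ?_
    rw [abs_mul, abs_mul, abs_of_pos (by norm_num : (0 : ℝ) < 1 / 6),
      abs_of_pos (by norm_num : (0 : ℝ) < 1 / 3)]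
    have := hmean_b i S
    have := hsqC i S
    gcongr
  have hiw := fun i => integrable_exp_mul_of_abs_le (Measure.pi fun _ => P) hφ (hw_m i) hφC (hw_b i)
  have step : ∀ i : Fin n, ∫ S, Real.exp (a * H S) *
      (a * H S - Real.log (expMean P (fun S => a * H S) {i} S)) ∂(Measure.pi fun _ => P) ≤
      a ^ 2 * ∫ S, Real.exp (a * H S) * (1 / 6 * ∫ x, h i (Function.update S i x) ^ 2 ∂P +
        1 / 3 * h i S ^ 2) ∂(Measure.pi fun _ => P) := by
    intro i
    have hlm : Measurable fun S => a * H S - Real.log (expMean P (fun S => a * H S) {i} S) :=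
      hφ.sub (measurable_expMean hφ {i}).log
    have il := integrable_exp_mul_of_abs_le (Measure.pi fun _ => P) hφ hlm hφC
      (D := |a| * C + |a| * C) fun S =>
        (abs_sub _ _).trans (add_le_add (hφC S) (abs_log_expMean_le hφC {i} S))
    -- Both sides are averaged over a redrawn coordinate `i`. Given the other coordinates, `base i`
    -- is constant and its exponential factors out, so the bound for one coordinate applies.
    rw [integral_pi_update P i il, integral_pi_update P i (hiw i), ← integral_const_mul]
    have hcompP : MeasurePreserving (fun p : (Fin n → 𝒳) × 𝒳 => Function.update p.1 i p.2)
      ((Measure.pi fun _ => P).prod P) (Measure.pi fun _ => P) := measurePreserving_update P i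
    have il' : Integrable (fun S => ∫ x, (fun S => Real.exp (a * H S) *
        (a * H S - Real.log (expMean P (fun S => a * H S) {i} S))) (Function.update S i x) ∂P)
        (Measure.pi fun _ => P) :=
      (hcompP.integrable_comp_of_integrable il).integral_prod_left
    have iw' : Integrable (fun S => ∫ x, (fun S => Real.exp (a * H S) *
        (1 / 6 * ∫ x, h i (Function.update S i x) ^ 2 ∂P + 1 / 3 * h i S ^ 2))
        (Function.update S i x) ∂P) (Measure.pi fun _ => P) :=
      (hcompP.integrable_comp_of_integrable (hiw i)).integral_prod_left
    refine integral_mono il' (iw'.const_mul _) fun S => ?_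
    simp only
    set y : 𝒳 → ℝ := fun x => a * h i (Function.update S i x) with hy
    have hym : Measurable y := by
      have := hh i
      fun_prop
    have hyC : ∀ x, |y x| ≤ |a| * C := fun x => by
      rw [hy, abs_mul]; exact mul_le_mul_of_nonneg_left (hhC i _) (abs_nonneg _)
    have hent := expEntropy_le P hym hyC
    have iey := integrable_exp_of_abs_le P hym hyC
    have hZ : 0 < ∫ x, Real.exp (y x) ∂P := integral_exp_pos iey
    have eH : ∀ x, a * H (Function.update S i x) = a * base i S + y x := fun x => by
      rw [hdec i, hbase, mul_add]
    have eM : ∀ x, expMean P (fun S => a * H S) {i} (Function.update S i x) =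
        Real.exp (a * base i S) * ∫ x, Real.exp (y x) ∂P := fun x => by
      rw [expMean_singleton P hφ, ← integral_const_mul]
      simp only [Function.update_idem, eH, Real.exp_add]
    have eu : ∀ x, ∫ x', h i (Function.update (Function.update S i x) i x') ^ 2 ∂P =
        ∫ x', h i (Function.update S i x') ^ 2 ∂P := fun x => by
      simp only [Function.update_idem]
    simp only [eH, eM, eu, Real.log_mul (Real.exp_pos _).ne' hZ.ne', Real.log_exp, Real.exp_add]
    have e2 : ∀ x, y x ^ 2 = a ^ 2 * h i (Function.update S i x) ^ 2 := fun x => by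
      rw [hy]; ring
    have iey1 := integrable_exp_mul_of_abs_le P hym hym hyC hyC
    have hh2 : Measurable fun x => h i (Function.update S i x) ^ 2 := by
      have := hh i
      fun_prop
    have ieh := integrable_exp_mul_of_abs_le P hym hh2 hyC (fun x => hsqC i _)
    set Z := ∫ x, Real.exp (y x) ∂P with hZd
    set B := ∫ x, h i (Function.update S i x) ^ 2 ∂P with hB
    have el : ∫ x, Real.exp (a * base i S) * Real.exp (y x) *
        (a * base i S + y x - (a * base i S + Real.log Z)) ∂P =
        Real.exp (a * base i S) * expEntropy P y := by
      rw [expEntropy, ← hZd, mul_comm Z, ← integral_const_mul, ← integral_sub iey1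
        (iey.const_mul _), ← integral_const_mul]
      congr 1; funext x; ring
    have er : ∫ x, Real.exp (a * base i S) * Real.exp (y x) *
        (1 / 6 * B + 1 / 3 * h i (Function.update S i x) ^ 2) ∂P =
        Real.exp (a * base i S) * (Z * (1 / 6 * B) +
          1 / 3 * ∫ x, Real.exp (y x) * h i (Function.update S i x) ^ 2 ∂P) := by
      rw [hZd, ← integral_mul_const, ← integral_const_mul (1 / 3), ← integral_add (iey.mul_const _)
        (ieh.const_mul _), ← integral_const_mul (Real.exp (a * base i S))]
      congr 1; funext x; ring
    rw [el, er]
    have e3 : ∫ x, y x ^ 2 ∂P = a ^ 2 * B := by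
      simp only [e2]; rw [integral_const_mul]
    have e4 : ∫ x, Real.exp (y x) * y x ^ 2 ∂P =
        a ^ 2 * ∫ x, Real.exp (y x) * h i (Function.update S i x) ^ 2 ∂P := by
      rw [← integral_const_mul]; simp only [e2]
      congr 1; funext x; ring
    rw [e3, e4] at hent
    refine (mul_le_mul_of_nonneg_left hent (Real.exp_pos _).le).trans (le_of_eq ?_)
    ring
  have hsub := entropy_le_sum_groups (P := P) hφ hφC (fun i : Fin n => i)
  have ef : ∀ r : Fin n, (Finset.univ.filter fun i : Fin n => i = r) = {r} := fun r => by
    ext; simp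
  simp only [ef] at hsub
  refine hsub.trans ((Finset.sum_le_sum fun i _ => step i).trans (le_of_eq ?_))
  rw [← Finset.mul_sum, ← integral_finsetSum _ fun i _ => hiw i]
  simp only [Finset.mul_sum]

end

/-! ### Rényi bounds for the law of data and path -/

/-- The Rényi divergence of order `1 + s`, times `s`, of the law with density `p` from the product
of `Q` and some other law is at most `ψ`. -/
def HasRenyiBound {Ω Ω' : Type*} [MeasurableSpace Ω] [MeasurableSpace Ω'] (Q : Measure Ω)
    (γ : Measure Ω') (p : Ω → Ω' → ℝ≥0∞) (s ψ : ℝ) : Prop :=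
  ∃ q : Ω' → ℝ≥0∞, Measurable q ∧ (∀ v, q v ≠ 0) ∧ (∀ v, q v ≠ ∞) ∧ ∫⁻ v, q v ∂γ ≤ 1 ∧
    ∫⁻ v, ∫⁻ x, p x v ^ (1 + s) * q v ^ (-s) ∂Q ∂γ ≤ ENNReal.ofReal (Real.exp ψ)

theorem HasRenyiBound.mono {Ω Ω' : Type*} [MeasurableSpace Ω] [MeasurableSpace Ω'] {Q : Measure Ω}
    {γ : Measure Ω'} {p : Ω → Ω' → ℝ≥0∞} {s ψ ψ' : ℝ} (h : HasRenyiBound Q γ p s ψ) (hψ : ψ ≤ ψ') :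
    HasRenyiBound Q γ p s ψ' := by
  obtain ⟨q, h1, h2, h3, h4, h5⟩ := h
  exact ⟨q, h1, h2, h3, h4, h5.trans (ENNReal.ofReal_le_ofReal (Real.exp_le_exp.2 hψ))⟩

theorem ofReal_exp_rpow (x r : ℝ) :
    ENNReal.ofReal (Real.exp x) ^ r = ENNReal.ofReal (Real.exp (x * r)) := by
  rw [ENNReal.ofReal_rpow_of_pos (Real.exp_pos _), Real.exp_mul]

theorem ofReal_exp_mul (x y : ℝ) : ENNReal.ofReal (Real.exp x) * ENNReal.ofReal (Real.exp y) =
    ENNReal.ofReal (Real.exp (x + y)) := by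
  rw [← ENNReal.ofReal_mul (Real.exp_pos _).le, Real.exp_add]

/-- A Rényi bound from an `L^α`-norm bound. -/
theorem HasRenyiBound.of_norm {Ω Ω' : Type*} [MeasurableSpace Ω] [MeasurableSpace Ω']
    (Q : Measure Ω) [IsProbabilityMeasure Q] (γ : Measure Ω') {ℓ : Ω → Ω' → ℝ}
    (hℓ : Measurable (Function.uncurry ℓ)) (hb : ∀ v, ∃ C, ∀ x, |ℓ x v| ≤ C) {s Λ : ℝ} (hs : 0 ≤ s)
    (hN : ∫⁻ v, ENNReal.ofReal (Real.exp
      (Real.log (∫ x, Real.exp ((1 + s) * ℓ x v) ∂Q) / (1 + s))) ∂γ ≤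
        ENNReal.ofReal (Real.exp Λ)) :
    HasRenyiBound Q γ (fun x v => ENNReal.ofReal (Real.exp (ℓ x v))) s ((1 + s) * Λ) := by
  set α := 1 + s with hα
  have hα0 : 0 < α := by linarith
  set L : Ω' → ℝ := fun v => Real.log (∫ x, Real.exp (α * ℓ x v) ∂Q) / α with hL
  have hLm : Measurable L := by
    have h1 : Measurable (Function.uncurry fun v x => Real.exp (α * ℓ x v)) :=
      ((hℓ.comp measurable_swap).const_mul α).exp
    have h2 := (measurable_integral_right Q h1).log
    exact h2.div_const α
  -- The L^(1+s) norm over the data is, up to normalization, the choice of q with the least Rényi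
  -- divergence; dividing by exp Λ makes its mass at most one.
  refine ⟨fun v => ENNReal.ofReal (Real.exp (L v - Λ)), by fun_prop, fun v => ?_,
    fun v => ENNReal.ofReal_ne_top, ?_, ?_⟩
  · exact (ENNReal.ofReal_pos.2 (Real.exp_pos _)).ne'
  · simp only [sub_eq_add_neg, ← ofReal_exp_mul]
    rw [lintegral_mul_const' _ _ ENNReal.ofReal_ne_top]
    refine (mul_le_mul_left hN _).trans ?_
    rw [ofReal_exp_mul]; simp
  · have e : ∀ v, ∫⁻ x, ENNReal.ofReal (Real.exp (ℓ x v)) ^ α *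
        ENNReal.ofReal (Real.exp (L v - Λ)) ^ (-s) ∂Q =
        ENNReal.ofReal (Real.exp (L v)) * ENNReal.ofReal (Real.exp (Λ * s)) := fun v => by
      obtain ⟨C, hC⟩ := hb v
      have hm : Measurable fun x => ℓ x v := hℓ.comp measurable_prodMk_right
      have hi : Integrable (fun x => Real.exp (α * ℓ x v)) Q :=
        integrable_exp_of_abs_le Q (φ := fun x => α * ℓ x v) (by fun_prop) (C := α * C) fun x => by
          rw [abs_mul, abs_of_pos hα0]; exact mul_le_mul_of_nonneg_left (hC x) hα0.le
      simp only [ofReal_exp_rpow]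
      rw [lintegral_mul_const' _ _ ENNReal.ofReal_ne_top]
      have e0 : ∀ x, ℓ x v * α = α * ℓ x v := fun x => mul_comm _ _
      simp only [e0]
      rw [← ofReal_integral_eq_lintegral_ofReal hi
        (Filter.Eventually.of_forall fun x => (Real.exp_pos _).le),
        ← Real.exp_log (integral_exp_pos hi), ofReal_exp_mul, ofReal_exp_mul]
      have : Real.log (∫ x, Real.exp (α * ℓ x v) ∂Q) = α * L v := by
        simp only [hL]; field_simp
      rw [this]
      congr 2
      rw [hα]; ring
    refine (lintegral_congr e).trans_le ?_
    rw [lintegral_mul_const' _ _ ENNReal.ofReal_ne_top]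
    refine (mul_le_mul_left hN _).trans ?_
    rw [ofReal_exp_mul, hα]
    refine ENNReal.ofReal_le_ofReal (Real.exp_le_exp.2 (le_of_eq (by ring)))

namespace PathField

variable {𝒳 : Type*} [MeasurableSpace 𝒳] {d K n : ℕ} {b : ℝ}

local notation "V" => EuclideanSpace ℝ (Fin d)

@[fun_prop]
theorem measurable_logLik_drift (o : PathField 𝒳 d K b) (I : Fin K → Finset (Fin n))
    {X : Type*} [MeasurableSpace X] {g : X → Fin n → 𝒳} {h : X → Fin K → V}
    (hg : Measurable g) (hh : Measurable h) :
    Measurable fun p => logLik (o.drift I (g p)) (h p) := by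
  unfold logLik
  fun_prop

@[fun_prop]
theorem measurable_gain (o : PathField 𝒳 d K b) (I : Fin K → Finset (Fin n)) (G : Finset (Fin n))
    {X : Type*} [MeasurableSpace X] {g : X → Fin n → 𝒳} {h : X → Fin K → V}
    (hg : Measurable g) (hh : Measurable h) :
    Measurable fun p => o.gain I G (g p) (h p) := by
  unfold gain
  fun_prop

theorem norm_drift_le (o : PathField 𝒳 d K b) (I : Fin K → Finset (Fin n)) (S : Fin n → 𝒳)
    (k : Fin K) (v : Fin K → V) : ‖o.drift I S k v‖ ≤ (I k).card * b := by
  refine (norm_sum_le _ _).trans ?_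
  rw [← nsmul_eq_mul]
  exact Finset.sum_le_card_nsmul _ _ _ fun i _ => o.bound _ _ _

/-- A bound on the log-likelihood of a path that is uniform in the data. -/
noncomputable def logLikBound (d K n : ℕ) (b : ℝ) (v : Fin K → EuclideanSpace ℝ (Fin d)) : ℝ :=
  ∑ k, (‖v k‖ * (n * |b|) + (n * |b|) ^ 2 / 2)

theorem abs_logLik_drift_le (o : PathField 𝒳 d K b) (I : Fin K → Finset (Fin n)) (S : Fin n → 𝒳)
    (v : Fin K → V) : |logLik (o.drift I S) v| ≤ logLikBound d K n b v := by
  refine (Finset.abs_sum_le_sum_abs _ _).trans (Finset.sum_le_sum fun k _ => ?_)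
  have h1 : ‖o.drift I S k v‖ ≤ n * |b| := by
    refine (o.norm_drift_le I S k v).trans ?_
    have h2 : ((I k).card : ℝ) ≤ n := by
      exact_mod_cast (Finset.card_le_univ (I k)).trans_eq (Fintype.card_fin n)
    exact (mul_le_mul_of_nonneg_left (le_abs_self b) (by positivity)).trans
      (mul_le_mul_of_nonneg_right h2 (abs_nonneg b))
  refine (abs_sub _ _).trans (add_le_add ((abs_real_inner_le_norm _ _).trans (by gcongr)) ?_)
  rw [abs_of_nonneg (by positivity)]
  gcongr

theorem logLikBound_nonneg (v : Fin K → V) : 0 ≤ logLikBound d K n b v :=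
  Finset.sum_nonneg fun k _ => by positivity

theorem abs_gain_le (o : PathField 𝒳 d K b) (I : Fin K → Finset (Fin n)) (G : Finset (Fin n))
    (S : Fin n → 𝒳) (v : Fin K → V) : |o.gain I G S v| ≤ 2 * logLikBound d K n b v := by
  have h1 := o.abs_logLik_drift_le I S v
  have h2 := o.abs_logLik_drift_le (fun k => I k \ G) S v
  refine (abs_sub _ _).trans ?_
  linarith

theorem gain_base_update (o : PathField 𝒳 d K b) (I : Fin K → Finset (Fin n)) (i : Fin n)
    (S : Fin n → 𝒳) (x : 𝒳) (v : Fin K → V) :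
    logLik (o.drift (fun k => I k \ {i}) (Function.update S i x)) v =
      logLik (o.drift (fun k => I k \ {i}) S) v := by
  rw [o.drift_congr (fun k => I k \ {i}) (S := Function.update S i x) (S' := S) fun k j hj => by
    have : j ≠ i := by simp at hj; exact hj.2
    rw [Function.update_of_ne this]]

@[fun_prop]
theorem measurable_infoWeight (o : PathField 𝒳 d K b) (P : Measure 𝒳) [IsProbabilityMeasure P]
    (I : Fin K → Finset (Fin n)) {X : Type*} [MeasurableSpace X] {g : X → Fin n → 𝒳}
    {h : X → Fin K → V} (hg : Measurable g) (hh : Measurable h) :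
    Measurable fun p => o.infoWeight P I (g p) (h p) := by
  unfold infoWeight
  refine Finset.measurable_fun_sum _ fun i _ => ?_
  have h1 : Measurable (Function.uncurry fun (p : X) (x : 𝒳) =>
      o.gain I {i} (Function.update (g p) i x) (h p) ^ 2) := by
    have h2 : Measurable fun q : X × 𝒳 => Function.update (g q.1) i q.2 :=
      (measurePreserving_update P i).measurable.comp
        (f := fun q : X × 𝒳 => (g q.1, q.2)) (by fun_prop)
    have h3 : Measurable fun q : X × 𝒳 =>
        o.gain I {i} (Function.update (g q.1) i q.2) (h q.1) ^ 2 := by fun_prop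
    exact h3
  have h4 := measurable_integral_right P h1
  fun_prop

theorem abs_infoWeight_le (o : PathField 𝒳 d K b) (P : Measure 𝒳) [IsProbabilityMeasure P]
    (I : Fin K → Finset (Fin n)) (S : Fin n → 𝒳) (v : Fin K → V) :
    |o.infoWeight P I S v| ≤ n * (2 * logLikBound d K n b v) ^ 2 := by
  have hsq : ∀ i S, o.gain I {i} S v ^ 2 ≤ (2 * logLikBound d K n b v) ^ 2 := fun i S => by
    rw [← sq_abs]; exact pow_le_pow_left₀ (abs_nonneg _) (o.abs_gain_le I {i} S v) 2
  have h0 : 0 ≤ o.infoWeight P I S v := Finset.sum_nonneg fun i _ => by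
    have : 0 ≤ ∫ x, o.gain I {i} (Function.update S i x) v ^ 2 ∂P :=
      integral_nonneg fun x => sq_nonneg _
    positivity
  rw [abs_of_nonneg h0, infoWeight]
  have : ∀ i ∈ Finset.univ, 1 / 6 * ∫ x, o.gain I {i} (Function.update S i x) v ^ 2 ∂P +
      1 / 3 * o.gain I {i} S v ^ 2 ≤ (2 * logLikBound d K n b v) ^ 2 := fun i _ => by
    have h1 : ∫ x, o.gain I {i} (Function.update S i x) v ^ 2 ∂P ≤
        (2 * logLikBound d K n b v) ^ 2 := by
      refine (integral_mono_of_nonneg (Filter.Eventually.of_forall fun x => sq_nonneg _)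
        (integrable_const _) (Filter.Eventually.of_forall fun x => hsq i _)).trans ?_
      simp
    have h2 := hsq i S
    nlinarith [sq_nonneg (2 * logLikBound d K n b v)]
  refine (Finset.sum_le_card_nsmul _ _ _ this).trans (le_of_eq ?_)
  simp

/-- A Rényi bound for the adaptive Gaussian process from an exponential moment of `infoWeight`. -/
theorem hasRenyiBound_of_infoWeight (o : PathField 𝒳 d K b) (P : Measure 𝒳)
    [IsProbabilityMeasure P] (I : Fin K → Finset (Fin n)) {s κ ω Ψ : ℝ} (hs : 0 < s)
    (hω0 : 0 ≤ ω) (hω1 : ω ≤ 1)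
    (hκω : ω = 1 ∧ κ = (1 + s) * s ∨ (1 + s) * s < κ ∧ s ≤ ω * (κ - (1 + s) * s))
    (hΨ : ∀ S : Fin n → 𝒳, ∫⁻ v, lik (o.drift I S) v *
      ENNReal.ofReal (Real.exp (κ * o.infoWeight P I S v)) ∂(whiteNoise d K) ≤
        ENNReal.ofReal (Real.exp Ψ)) :
    HasRenyiBound (Measure.pi fun _ : Fin n => P) (whiteNoise d K)
      (fun S v => lik (o.drift I S) v) s ((1 + s) * (ω * Ψ)) := by
  simp only [lik_eq_exp_logLik]
  have hκ0 : 0 ≤ κ := by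
    have : 0 < (1 + s) * s := by positivity
    rcases hκω with ⟨_, h⟩ | ⟨h, _⟩ <;> linarith
  have hjoint : Measurable fun p : (Fin n → 𝒳) × (Fin K → V) => logLik (o.drift I p.1) p.2 := by
    fun_prop
  refine HasRenyiBound.of_norm _ _ (ℓ := fun S v => logLik (o.drift I S) v) hjoint
    (fun v => ⟨_, fun S => o.abs_logLik_drift_le I S v⟩) hs.le ?_
  -- For each path the norm will be at most A^(1-ω) B^ω. Hölder over the paths then needs two
  -- integrals: that of A is at most one, and that of B is the exponential moment of the weight
  -- under the true process.
  set A : (Fin K → V) → ℝ≥0∞ := fun v =>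
    ∫⁻ S, ENNReal.ofReal (Real.exp (logLik (o.drift I S) v)) ∂(Measure.pi fun _ : Fin n => P)
    with hA
  set B : (Fin K → V) → ℝ≥0∞ := fun v =>
    ∫⁻ S, ENNReal.ofReal (Real.exp (logLik (o.drift I S) v + κ * o.infoWeight P I S v))
      ∂(Measure.pi fun _ : Fin n => P) with hB
  have hAm : Measurable A := by
    have : Measurable (Function.uncurry fun (v : Fin K → V) (S : Fin n → 𝒳) =>
        ENNReal.ofReal (Real.exp (logLik (o.drift I S) v))) := by
      have h1 : Measurable fun p : (Fin K → V) × (Fin n → 𝒳) =>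
        ENNReal.ofReal (Real.exp (logLik (o.drift I p.2) p.1)) := by fun_prop
      exact h1
    exact this.lintegral_prod_right
  have hBj : Measurable fun p : (Fin K → V) × (Fin n → 𝒳) =>
      ENNReal.ofReal (Real.exp (logLik (o.drift I p.2) p.1 + κ * o.infoWeight P I p.2 p.1)) := by
    fun_prop
  have hBm : Measurable B := by
    have : Measurable (Function.uncurry fun (v : Fin K → V) (S : Fin n → 𝒳) =>
        ENNReal.ofReal (Real.exp (logLik (o.drift I S) v + κ * o.infoWeight P I S v))) := hBj
    exact this.lintegral_prod_right
  have hA1 : ∫⁻ v, A v ∂(whiteNoise d K) ≤ 1 := by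
    have hsw : Measurable fun p : (Fin K → V) × (Fin n → 𝒳) =>
        ENNReal.ofReal (Real.exp (logLik (o.drift I p.2) p.1)) := by fun_prop
    simp only [hA]
    rw [lintegral_lintegral_swap hsw.aemeasurable]
    simp only [← lik_eq_exp_logLik]
    refine (lintegral_mono fun S => lintegral_lik_le (o.past_drift I S)
      fun k => by fun_prop).trans ?_
    simp
  have hB1 : ∫⁻ v, B v ∂(whiteNoise d K) ≤ ENNReal.ofReal (Real.exp Ψ) := by
    simp only [hB]
    rw [lintegral_lintegral_swap hBj.aemeasurable]
    simp only [← ofReal_exp_mul, ← lik_eq_exp_logLik]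
    refine (lintegral_mono hΨ).trans ?_
    simp
  have main : ∀ v, ENNReal.ofReal (Real.exp (Real.log (∫ S, Real.exp ((1 + s) *
      logLik (o.drift I S) v) ∂(Measure.pi fun _ : Fin n => P)) / (1 + s))) ≤
      A v ^ (1 - ω) * B v ^ ω := by
    intro v
    set H : (Fin n → 𝒳) → ℝ := fun S => logLik (o.drift I S) v with hH
    set w : (Fin n → 𝒳) → ℝ := fun S => o.infoWeight P I S v with hw
    have hHm : Measurable H := by simp only [hH]; fun_prop
    have hwm : Measurable w := by simp only [hw]; fun_prop
    set C := max (2 * logLikBound d K n b v) (n * (2 * logLikBound d K n b v) ^ 2) with hC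
    have hC1 : logLikBound d K n b v ≤ C := by
      have := logLikBound_nonneg (n := n) (b := b) v
      exact le_trans (by linarith) (le_max_left _ _)
    have hHC : ∀ S, |H S| ≤ C := fun S => (o.abs_logLik_drift_le I S v).trans hC1
    have hwC : ∀ S, |w S| ≤ C := fun S => (o.abs_infoWeight_le P I S v).trans (le_max_right _ _)
    have hent : ∀ a : ℝ, expEntropy (Measure.pi fun _ : Fin n => P) (fun S => a * H S) ≤
        a ^ 2 * ∫ S, Real.exp (a * H S) * w S ∂(Measure.pi fun _ : Fin n => P) := fun a =>
      expEntropy_const_mul_le P hHm (h := fun i S => o.gain I {i} S v)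
        (base := fun i S => logLik (o.drift (fun k => I k \ {i}) S) v)
        (fun i => by fun_prop) hHC (fun i S => (o.abs_gain_le I {i} S v).trans (le_max_left _ _))
        (fun i S => by simp only [hH, gain]; ring) (fun i S x => o.gain_base_update I i S x v) a
    have ieA : Integrable (fun S => Real.exp (H S)) (Measure.pi fun _ : Fin n => P) :=
      integrable_exp_of_abs_le _ hHm hHC
    have ieB : Integrable (fun S => Real.exp (H S + κ * w S)) (Measure.pi fun _ : Fin n => P) :=
      integrable_exp_of_abs_le _ (φ := fun S => H S + κ * w S) (by fun_prop) (C := C + κ * C)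
        fun S => (abs_add_le _ _).trans (add_le_add (hHC S) (by
          rw [abs_mul, abs_of_nonneg hκ0]; exact mul_le_mul_of_nonneg_left (hwC S) hκ0))
    have eA : A v = ENNReal.ofReal (Real.exp (Real.log (∫ S, Real.exp (H S)
        ∂(Measure.pi fun _ : Fin n => P)))) := by
      rw [Real.exp_log (integral_exp_pos ieA), ofReal_integral_eq_lintegral_ofReal ieA
        (Filter.Eventually.of_forall fun x => (Real.exp_pos _).le)]
    have eB : B v = ENNReal.ofReal (Real.exp (Real.log (∫ S, Real.exp (H S + κ * w S)
        ∂(Measure.pi fun _ : Fin n => P)))) := by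
      rw [Real.exp_log (integral_exp_pos ieB), ofReal_integral_eq_lintegral_ofReal ieB
        (Filter.Eventually.of_forall fun x => (Real.exp_pos _).le)]
    rw [eA, eB, ofReal_exp_rpow, ofReal_exp_rpow, ofReal_exp_mul]
    refine ENNReal.ofReal_le_ofReal (Real.exp_le_exp.2 ?_)
    -- Either the plain norm bound, or the interpolation, where the moment enters only to the power
    -- ω at the price of a larger κ.
    rcases hκω with ⟨h1, h2⟩ | ⟨h1, h2⟩
    · have h := log_integral_exp_mul_div_le hHm hwm hHC hwC (α := 1 + s) (by linarith) (hent _)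
      rw [h1, h2]
      simpa using h
    · have h := log_integral_exp_mul_div_le_interpolate hHm hwm hHC hwC (α := 1 + s) (κ := κ)
        (ω := ω) (by linarith) (by simpa using h1) (by simpa using h2) (fun a _ _ => hent a)
      refine h.trans (le_of_eq ?_)
      ring
  refine (lintegral_mono main).trans ((ENNReal.lintegral_mul_norm_pow_le hAm.aemeasurable
    hBm.aemeasurable (by linarith) hω0 (by ring)).trans ?_)
  calc _ ≤ 1 ^ (1 - ω) * ENNReal.ofReal (Real.exp Ψ) ^ ω :=
        mul_le_mul' (ENNReal.rpow_le_rpow hA1 (by linarith)) (ENNReal.rpow_le_rpow hB1 hω0)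
    _ = _ := by rw [ENNReal.one_rpow, one_mul, ofReal_exp_rpow, mul_comm]

end PathField

/-! ### A single epoch: every batch is fresh -/

section

variable {d : ℕ}

local notation "V" => EuclideanSpace ℝ (Fin d)

/-- Exponential moment of the squared length of a vector plus a centered bounded random vector. -/
theorem lintegral_exp_norm_add_centered_sq_le {𝒳 : Type*} [MeasurableSpace 𝒳] (P : Measure 𝒳)
    [IsProbabilityMeasure P] {g : 𝒳 → V} (hg : Measurable g) {b : ℝ} (hb : ∀ t, ‖g t‖ ≤ b) (D : V)
    {x : ℝ} (hx : 0 ≤ x) (hxb : 2 * x * b ^ 2 < 1) :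
    ∫⁻ t, ENNReal.ofReal (Real.exp (x * ‖D + (g t - ∫ t, g t ∂P)‖ ^ 2)) ∂P ≤
      ENNReal.ofReal ((√(1 - 2 * x * b ^ 2))⁻¹ *
        Real.exp (x / (1 - 2 * x * b ^ 2) * ‖D‖ ^ 2)) := by
  set m := ∫ t, g t ∂P with hm
  set u := D - m with hu
  set Y : 𝒳 → ℝ := fun t => inner ℝ u (g t) with hY
  have hb0 : 0 ≤ b := by
    obtain ⟨t⟩ := nonempty_of_isProbabilityMeasure P
    exact (norm_nonneg _).trans (hb t)
  have hYm : Measurable Y := by fun_prop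
  have hYb : ∀ t, |Y t| ≤ ‖u‖ * b := fun t =>
    (abs_real_inner_le_norm _ _).trans (mul_le_mul_of_nonneg_left (hb t) (norm_nonneg _))
  have ig : Integrable g P :=
    Integrable.of_bound hg.aestronglyMeasurable b (Filter.Eventually.of_forall hb)
  have hEY : ∫ t, Y t ∂P = inner ℝ u m := by
    rw [hm, ← integral_inner ig]
  have hsub := hasSubgaussianMGF_of_mem_Icc (μ := P) (X := Y) (a := -(‖u‖ * b)) (b := ‖u‖ * b)
    hYm.aemeasurable (Filter.Eventually.of_forall fun t => abs_le.1 (hYb t))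
  have hmgf := hsub.mgf_le (2 * x)
  rw [mgf, hEY] at hmgf
  have hi : Integrable (fun t => Real.exp (2 * x * (Y t - inner ℝ u m))) P := by
    have h := hsub.integrable_exp_mul (2 * x)
    rwa [hEY] at h
  set θ := 2 * x * b ^ 2 with hθ
  have hθ0 : 0 ≤ θ := by positivity
  have h1θ : 0 < 1 - θ := by linarith
  have hv : ((‖‖u‖ * b - -(‖u‖ * b)‖₊ / 2) ^ 2 : NNReal) * (2 * x) ^ 2 / 2 = x * θ * ‖u‖ ^ 2 := by
    have : ‖‖u‖ * b - -(‖u‖ * b)‖ = 2 * (‖u‖ * b) := by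
      rw [Real.norm_eq_abs, abs_of_nonneg (by have := norm_nonneg u; nlinarith [mul_nonneg this hb0])]
      ring
    push_cast
    rw [this, hθ]
    ring
  rw [hv] at hmgf
  -- Expanded such that, after ‖g‖² ≤ b², only the linear functional ⟨D - m, g⟩ is random.
  -- Hoeffding's lemma for it yields ‖D - m‖² instead of ‖D‖², and the retained term -‖m‖²
  -- compensates for that.
  have pt : ∀ t, x * ‖D + (g t - m)‖ ^ 2 ≤
      (x * ‖D‖ ^ 2 + x * b ^ 2 - x * ‖m‖ ^ 2) + 2 * x * (Y t - inner ℝ u m) := fun t => by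
    have e : ‖D + (g t - m)‖ ^ 2 = ‖D‖ ^ 2 + ‖g t‖ ^ 2 - ‖m‖ ^ 2 + 2 * (Y t - inner ℝ u m) := by
      rw [norm_add_sq_real, norm_sub_sq_real, hY, hu]
      simp only [inner_sub_left, inner_sub_right, real_inner_self_eq_norm_sq]
      rw [real_inner_comm m (g t)]
      ring
    have h1 : ‖g t‖ ^ 2 ≤ b ^ 2 := pow_le_pow_left₀ (norm_nonneg _) (hb t) 2
    rw [e]
    nlinarith
  -- Equivalent, after clearing the denominator, to ‖(1 - θ) m + θ D‖² ≥ 0 up to the factor x.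
  have hfin : x * ‖D‖ ^ 2 - x * ‖m‖ ^ 2 + x * θ * ‖u‖ ^ 2 ≤ x / (1 - θ) * ‖D‖ ^ 2 := by
    have h0 : 0 ≤ ‖(1 - θ) • m + θ • D‖ ^ 2 := by positivity
    rw [norm_add_sq_real, norm_smul, norm_smul, inner_smul_left, inner_smul_right, mul_pow,
      mul_pow, Real.norm_eq_abs, Real.norm_eq_abs, sq_abs, sq_abs] at h0
    simp only [conj_trivial] at h0
    rw [hu, norm_sub_sq_real, div_mul_eq_mul_div, le_div_iff₀ h1θ]
    rw [real_inner_comm] at h0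
    nlinarith
  calc _ ≤ ∫⁻ t, ENNReal.ofReal (Real.exp (x * ‖D‖ ^ 2 + x * b ^ 2 - x * ‖m‖ ^ 2)) *
        ENNReal.ofReal (Real.exp (2 * x * (Y t - inner ℝ u m))) ∂P := by
        refine lintegral_mono fun t => ?_
        rw [ofReal_exp_mul]
        exact ENNReal.ofReal_le_ofReal (Real.exp_le_exp.2 (pt t))
    _ = ENNReal.ofReal (Real.exp (x * ‖D‖ ^ 2 + x * b ^ 2 - x * ‖m‖ ^ 2)) *
        ENNReal.ofReal (∫ t, Real.exp (2 * x * (Y t - inner ℝ u m)) ∂P) := by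
        rw [lintegral_const_mul' _ _ ENNReal.ofReal_ne_top, ofReal_integral_eq_lintegral_ofReal hi
          (Filter.Eventually.of_forall fun x => (Real.exp_pos _).le)]
    _ ≤ ENNReal.ofReal (Real.exp (x * ‖D‖ ^ 2 + x * b ^ 2 - x * ‖m‖ ^ 2)) *
        ENNReal.ofReal (Real.exp (x * θ * ‖u‖ ^ 2)) :=
        mul_le_mul_right (ENNReal.ofReal_le_ofReal hmgf) _
    _ ≤ _ := by
        rw [ofReal_exp_mul]
        refine ENNReal.ofReal_le_ofReal ?_
        have h2 : Real.exp (x * b ^ 2) ≤ (√(1 - θ))⁻¹ := by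
          rw [le_inv_comm₀ (Real.exp_pos _) (Real.sqrt_pos.2 h1θ), ← Real.exp_neg,
            Real.sqrt_le_left (Real.exp_pos _).le, ← Real.exp_nat_mul]
          have := Real.add_one_le_exp (-θ)
          refine (by linarith : 1 - θ ≤ Real.exp (-θ)).trans (le_of_eq ?_)
          congr 1
          rw [hθ]; push_cast; ring
        calc _ = Real.exp (x * b ^ 2) * Real.exp (x * ‖D‖ ^ 2 - x * ‖m‖ ^ 2 + x * θ * ‖u‖ ^ 2) := by
              rw [← Real.exp_add]; congr 1; ring
          _ ≤ _ := mul_le_mul h2 (Real.exp_le_exp.2 hfin) (Real.exp_pos _).le (by positivity)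

/-- Exponential moment of the squared length of a sum of independent centered bounded vectors. -/
theorem lintegral_mul_exp_norm_sum_centered_sq_le {𝒳 : Type*} [MeasurableSpace 𝒳] {n : ℕ}
    (P : Measure 𝒳) [IsProbabilityMeasure P] {g : 𝒳 → V} (hg : Measurable g) {b : ℝ}
    (hb : ∀ t, ‖g t‖ ≤ b) (I : Finset (Fin n)) {Φ : (Fin n → 𝒳) → ℝ≥0∞} (hΦ : Measurable Φ)
    (hI : ∀ i ∈ I, ∀ S t, Φ (Function.update S i t) = Φ S) :
    ∀ {x : ℝ}, 0 ≤ x → 2 * x * I.card * b ^ 2 < 1 →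
    ∫⁻ S, Φ S * ENNReal.ofReal (Real.exp (x * ‖∑ i ∈ I, (g (S i) - ∫ t, g t ∂P)‖ ^ 2))
        ∂(Measure.pi fun _ => P) ≤
      ENNReal.ofReal (√(1 - 2 * x * I.card * b ^ 2))⁻¹ * ∫⁻ S, Φ S ∂(Measure.pi fun _ => P) := by
  induction I using Finset.induction_on with
  | empty => intro x _ _; simp
  | insert i J hi ih =>
    intro x hx hxb
    have ih' := @ih (fun j hj => hI j (Finset.mem_insert_of_mem hj))
    rw [Finset.card_insert_of_notMem hi] at hxb ⊢
    push_cast at hxb ⊢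
    have hJ0 : 0 ≤ 2 * x * J.card * b ^ 2 := by positivity
    have hx1 : 2 * x * b ^ 2 < 1 := by nlinarith
    have h1 : 0 < 1 - 2 * x * b ^ 2 := by linarith
    -- Integrating out one point lowers 1/x by 2b², so the square roots of successive points
    -- telescope.
    set x' := x / (1 - 2 * x * b ^ 2) with hx'
    have hx'0 : 0 ≤ x' := div_nonneg hx h1.le
    have e1 : 1 - 2 * x' * J.card * b ^ 2 =
        (1 - 2 * x * (J.card + 1) * b ^ 2) / (1 - 2 * x * b ^ 2) := by
      rw [hx']; field_simp; ring
    have h2 : 0 < (1 - 2 * x * (J.card + 1) * b ^ 2) / (1 - 2 * x * b ^ 2) :=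
      div_pos (by linarith) h1
    have hmeas : ∀ (J : Finset (Fin n)) (x : ℝ), Measurable fun S : Fin n → 𝒳 => Φ S *
        ENNReal.ofReal (Real.exp (x * ‖∑ i ∈ J, (g (S i) - ∫ t, g t ∂P)‖ ^ 2)) := fun J x => by
      fun_prop
    have step : ∫⁻ S, Φ S * ENNReal.ofReal (Real.exp
          (x * ‖∑ i ∈ insert i J, (g (S i) - ∫ t, g t ∂P)‖ ^ 2)) ∂(Measure.pi fun _ => P) ≤
        ∫⁻ S, ENNReal.ofReal (√(1 - 2 * x * b ^ 2))⁻¹ * (Φ S * ENNReal.ofReal (Real.exp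
          (x' * ‖∑ i ∈ J, (g (S i) - ∫ t, g t ∂P)‖ ^ 2))) ∂(Measure.pi fun _ => P) := by
      refine lintegral_pi_le_of_update P i (hmeas _ _) ((hmeas _ _).const_mul _) fun S => ?_
      have e2 : ∀ t, ∑ j ∈ J, (g (Function.update S i t j) - ∫ t, g t ∂P) =
          ∑ j ∈ J, (g (S j) - ∫ t, g t ∂P) := fun t =>
        Finset.sum_congr rfl fun j hj => by
          rw [Function.update_of_ne (ne_of_mem_of_not_mem hj hi)]
      simp only [hI i (Finset.mem_insert_self _ _), Finset.sum_insert hi, e2, Function.update_self]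
      rw [lintegral_const_mul _ (by fun_prop), lintegral_const, measure_univ, mul_one]
      set D := ∑ j ∈ J, (g (S j) - ∫ t, g t ∂P)
      have h := lintegral_exp_norm_add_centered_sq_le P hg hb D hx hx1
      simp only [add_comm _ D]
      refine (mul_le_mul_right h _).trans (le_of_eq ?_)
      rw [ENNReal.ofReal_mul (by positivity), mul_left_comm]
    refine step.trans ?_
    rw [lintegral_const_mul _ (hmeas _ _)]
    refine (mul_le_mul_right (ih' hx'0 (by linarith [e1 ▸ h2])) _).trans (le_of_eq ?_)
    rw [← mul_assoc, ← ENNReal.ofReal_mul (by positivity), e1, Real.sqrt_div (by linarith)]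
    congr 2
    have := (Real.sqrt_pos.2 h1).ne'
    have : 0 < √(1 - 2 * x * (J.card + 1) * b ^ 2) := Real.sqrt_pos.2 (by linarith)
    field_simp

/-- Powers and quotients of Gaussian densities. -/
theorem inner_sub_norm_sq_combine (v c c' : V) (s : ℝ) :
    (inner ℝ v c - ‖c‖ ^ 2 / 2) * (1 + s) + (inner ℝ v c' - ‖c'‖ ^ 2 / 2) * (-s) =
      inner ℝ v ((1 + s) • c - s • c') - ‖(1 + s) • c - s • c'‖ ^ 2 / 2 +
        (1 + s) * s / 2 * ‖c - c'‖ ^ 2 := by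
  rw [norm_sub_sq_real, norm_sub_sq_real, norm_smul, norm_smul, inner_sub_right, inner_smul_right,
    inner_smul_right, inner_smul_left, inner_smul_right, mul_pow, mul_pow, Real.norm_eq_abs,
    Real.norm_eq_abs, sq_abs, sq_abs]
  simp only [conj_trivial]
  ring

/-- The exponents are again Gaussian: the powers combine to the density with the extrapolated drift,
times a factor in the squared distances of the drifts. A Rényi moment thus becomes an exponential
moment under another process. -/
theorem lik_rpow_mul_rpow {K : ℕ} (c c' : Fin K → (Fin K → V) → V) (v : Fin K → V) (s : ℝ) :
    lik c v ^ (1 + s) * lik c' v ^ (-s) = lik (fun k v => (1 + s) • c k v - s • c' k v) v *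
      ENNReal.ofReal (Real.exp (∑ k, (1 + s) * s / 2 * ‖c k v - c' k v‖ ^ 2)) := by
  simp only [lik_eq_exp_logLik, ofReal_exp_rpow, ofReal_exp_mul, logLik]
  rw [Finset.sum_mul, Finset.sum_mul, ← Finset.sum_add_distrib, ← Finset.sum_add_distrib]
  simp only [inner_sub_norm_sq_combine]

end

theorem lik_ne_zero {d K : ℕ}
    (c : Fin K → (Fin K → EuclideanSpace ℝ (Fin d)) → EuclideanSpace ℝ (Fin d))
    (v : Fin K → EuclideanSpace ℝ (Fin d)) : lik c v ≠ 0 := by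
  rw [lik_eq_exp_logLik]
  exact (ENNReal.ofReal_pos.2 (Real.exp_pos _)).ne'

theorem lik_ne_top {d K : ℕ}
    (c : Fin K → (Fin K → EuclideanSpace ℝ (Fin d)) → EuclideanSpace ℝ (Fin d))
    (v : Fin K → EuclideanSpace ℝ (Fin d)) : lik c v ≠ ∞ := by
  rw [lik_eq_exp_logLik]
  exact ENNReal.ofReal_ne_top

namespace PathField

variable {𝒳 : Type*} [MeasurableSpace 𝒳] {d K n : ℕ} {b : ℝ}

local notation "V" => EuclideanSpace ℝ (Fin d)

@[fun_prop]
theorem measurable_lik_drift (o : PathField 𝒳 d K b) (I : Fin K → Finset (Fin n))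
    {X : Type*} [MeasurableSpace X] {g : X → Fin n → 𝒳} {h : X → Fin K → V}
    (hg : Measurable g) (hh : Measurable h) :
    Measurable fun p => lik (o.drift I (g p)) (h p) := by
  simp only [lik_eq_exp_logLik]
  fun_prop

/-- The worst case Rényi bound, without any use of the randomness of the data. -/
theorem hasRenyiBound_worstCase (o : PathField 𝒳 d K b) (P : Measure 𝒳) [IsProbabilityMeasure P]
    (I : Fin K → Finset (Fin n)) {m : ℕ} (hcard : ∀ k, (I k).card = m) {s : ℝ} (hs : 0 ≤ s) :
    HasRenyiBound (Measure.pi fun _ : Fin n => P) (whiteNoise d K)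
      (fun S v => lik (o.drift I S) v) s ((1 + s) * s / 2 * (K * (m * b) ^ 2)) := by
  -- The comparison law is white noise, so only the lengths of the drifts matter.
  refine ⟨fun _ => 1, measurable_const, by simp, by simp, by simp, ?_⟩
  simp only [ENNReal.one_rpow, mul_one]
  have hm : Measurable (Function.uncurry fun (v : Fin K → V) (S : Fin n → 𝒳) =>
      lik (o.drift I S) v ^ (1 + s)) := by
    have : Measurable fun p : (Fin K → V) × (Fin n → 𝒳) => lik (o.drift I p.2) p.1 ^ (1 + s) := by
      fun_prop
    exact this
  rw [lintegral_lintegral_swap hm.aemeasurable]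
  have key : ∀ S : Fin n → 𝒳, ∫⁻ v, lik (o.drift I S) v ^ (1 + s) ∂(whiteNoise d K) ≤
      ENNReal.ofReal (Real.exp ((1 + s) * s / 2 * (K * (m * b) ^ 2))) := by
    intro S
    set c := o.drift I S with hc
    have e : ∀ v, lik c v ^ (1 + s) ≤ ENNReal.ofReal (Real.exp ((1 + s) * s / 2 *
        (K * (m * b) ^ 2))) * lik (fun k v => (1 + s) • c k v) v := fun v => by
      have h := lik_rpow_mul_rpow c (fun _ _ => 0) v s
      have h1 : lik (fun (_ : Fin K) (_ : Fin K → V) => (0 : V)) v = 1 := by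
        simp [lik, gaussianShift]
      rw [h1, ENNReal.one_rpow, mul_one] at h
      simp only [smul_zero, sub_zero] at h
      rw [h, mul_comm]
      refine mul_le_mul_left (ENNReal.ofReal_le_ofReal (Real.exp_le_exp.2 ?_)) _
      rw [← Finset.mul_sum]
      refine mul_le_mul_of_nonneg_left ?_ (by positivity)
      have h2 : ∀ k ∈ Finset.univ, ‖c k v‖ ^ 2 ≤ (m * b) ^ 2 := fun k _ => by
        have h3 := o.norm_drift_le I S k v
        rw [hcard] at h3
        exact pow_le_pow_left₀ (norm_nonneg _) h3 2
      refine (Finset.sum_le_card_nsmul _ _ _ h2).trans (le_of_eq (by simp))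
    have hpast : DependsOnPast fun k v => (1 + s) • c k v := fun k v v' h => by
      simp only [hc, o.past_drift I S k v v' h]
    have hcm : ∀ k, Measurable fun v => (1 + s) • c k v := fun k => by rw [hc]; fun_prop
    refine (lintegral_mono e).trans ?_
    rw [lintegral_const_mul' _ _ ENNReal.ofReal_ne_top]
    exact (mul_le_mul_right (lintegral_lik_le hpast hcm) _).trans_eq (mul_one _)
  refine (lintegral_mono key).trans ?_
  simp

/-- The vector field averaged over the law of the data points. -/
noncomputable def mean (o : PathField 𝒳 d K b) (P : Measure 𝒳) (k : Fin K) (v : Fin K → V) : V :=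
  ∫ x, o.toFun k x v ∂P

theorem past_mean (o : PathField 𝒳 d K b) (P : Measure 𝒳) : DependsOnPast (o.mean P) :=
  fun k v v' h => by
    unfold mean
    congr 1; funext x
    exact o.past x k v v' h

@[fun_prop]
theorem measurable_mean (o : PathField 𝒳 d K b) (P : Measure 𝒳) [IsProbabilityMeasure P]
    (k : Fin K) {X : Type*} [MeasurableSpace X] {h : X → Fin K → V} (hh : Measurable h) :
    Measurable fun p => o.mean P k (h p) := by
  have h1 : Measurable (Function.uncurry fun (v : Fin K → V) (x : 𝒳) => o.toFun k x v) :=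
    (o.meas k).comp measurable_swap
  have h2 : Measurable (o.mean P k) := (h1.stronglyMeasurable.integral_prod_right (ν := P)).measurable
  exact h2.comp hh

/-- The difference of the batch sum and its mean. -/
noncomputable def fluct (o : PathField 𝒳 d K b) (P : Measure 𝒳) (I : Fin K → Finset (Fin n))
    (S : Fin n → 𝒳) (k : Fin K) (v : Fin K → V) : V :=
  o.drift I S k v - ((I k).card : ℝ) • o.mean P k v

/-- The drift extrapolated away from its mean. -/
noncomputable def tilt (o : PathField 𝒳 d K b) (P : Measure 𝒳) (I : Fin K → Finset (Fin n)) (s : ℝ)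
    (S : Fin n → 𝒳) (k : Fin K) (v : Fin K → V) : V :=
  (1 + s) • o.drift I S k v - s • (((I k).card : ℝ) • o.mean P k v)

theorem past_fluct (o : PathField 𝒳 d K b) (P : Measure 𝒳) (I : Fin K → Finset (Fin n))
    (S : Fin n → 𝒳) : DependsOnPast (o.fluct P I S) := fun k v v' h => by
  rw [fluct, fluct, o.past_drift I S k v v' h, o.past_mean P k v v' h]

theorem past_tilt (o : PathField 𝒳 d K b) (P : Measure 𝒳) (I : Fin K → Finset (Fin n)) (s : ℝ)
    (S : Fin n → 𝒳) : DependsOnPast (o.tilt P I s S) := fun k v v' h => by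
  rw [tilt, tilt, o.past_drift I S k v v' h, o.past_mean P k v v' h]

@[fun_prop]
theorem measurable_fluct (o : PathField 𝒳 d K b) (P : Measure 𝒳) [IsProbabilityMeasure P]
    (I : Fin K → Finset (Fin n)) (k : Fin K) {X : Type*} [MeasurableSpace X]
    {g : X → Fin n → 𝒳} {h : X → Fin K → V} (hg : Measurable g) (hh : Measurable h) :
    Measurable fun p => o.fluct P I (g p) k (h p) := by
  unfold fluct
  fun_prop

@[fun_prop]
theorem measurable_tilt (o : PathField 𝒳 d K b) (P : Measure 𝒳) [IsProbabilityMeasure P]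
    (I : Fin K → Finset (Fin n)) (s : ℝ) (k : Fin K) {X : Type*} [MeasurableSpace X]
    {g : X → Fin n → 𝒳} {h : X → Fin K → V} (hg : Measurable g) (hh : Measurable h) :
    Measurable fun p => o.tilt P I s (g p) k (h p) := by
  unfold tilt
  fun_prop

theorem fluct_eq_sum (o : PathField 𝒳 d K b) (P : Measure 𝒳) (I : Fin K → Finset (Fin n))
    (S : Fin n → 𝒳) (k : Fin K) (v : Fin K → V) : o.fluct P I S k v =
      ∑ i ∈ I k, (o.toFun k (S i) v - ∫ t, o.toFun k t v ∂P) := by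
  rw [Finset.sum_sub_distrib, Finset.sum_const, ← Nat.cast_smul_eq_nsmul ℝ]
  rfl

/-- The density of the extrapolated process, weighted by the exponential of the squared
fluctuations, up to step `j`. -/
noncomputable def fluctWeight (o : PathField 𝒳 d K b) (P : Measure 𝒳) (I : Fin K → Finset (Fin n))
    (s x : ℝ) (j : ℕ) (S : Fin n → 𝒳) (v : Fin K → V) : ℝ≥0∞ :=
  likUpTo (o.tilt P I s S) j v * ENNReal.ofReal (Real.exp
    (∑ k ∈ Finset.univ.filter (fun k : Fin K => k.val < j), x * ‖o.fluct P I S k v‖ ^ 2))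

@[fun_prop]
theorem measurable_fluctWeight (o : PathField 𝒳 d K b) (P : Measure 𝒳) [IsProbabilityMeasure P]
    (I : Fin K → Finset (Fin n)) (s x : ℝ) (j : ℕ) {X : Type*} [MeasurableSpace X]
    {g : X → Fin n → 𝒳} {h : X → Fin K → V} (hg : Measurable g) (hh : Measurable h) :
    Measurable fun p => o.fluctWeight P I s x j (g p) (h p) := by
  have h1 : Measurable fun p => likUpTo (o.tilt P I s (g p)) j (h p) :=
    Finset.measurable_fun_prod _ fun k _ => Measurable.gaussianShift (by fun_prop) (by fun_prop)
  unfold fluctWeight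
  fun_prop

theorem fluctWeight_succ_update (o : PathField 𝒳 d K b) (P : Measure 𝒳)
    (I : Fin K → Finset (Fin n)) (s x : ℝ) (k : Fin K) (S : Fin n → 𝒳) (v : Fin K → V) (y : V) :
    o.fluctWeight P I s x (k + 1) S (Function.update v k y) =
      gaussianShift y (o.tilt P I s S k v) * (o.fluctWeight P I s x k S v *
        ENNReal.ofReal (Real.exp (x * ‖o.fluct P I S k v‖ ^ 2))) := by
  have h1 : ∀ i : Fin K, i ≤ k → o.fluct P I S i (Function.update v k y) = o.fluct P I S i v :=
    fun i hi => (o.past_fluct P I S).update hi v y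
  unfold fluctWeight
  rw [likUpTo_succ_update (o.past_tilt P I s S), filter_lt_succ, Finset.sum_insert (by simp),
    h1 k le_rfl, Finset.sum_congr rfl fun i hi => by
      have : i < k := by simpa using hi
      rw [h1 i this.le], ← ofReal_exp_mul]
  ring

/-- With disjoint batches, the points of batch `k` have not entered the drift before step `k`. This
is the freshness that allows them to be averaged out. -/
theorem fluctWeight_update_data (o : PathField 𝒳 d K b) (P : Measure 𝒳)
    (I : Fin K → Finset (Fin n)) (hI : ∀ k k', k ≠ k' → Disjoint (I k) (I k')) (s x : ℝ)
    {k : Fin K} {i : Fin n} (hi : i ∈ I k) (S : Fin n → 𝒳) (t : 𝒳) (v : Fin K → V) :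
    o.fluctWeight P I s x k (Function.update S i t) v = o.fluctWeight P I s x k S v := by
  have h1 : ∀ j : Fin K, j.val < k.val →
      o.drift I (Function.update S i t) j v = o.drift I S j v := fun j hj => by
    refine Finset.sum_congr rfl fun l hl => ?_
    have : l ≠ i := by
      rintro rfl
      exact Finset.disjoint_left.1 (hI j k (by intro h; subst h; omega)) hl hi
    rw [Function.update_of_ne this]
  unfold fluctWeight
  congr 1
  · refine Finset.prod_congr rfl fun j hj => ?_
    rw [tilt, tilt, h1 j (by simpa using hj)]
  · congr 2
    refine Finset.sum_congr rfl fun j hj => ?_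
    rw [fluct, fluct, h1 j (by simpa using hj)]

/-- The new coordinate is integrated first, where the Gaussian density has mass one. The fluctuation
of step `k` is then a centered sum of independent bounded vectors, and the rest of the weight does
not see them. -/
theorem lintegral_fluctWeight_succ_le (o : PathField 𝒳 d K b) (P : Measure 𝒳)
    [IsProbabilityMeasure P] (I : Fin K → Finset (Fin n))
    (hI : ∀ k k', k ≠ k' → Disjoint (I k) (I k')) (s : ℝ) {x : ℝ} (hx : 0 ≤ x) (k : Fin K)
    (hxb : 2 * x * (I k).card * b ^ 2 < 1) (v : Fin K → V) :
    ∫⁻ y, ∫⁻ S, o.fluctWeight P I s x (k + 1) S (Function.update v k y)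
        ∂(Measure.pi fun _ => P) ∂(stdGaussian V) ≤
      ENNReal.ofReal (√(1 - 2 * x * (I k).card * b ^ 2))⁻¹ *
        ∫⁻ S, o.fluctWeight P I s x k S v ∂(Measure.pi fun _ => P) := by
  simp only [fluctWeight_succ_update]
  have hm : Measurable fun p : V × (Fin n → 𝒳) => gaussianShift p.1 (o.tilt P I s p.2 k v) *
      (o.fluctWeight P I s x k p.2 v * ENNReal.ofReal (Real.exp (x * ‖o.fluct P I p.2 k v‖ ^ 2))) := by
    fun_prop
  rw [lintegral_lintegral_swap hm.aemeasurable]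
  have hin : ∀ S, ∫⁻ y, gaussianShift y (o.tilt P I s S k v) * (o.fluctWeight P I s x k S v *
      ENNReal.ofReal (Real.exp (x * ‖o.fluct P I S k v‖ ^ 2))) ∂(stdGaussian V) =
      o.fluctWeight P I s x k S v * ENNReal.ofReal (Real.exp
        (x * ‖∑ i ∈ I k, (o.toFun k (S i) v - ∫ t, o.toFun k t v ∂P)‖ ^ 2)) := fun S => by
    rw [lintegral_mul_const _ (by fun_prop), lintegral_gaussianShift, one_mul, fluct_eq_sum]
  simp only [hin]
  exact lintegral_mul_exp_norm_sum_centered_sq_le P (g := fun t => o.toFun k t v)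
    (by fun_prop) (fun t => o.bound k t v) (I k) (by fun_prop)
    (fun i hi S t => o.fluctWeight_update_data P I hI s x hi S t v) hx hxb

/-- Rényi bound when no data point is used twice. -/
theorem hasRenyiBound_single_epoch (o : PathField 𝒳 d K b) (P : Measure 𝒳) [IsProbabilityMeasure P]
    (I : Fin K → Finset (Fin n)) {m : ℕ} (hcard : ∀ k, (I k).card = m)
    (hI : ∀ k k', k ≠ k' → Disjoint (I k) (I k')) {s : ℝ} (hs : 0 ≤ s)
    (hlt : (1 + s) * s * (m * b ^ 2) < 1) :
    HasRenyiBound (Measure.pi fun _ : Fin n => P) (whiteNoise d K)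
      (fun S v => lik (o.drift I S) v) s
      (-(K / 2) * Real.log (1 - (1 + s) * s * (m * b ^ 2))) := by
  have hpast : DependsOnPast fun k v => ((I k).card : ℝ) • o.mean P k v := fun k v v' h => by
    simp only [o.past_mean P k v v' h]
  have hmeas : ∀ k, Measurable fun v => ((I k).card : ℝ) • o.mean P k v := fun k => by fun_prop
  -- The comparison process has the batch sums replaced by their means along the path, so its law is
  -- free of the data.
  refine ⟨_, measurable_lik hmeas, lik_ne_zero _, lik_ne_top _, lintegral_lik_le hpast hmeas, ?_⟩
  have hx0 : 0 ≤ (1 + s) * s / 2 := by positivity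
  have hr0 : 0 < 1 - (1 + s) * s * (m * b ^ 2) := by linarith
  have hr : ∀ k, 1 - 2 * ((1 + s) * s / 2) * (I k).card * b ^ 2 = 1 - (1 + s) * s * (m * b ^ 2) :=
    fun k => by rw [hcard]; ring
  have hxb : ∀ k, 2 * ((1 + s) * s / 2) * (I k).card * b ^ 2 < 1 := fun k => by
    rw [hcard]; refine lt_of_eq_of_lt ?_ hlt; ring
  generalize 1 - (1 + s) * s * (m * b ^ 2) = r at hr hr0
  obtain ⟨x, hx⟩ : ∃ x, x = (1 + s) * s / 2 := ⟨_, rfl⟩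
  rw [← hx] at hx0 hr hxb
  have hchain := lintegral_pi_chain (stdGaussian V) (F := fun j v =>
    ENNReal.ofReal (√r)⁻¹ ^ (K - j) *
      ∫⁻ S, o.fluctWeight P I s x j S v ∂(Measure.pi fun _ : Fin n => P)) (fun j => by
      have h1 : Measurable fun p : (Fin K → V) × (Fin n → 𝒳) =>
        o.fluctWeight P I s x j p.2 p.1 := by fun_prop
      exact (Measurable.lintegral_prod_right (f := fun v S => o.fluctWeight P I s x j S v)
        h1).const_mul _) (fun k v => by
      rw [lintegral_const_mul' _ _ (ENNReal.pow_ne_top ENNReal.ofReal_ne_top)]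
      refine (mul_le_mul_right (o.lintegral_fluctWeight_succ_le P I hI s hx0 k (hxb k) v) _).trans
        (le_of_eq ?_)
      rw [hr, ← mul_assoc]
      congr 1
      have : K - k.val = K - (k.val + 1) + 1 := by have := k.isLt; omega
      rw [this, pow_succ])
  have hfin : ∀ v, ∫⁻ S, lik (o.drift I S) v ^ (1 + s) *
      lik (fun k v => ((I k).card : ℝ) • o.mean P k v) v ^ (-s) ∂(Measure.pi fun _ : Fin n => P) =
      ENNReal.ofReal (√r)⁻¹ ^ (K - K) *
        ∫⁻ S, o.fluctWeight P I s x K S v ∂(Measure.pi fun _ : Fin n => P) := fun v => by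
    rw [Nat.sub_self, pow_zero, one_mul]
    refine lintegral_congr fun S => ?_
    rw [lik_rpow_mul_rpow, fluctWeight, likUpTo_self, ← hx]
    simp only [Fin.is_lt, Finset.filter_true]
    rfl
  refine (lintegral_congr hfin).trans_le (hchain.trans (le_of_eq ?_))
  simp only [fluctWeight, likUpTo_zero, Nat.sub_zero]
  simp only [Nat.not_lt_zero, Finset.filter_false, Finset.sum_empty, Real.exp_zero,
    ENNReal.ofReal_one, mul_one, lintegral_const, measure_univ]
  have h5 : √r = Real.exp (Real.log r / 2) := by
    rw [Real.exp_half, Real.exp_log hr0]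
  rw [h5, ← Real.exp_neg, ← ENNReal.ofReal_pow (Real.exp_pos _).le, ← Real.exp_nat_mul]
  congr 2; ring

end PathField

/-! ### Resampling groups of data points -/

section

variable {𝒳 : Type*} [MeasurableSpace 𝒳] {n : ℕ} {P : Measure 𝒳} [IsProbabilityMeasure P]
  {φ : (Fin n → 𝒳) → ℝ} (hφ : Measurable φ) {C : ℝ} (hC : ∀ S, |φ S| ≤ C)

include hφ hC in
-- On a probability space the L^1 norm is at most the L^α norm; applied to the coordinates in `s`.
theorem mul_log_expMean_le {α : ℝ} (hα : 1 ≤ α) (s : Finset (Fin n)) (S : Fin n → 𝒳) :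
    α * Real.log (expMean P φ s S) ≤ Real.log (expMean P (fun S => α * φ S) s S) := by
  have hα0 : 0 < α := by linarith
  have hC' : ∀ S, |α * φ S| ≤ α * C := fun S => by
    rw [abs_mul, abs_of_pos hα0]; exact mul_le_mul_of_nonneg_left (hC S) hα0.le
  have h1 := expMean_pos (P := P) hC s S
  have h2 := expMean_pos (P := P) hC' s S
  have hu : Measurable fun y : (i : s) → 𝒳 => Function.updateFinset S s y :=
    measurable_updateFinset
  have h : ENNReal.ofReal (expMean P φ s S) ≤
      ENNReal.ofReal (expMean P (fun S => α * φ S) s S) ^ (1 / α) := by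
    rw [ofReal_expMean hC, ofReal_expMean hC']
    simp only [lmarginal]
    have h3 := ENNReal.lintegral_mul_norm_pow_le (μ := Measure.pi fun _ : s => P)
      (f := fun y => ENNReal.ofReal (Real.exp (α * φ (Function.updateFinset S s y))))
      (g := fun _ => 1) (p := 1 / α) (q := 1 - 1 / α) (by fun_prop) (by fun_prop)
      (by positivity) (by rw [sub_nonneg, div_le_one hα0]; exact hα) (by ring)
    simp only [ofReal_exp_rpow, ENNReal.one_rpow, mul_one, lintegral_const, measure_univ] at h3
    refine le_trans (le_of_eq ?_) h3
    refine lintegral_congr fun y => ?_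
    congr 2
    field_simp
  rw [ENNReal.ofReal_rpow_of_pos h2, ENNReal.ofReal_le_ofReal_iff (by positivity)] at h
  have h4 := Real.log_le_log h1 h
  rw [Real.log_rpow h2] at h4
  calc _ ≤ α * (1 / α * Real.log (expMean P (fun S => α * φ S) s S)) := by gcongr
    _ = _ := by field_simp

include hφ hC in
/-- The `L^(1+s)`-norm of `exp φ` in terms of the gains of groups of coordinates. -/
theorem log_integral_exp_mul_div_le_groups {g : ℕ} (col : Fin n → Fin g) {s : ℝ} (hs : 0 ≤ s) :
    Real.log (∫ S, Real.exp ((1 + s) * φ S) ∂(Measure.pi fun _ => P)) / (1 + s) ≤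
      Real.log (∫ S, Real.exp (φ S + ∑ r, s * (φ S - Real.log
        (expMean P φ (Finset.univ.filter fun i => col i = r) S))) ∂(Measure.pi fun _ => P)) := by
  obtain ⟨α, hα⟩ : ∃ α, α = 1 + s := ⟨_, rfl⟩
  have hα1 : 1 ≤ α := by linarith
  have hα0 : 0 < α := by linarith
  have hC' : ∀ S, |α * φ S| ≤ α * C := fun S => by
    rw [abs_mul, abs_of_pos hα0]; exact mul_le_mul_of_nonneg_left (hC S) hα0.le
  have hφ' : Measurable fun S => α * φ S := by fun_prop
  set G : Fin g → Finset (Fin n) := fun r => Finset.univ.filter fun i => col i = r with hG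
  set M : Fin g → (Fin n → 𝒳) → ℝ := fun r => expMean P (fun S => α * φ S) (G r) with hM
  have hMm : ∀ r, Measurable (M r) := fun r => measurable_expMean hφ' _
  have hNm : ∀ r, Measurable (expMean P φ (G r)) := fun r => measurable_expMean hφ _
  have hMC : ∀ r S, |Real.log (M r S)| ≤ α * C := fun r S => abs_log_expMean_le hC' _ _
  have hNC : ∀ r S, |Real.log (expMean P φ (G r) S)| ≤ C := fun r S => abs_log_expMean_le hC _ _
  clear_value M
  have hent := entropy_le_sum_groups (P := P) hφ' hC' col
  set w : (Fin n → 𝒳) → ℝ := fun S => (∑ r, (α * φ S - Real.log (M r S))) / α ^ 2 with hw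
  have hwm : Measurable w := by fun_prop
  have hterm : ∀ r S, |α * φ S - Real.log (M r S)| ≤ α * C + α * C := fun r S =>
    (abs_sub _ _).trans (add_le_add (hC' S) (hMC r S))
  have hwC : ∀ S, |w S| ≤ (g * (α * C + α * C)) / α ^ 2 := fun S => by
    simp only [hw]
    rw [abs_div, abs_of_nonneg (sq_nonneg α)]
    gcongr
    refine (Finset.abs_sum_le_sum_abs _ _).trans ((Finset.sum_le_card_nsmul _ _ _
      fun r _ => hterm r S).trans (le_of_eq ?_))
    rw [Finset.card_univ, Fintype.card_fin, nsmul_eq_mul]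
  have hint : ∀ r, Integrable (fun S => Real.exp (α * φ S) * (α * φ S - Real.log (M r S)))
      (Measure.pi fun _ => P) := fun r =>
    integrable_of_abs_le _ (by have := hMm r; fun_prop) (Real.exp (α * C) * (α * C + α * C))
      fun S => by
        rw [abs_mul, Real.abs_exp]
        exact mul_le_mul (Real.exp_le_exp.2 (le_of_abs_le (hC' S))) (hterm r S) (abs_nonneg _)
          (Real.exp_pos _).le
  have hent' : expEntropy (Measure.pi fun _ => P) (fun S => α * φ S) ≤
      α ^ 2 * ∫ S, Real.exp (α * φ S) * w S ∂(Measure.pi fun _ => P) := by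
    refine hent.trans (le_of_eq ?_)
    rw [← integral_finsetSum _ fun r _ => by simp only [hM, hG] at hint; exact hint r,
      ← integral_const_mul]
    refine integral_congr_ae (Filter.Eventually.of_forall fun S => ?_)
    simp only [hw, hM, hG]
    rw [← Finset.mul_sum]
    field_simp
  have h := log_integral_exp_mul_div_le hφ hwm (C := max C ((g * (α * C + α * C)) / α ^ 2))
    (fun S => (hC S).trans (le_max_left _ _)) (fun S => (hwC S).trans (le_max_right _ _)) hα1 hent'
  rw [← hα]
  refine h.trans ?_
  have i1 : Integrable (fun S => Real.exp (φ S + α * (α - 1) * w S)) (Measure.pi fun _ => P) :=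
    integrable_exp_of_abs_le _ (φ := fun S => φ S + α * (α - 1) * w S) (by fun_prop)
      (C := C + α * (α - 1) * ((g * (α * C + α * C)) / α ^ 2))
      fun S => (abs_add_le _ _).trans (add_le_add (hC S) (by
        have h0 : 0 ≤ α * (α - 1) := mul_nonneg hα0.le (by linarith)
        rw [abs_mul, abs_of_nonneg h0]; exact mul_le_mul_of_nonneg_left (hwC S) h0))
  have i2 : Integrable (fun S => Real.exp (φ S + ∑ r, s * (φ S - Real.log (expMean P φ (G r) S))))
      (Measure.pi fun _ => P) :=
    integrable_exp_of_abs_le _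
      (φ := fun S => φ S + ∑ r, s * (φ S - Real.log (expMean P φ (G r) S))) (by fun_prop)
      (C := C + g * (s * (C + C)))
      fun S => (abs_add_le _ _).trans (add_le_add (hC S) (by
        refine (Finset.abs_sum_le_sum_abs _ _).trans ((Finset.sum_le_card_nsmul _ _ (s * (C + C))
          fun r _ => ?_).trans (le_of_eq (by simp)))
        rw [abs_mul, abs_of_nonneg hs]
        exact mul_le_mul_of_nonneg_left ((abs_sub _ _).trans (add_le_add (hC S) (hNC r S))) hs))
  refine Real.log_le_log (integral_exp_pos i1) (integral_mono i1 i2 fun S => ?_)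
  refine Real.exp_le_exp.2 (add_le_add le_rfl ?_)
  have e : α * (α - 1) * w S = ∑ r, s / α * (α * φ S - Real.log (M r S)) := by
    simp only [hw]
    rw [← Finset.mul_sum]
    have : α - 1 = s := by linarith
    rw [this]; field_simp
  rw [e]
  refine Finset.sum_le_sum fun r _ => ?_
  -- Averages of exp(αφ) are exchanged for averages of exp φ; only the latter are conditional masses
  -- of the likelihood, which the Hölder argument uses later.
  have h1 := mul_log_expMean_le (P := P) hφ hC hα1 (G r) S
  have h2 : s / α * (α * φ S - Real.log (M r S)) ≤
      s / α * (α * φ S - α * Real.log (expMean P φ (G r) S)) := by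
    refine mul_le_mul_of_nonneg_left ?_ (by positivity)
    rw [hM]; linarith
  refine h2.trans (le_of_eq ?_)
  simp only [hG]
  field_simp

include hφ hC in
-- Dividing exp φ by its average over `G` gives a conditional density of the coordinates in `G`, of
-- mass one given the others, and `base` depends only on the others.
theorem lintegral_exp_add_sub_log_expMean (G : Finset (Fin n)) {base : (Fin n → 𝒳) → ℝ}
    (hb : Measurable base)
    (hbG : ∀ S S' : Fin n → 𝒳, (∀ i, i ∉ G → S i = S' i) → base S = base S') :
    ∫⁻ S, ENNReal.ofReal (Real.exp (φ S + (base S - Real.log (expMean P φ G S))))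
        ∂(Measure.pi fun _ => P) =
      ∫⁻ S, ENNReal.ofReal (Real.exp (base S)) ∂(Measure.pi fun _ => P) := by
  have hm := measurable_expMean (P := P) hφ G
  refine lintegral_eq_of_lmarginal_eq (μ := fun _ => P) G (by fun_prop) (by fun_prop)
    (funext fun S => ?_)
  have hoff : ∀ (y : (i : G) → 𝒳), ∀ i, i ∉ G → Function.updateFinset S G y i = S i :=
    fun y i hi => by simp [Function.updateFinset, hi]
  have e1 : ∀ y : (i : G) → 𝒳, base (Function.updateFinset S G y) = base S := fun y =>
    hbG _ _ (hoff y)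
  have e2 : ∀ y : (i : G) → 𝒳, expMean P φ G (Function.updateFinset S G y) = expMean P φ G S :=
    fun y => by
      rw [expMean, expMean]
      congr 1
      exact lmarginal_congr _ _ fun i hi => hoff y i hi
  have hp := expMean_pos (P := P) hC G S
  simp only [lmarginal, e1, e2]
  simp only [← ofReal_exp_mul (φ _)]
  rw [lintegral_mul_const' _ _ ENNReal.ofReal_ne_top, lintegral_const, measure_univ, mul_one]
  have e3 := ofReal_expMean (P := P) hC G S
  rw [lmarginal] at e3
  rw [← e3]
  nth_rewrite 1 [← Real.exp_log hp]
  rw [ofReal_exp_mul]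
  congr 2; ring

end

/-- There is a coloring with as few monochromatic pairs as for a random one. -/
theorem exists_coloring {n K g m : ℕ} (hg : 0 < g) (I : Fin K → Finset (Fin n))
    (hcard : ∀ k, (I k).card = m) : ∃ col : Fin n → Fin g,
    ∑ k, ∑ r, (((I k ∩ Finset.univ.filter fun i => col i = r).card : ℝ)) ^ 2 ≤
      K * (m + m * (m - 1) / g) := by
  have hg0 : (g : ℝ) ≠ 0 := by positivity
  have hsq : ∀ (col : Fin n → Fin g) (k : Fin K) (r : Fin g),
      (((I k ∩ Finset.univ.filter fun i => col i = r).card : ℝ)) ^ 2 =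
        ∑ i ∈ I k, ∑ j ∈ I k, (if col i = r then 1 else 0) * (if col j = r then 1 else 0) := by
    intro col k r
    rw [← Finset.sum_mul_sum, sq]
    have : ((I k ∩ Finset.univ.filter fun i => col i = r).card : ℝ) =
        ∑ i ∈ I k, (if col i = r then 1 else 0) := by
      rw [Finset.sum_boole]
      congr 2; ext i; simp
    rw [this]
  have hpair : ∀ i j : Fin n, ∑ r : Fin g, ∑ col : Fin n → Fin g,
      ((if col i = r then 1 else 0) * (if col j = r then 1 else 0) : ℝ) =
        if i = j then (g : ℝ) ^ n else (g : ℝ) ^ n / g := by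
    intro i j
    by_cases hij : i = j
    · subst hij
      rw [Finset.sum_comm]
      simp
    · rw [if_neg hij]
      have hr : ∀ r : Fin g, ∑ col : Fin n → Fin g,
          ((if col i = r then 1 else 0) * (if col j = r then 1 else 0) : ℝ) =
            (g : ℝ) ^ n / g ^ 2 := by
        intro r
        set f : Fin n → Fin g → ℝ := fun l c => (if l = i then (if c = r then 1 else 0) else 1) *
          (if l = j then (if c = r then 1 else 0) else 1) with hf
        have e1 : ∀ col : Fin n → Fin g,
            ((if col i = r then 1 else 0) * (if col j = r then 1 else 0) : ℝ) =
              ∏ l, f l (col l) := fun col => by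
          simp only [hf]
          rw [Finset.prod_mul_distrib, Finset.prod_ite_eq' Finset.univ i,
            Finset.prod_ite_eq' Finset.univ j]
          simp
        have e2 : ∀ l, ∑ c, f l c =
            (if l = i then (g : ℝ)⁻¹ else 1) * (if l = j then (g : ℝ)⁻¹ else 1) * g := by
          intro l
          simp only [hf]
          by_cases h1 : l = i
          · have h2 : l ≠ j := fun h => hij (h1 ▸ h)
            simp [h1, hij, hg0]
          · by_cases h2 : l = j
            · have : j ≠ i := fun h => h1 (h2.trans h)
              simp [h2, this, hg0]
            · simp [h1, h2]
        simp only [e1]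
        rw [← Fintype.piFinset_univ, ← Finset.prod_univ_sum]
        simp only [e2]
        rw [Finset.prod_mul_distrib, Finset.prod_mul_distrib, Finset.prod_ite_eq' Finset.univ i,
          Finset.prod_ite_eq' Finset.univ j]
        simp
        field_simp
      simp only [hr]
      simp
      field_simp
  have hne : (Finset.univ : Finset (Fin n → Fin g)).Nonempty :=
    ⟨fun _ => ⟨0, hg⟩, Finset.mem_univ _⟩
  -- Some coloring is not worse than the average over all g^n of them, in which two different points
  -- share a color with frequency 1/g.
  have h := Finset.exists_le_of_sum_le hne
    (f := fun col => ∑ k, ∑ r, (((I k ∩ Finset.univ.filter fun i => col i = r).card : ℝ)) ^ 2)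
    (g := fun _ => (K : ℝ) * (m + m * (m - 1) / g)) (by
      rw [Finset.sum_comm]
      have hk : ∀ k ∈ Finset.univ, ∑ col : Fin n → Fin g, ∑ r,
          (((I k ∩ Finset.univ.filter fun i => col i = r).card : ℝ)) ^ 2 =
            (g : ℝ) ^ n * (m + m * (m - 1) / g) := by
        intro k _
        simp only [hsq]
        have e1 : ∑ col : Fin n → Fin g, ∑ r, ∑ i ∈ I k, ∑ j ∈ I k,
            ((if col i = r then 1 else 0) * (if col j = r then 1 else 0) : ℝ) =
            ∑ i ∈ I k, ∑ j ∈ I k, ∑ r : Fin g, ∑ col : Fin n → Fin g,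
            ((if col i = r then 1 else 0) * (if col j = r then 1 else 0) : ℝ) := by
          rw [Finset.sum_comm]
          have : ∀ r : Fin g, ∑ col : Fin n → Fin g, ∑ i ∈ I k, ∑ j ∈ I k,
              ((if col i = r then 1 else 0) * (if col j = r then 1 else 0) : ℝ) =
              ∑ i ∈ I k, ∑ j ∈ I k, ∑ col : Fin n → Fin g,
              ((if col i = r then 1 else 0) * (if col j = r then 1 else 0) : ℝ) := fun r => by
            rw [Finset.sum_comm]
            refine Finset.sum_congr rfl fun i _ => ?_
            rw [Finset.sum_comm]
          simp only [this]
          rw [Finset.sum_comm]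
          refine Finset.sum_congr rfl fun i _ => ?_
          rw [Finset.sum_comm]
        rw [e1]
        simp only [hpair]
        have e2 : ∀ i ∈ I k, ∑ j ∈ I k, (if i = j then (g : ℝ) ^ n else (g : ℝ) ^ n / g) =
            (g : ℝ) ^ n + (m - 1) * ((g : ℝ) ^ n / g) := by
          intro i hi
          rw [← Finset.add_sum_erase _ _ hi, if_pos rfl]
          congr 1
          rw [Finset.sum_congr rfl fun j hj => if_neg (Finset.ne_of_mem_erase hj).symm,
            Finset.sum_const, Finset.card_erase_of_mem hi, hcard, nsmul_eq_mul,
            Nat.cast_sub (by have := Finset.card_pos.2 ⟨i, hi⟩; rw [hcard] at this; exact this)]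
          simp
        rw [Finset.sum_congr rfl e2, Finset.sum_const, hcard, nsmul_eq_mul]
        ring
      rw [Finset.sum_congr rfl hk]
      simp
      exact le_of_eq (by ring))
  exact ⟨h.choose, h.choose_spec.2⟩

theorem ofReal_exp_sum {ι : Type*} (s : Finset ι) (f : ι → ℝ) :
    ENNReal.ofReal (Real.exp (∑ i ∈ s, f i)) = ∏ i ∈ s, ENNReal.ofReal (Real.exp (f i)) := by
  rw [Real.exp_sum, ENNReal.ofReal_prod_of_nonneg fun i _ => (Real.exp_pos _).le]

theorem inner_sub_tilt {d : ℕ} (v c : EuclideanSpace ℝ (Fin d)) (θ : ℝ) :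
    inner ℝ v c - ‖c‖ ^ 2 / 2 + θ * inner ℝ (v - c) c =
      inner ℝ v ((1 + θ) • c) - ‖(1 + θ) • c‖ ^ 2 / 2 + θ ^ 2 / 2 * ‖c‖ ^ 2 := by
  rw [inner_sub_left, norm_smul, inner_smul_right, mul_pow, Real.norm_eq_abs, sq_abs,
    real_inner_self_eq_norm_sq]
  ring

/-! ### The Rényi bound from resampling groups -/

namespace PathField

variable {𝒳 : Type*} [MeasurableSpace 𝒳] {d K n : ℕ} {b : ℝ}

local notation "V" => EuclideanSpace ℝ (Fin d)

@[fun_prop]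
theorem measurable_expMean_logLik_drift (o : PathField 𝒳 d K b) (P : Measure 𝒳)
    [IsProbabilityMeasure P] (I : Fin K → Finset (Fin n)) (G : Finset (Fin n))
    {X : Type*} [MeasurableSpace X] {f : X → Fin n → 𝒳} {h : X → Fin K → V}
    (hf : Measurable f) (hh : Measurable h) :
    Measurable fun p => expMean P (fun S => logLik (o.drift I S) (h p)) G (f p) := by
  unfold expMean
  refine Measurable.ennreal_toReal ?_
  simp only [lmarginal]
  have hu : Measurable fun q : X × ((i : G) → 𝒳) => Function.updateFinset (f q.1) G q.2 := by
    refine measurable_pi_lambda _ fun i => ?_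
    unfold Function.updateFinset
    by_cases hi : i ∈ G <;> simp only [hi, dite_true, dite_false] <;> fun_prop
  have h1 : Measurable fun q : X × ((i : G) → 𝒳) => ENNReal.ofReal (Real.exp
      (logLik (o.drift I (Function.updateFinset (f q.1) G q.2)) (h q.1))) := by fun_prop
  exact h1.lintegral_prod_right'

theorem norm_drift_sq_le (o : PathField 𝒳 d K b) (I : Fin K → Finset (Fin n)) (S : Fin n → 𝒳)
    (k : Fin K) (v : Fin K → V) : ‖o.drift I S k v‖ ^ 2 ≤ ((I k).card * b) ^ 2 :=
  pow_le_pow_left₀ (norm_nonneg _) (o.norm_drift_le I S k v) 2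

theorem sum_drift_inter (o : PathField 𝒳 d K b) (I : Fin K → Finset (Fin n)) {g : ℕ}
    (col : Fin n → Fin g) (S : Fin n → 𝒳) (k : Fin K) (v : Fin K → V) :
    ∑ r, o.drift (fun k => I k ∩ Finset.univ.filter fun i => col i = r) S k v =
      o.drift I S k v := by
  simp only [drift]
  rw [← Finset.sum_fiberwise_of_maps_to (s := I k) (t := Finset.univ) (g := col)
    fun _ _ => Finset.mem_univ _]
  refine Finset.sum_congr rfl fun r _ => Finset.sum_congr ?_ fun _ _ => rfl
  ext i; simp

/-- The linear parts of the group gains add up to the one of the full drift, so the coloring remains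
only in the half squares. The linear part scales the drift by `1 + θ`, at the cost of θ²/2 times its
squared length. -/
theorem logLik_add_sum_gain_le (o : PathField 𝒳 d K b) (I : Fin K → Finset (Fin n)) {m g : ℕ}
    (hcard : ∀ k, (I k).card = m) (col : Fin n → Fin g) {θ Q : ℝ} (hθ : 0 ≤ θ)
    (hQ : ∑ k, ∑ r, (((I k ∩ Finset.univ.filter fun i => col i = r).card : ℝ)) ^ 2 ≤ Q)
    (S : Fin n → 𝒳) (v : Fin K → V) :
    logLik (o.drift I S) v +
        θ * ∑ r, o.gain I (Finset.univ.filter fun i => col i = r) S v ≤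
      logLik (fun k v => (1 + θ) • o.drift I S k v) v +
        (θ ^ 2 / 2 * (K * (m * b) ^ 2) + θ / 2 * (b ^ 2 * Q)) := by
  have e1 : ∑ r, o.gain I (Finset.univ.filter fun i => col i = r) S v =
      ∑ k, (inner ℝ (v k - o.drift I S k v) (o.drift I S k v) + ∑ r,
        ‖o.drift (fun k => I k ∩ Finset.univ.filter fun i => col i = r) S k v‖ ^ 2 / 2) := by
    simp only [gain_eq]
    rw [Finset.sum_comm]
    refine Finset.sum_congr rfl fun k _ => ?_
    rw [Finset.sum_add_distrib, ← inner_sum, o.sum_drift_inter I col S k v]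
  have e2 : logLik (o.drift I S) v + θ * ∑ r, o.gain I (Finset.univ.filter fun i => col i = r) S v =
      logLik (fun k v => (1 + θ) • o.drift I S k v) v + (∑ k, θ ^ 2 / 2 * ‖o.drift I S k v‖ ^ 2 +
        θ / 2 * ∑ k, ∑ r,
          ‖o.drift (fun k => I k ∩ Finset.univ.filter fun i => col i = r) S k v‖ ^ 2) := by
    rw [e1, logLik, logLik, Finset.mul_sum, ← Finset.sum_add_distrib, Finset.mul_sum,
      ← Finset.sum_add_distrib, ← Finset.sum_add_distrib]
    refine Finset.sum_congr rfl fun k _ => ?_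
    have := inner_sub_tilt (v k) (o.drift I S k v) θ
    rw [mul_add, ← add_assoc, this, ← Finset.sum_div]
    ring
  rw [e2]
  refine add_le_add le_rfl (add_le_add ?_ (mul_le_mul_of_nonneg_left ?_ (by positivity)))
  · rw [← Finset.mul_sum]
    refine mul_le_mul_of_nonneg_left ?_ (by positivity)
    have h2 : ∀ k ∈ Finset.univ, ‖o.drift I S k v‖ ^ 2 ≤ (m * b) ^ 2 := fun k _ => by
      have h3 := o.norm_drift_sq_le I S k v
      rwa [hcard] at h3
    exact (Finset.sum_le_card_nsmul _ _ _ h2).trans (le_of_eq (by simp))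
  · calc _ ≤ ∑ k, ∑ r, b ^ 2 *
        (((I k ∩ Finset.univ.filter fun i => col i = r).card : ℝ)) ^ 2 := by
          refine Finset.sum_le_sum fun k _ => Finset.sum_le_sum fun r _ => ?_
          refine (o.norm_drift_sq_le _ S k v).trans (le_of_eq ?_)
          ring
      _ ≤ _ := by
          simp only [← Finset.mul_sum]
          exact mul_le_mul_of_nonneg_left hQ (sq_nonneg b)

theorem lintegral_exp_logLik_le (o : PathField 𝒳 d K b) (I : Fin K → Finset (Fin n)) {α : ℝ}
    (S : Fin n → 𝒳) : ∫⁻ v, ENNReal.ofReal (Real.exp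
      (logLik (fun k v => α • o.drift I S k v) v)) ∂(whiteNoise d K) ≤ 1 := by
  have hpast : DependsOnPast fun k v => α • o.drift I S k v := fun k v v' h => by
    simp only [o.past_drift I S k v v' h]
  simp only [← lik_eq_exp_logLik]
  exact lintegral_lik_le hpast fun k => by fun_prop

/-- The Rényi bound from resampling groups of data points. -/
theorem hasRenyiBound_groups (o : PathField 𝒳 d K b) (P : Measure 𝒳) [IsProbabilityMeasure P]
    (I : Fin K → Finset (Fin n)) {m g : ℕ} (hcard : ∀ k, (I k).card = m) (hg : 0 < g) {s : ℝ}
    (hs : 0 < s) (hsg : s * g < 1) :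
    HasRenyiBound (Measure.pi fun _ : Fin n => P) (whiteNoise d K)
      (fun S v => lik (o.drift I S) v) s ((1 + s) * (s / 2 *
        (s / (1 - s * g) * (K * (m * b) ^ 2) + b ^ 2 * (K * (m + m * (m - 1) / g))))) := by
  obtain ⟨col, hcol⟩ := exists_coloring hg I hcard
  generalize hQ : (K : ℝ) * (m + m * (m - 1) / g) = Q at hcol ⊢
  have h1 : 0 < 1 - s * g := by linarith
  -- Determined by (1 - sg) θ = s, so that the exponents in the Hölder splitting below add up.
  obtain ⟨θ, hθ⟩ : ∃ θ, θ = s / (1 - s * g) := ⟨_, rfl⟩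
  have hθ0 : 0 ≤ θ := by rw [hθ]; positivity
  have hθs : (1 - s * g) * θ = s := by rw [hθ]; field_simp
  rw [← hθ]
  simp only [lik_eq_exp_logLik]
  have hjoint : Measurable fun p : (Fin n → 𝒳) × (Fin K → V) => logLik (o.drift I p.1) p.2 := by
    fun_prop
  refine HasRenyiBound.of_norm _ _ (ℓ := fun S v => logLik (o.drift I S) v) hjoint
    (fun v => ⟨_, fun S => o.abs_logLik_drift_le I S v⟩) hs.le ?_
  set G : Fin g → Finset (Fin n) := fun r => Finset.univ.filter fun i => col i = r with hG
  set M : Fin g → (Fin n → 𝒳) → (Fin K → V) → ℝ := fun r S v =>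
    expMean P (fun S => logLik (o.drift I S) v) (G r) S with hM
  set base : Fin g → (Fin n → 𝒳) → (Fin K → V) → ℝ := fun r S v =>
    logLik (o.drift (fun k => I k \ G r) S) v with hbase
  set f₀ : (Fin K → V) × (Fin n → 𝒳) → ℝ≥0∞ := fun p => ENNReal.ofReal (Real.exp
    (logLik (o.drift I p.2) p.1 + θ * ∑ r, o.gain I (G r) p.2 p.1)) with hf₀
  set f : Fin g → (Fin K → V) × (Fin n → 𝒳) → ℝ≥0∞ := fun r p => ENNReal.ofReal (Real.exp
    (logLik (o.drift I p.2) p.1 + (base r p.2 p.1 - Real.log (M r p.2 p.1)))) with hf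
  have hf₀m : Measurable f₀ := by simp only [hf₀]; fun_prop
  have hfm : ∀ r, Measurable (f r) := fun r => by simp only [hf, hbase, hM]; fun_prop
  -- Hölder with exponent s for each group and 1 - sg for the rest. The factor of a group is the
  -- likelihood without the group times a conditional density, of mass at most one; `f₀` collects
  -- the gains, whose exponential moment is explicit.
  have step1 : ∀ v, ENNReal.ofReal (Real.exp (Real.log (∫ S, Real.exp ((1 + s) *
      logLik (o.drift I S) v) ∂(Measure.pi fun _ : Fin n => P)) / (1 + s))) ≤
      ∫⁻ S, f₀ (v, S) ^ (1 - s * g) * ∏ r, f r (v, S) ^ s ∂(Measure.pi fun _ : Fin n => P) := by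
    intro v
    have hHm : Measurable fun S : Fin n → 𝒳 => logLik (o.drift I S) v := by fun_prop
    have hHC : ∀ S : Fin n → 𝒳, |logLik (o.drift I S) v| ≤ logLikBound d K n b v := fun S =>
      o.abs_logLik_drift_le I S v
    have h := log_integral_exp_mul_div_le_groups (P := P) hHm hHC col hs.le
    have hMm : ∀ r, Measurable fun S => M r S v := fun r => by simp only [hM]; fun_prop
    have i2 : Integrable (fun S => Real.exp (logLik (o.drift I S) v +
        ∑ r, s * (logLik (o.drift I S) v - Real.log (M r S v)))) (Measure.pi fun _ => P) :=
      integrable_exp_of_abs_le _ (φ := fun S => logLik (o.drift I S) v +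
          ∑ r, s * (logLik (o.drift I S) v - Real.log (M r S v))) (by fun_prop)
        (C := logLikBound d K n b v + g * (s * (logLikBound d K n b v + logLikBound d K n b v)))
        fun S => (abs_add_le _ _).trans (add_le_add (hHC S) (by
          refine (Finset.abs_sum_le_sum_abs _ _).trans ((Finset.sum_le_card_nsmul _ _
            (s * (logLikBound d K n b v + logLikBound d K n b v))
            fun r _ => ?_).trans (le_of_eq (by simp)))
          rw [abs_mul, abs_of_pos hs]
          exact mul_le_mul_of_nonneg_left ((abs_sub _ _).trans
            (add_le_add (hHC S) (abs_log_expMean_le hHC _ _))) hs.le))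
    refine (ENNReal.ofReal_le_ofReal (Real.exp_le_exp.2 h)).trans (le_of_eq ?_)
    rw [Real.exp_log (integral_exp_pos i2), ofReal_integral_eq_lintegral_ofReal i2
      (Filter.Eventually.of_forall fun x => (Real.exp_pos _).le)]
    refine lintegral_congr fun S => ?_
    simp only [hf₀, hf, ofReal_exp_rpow]
    rw [← ofReal_exp_sum, ofReal_exp_mul]
    congr 2
    have e : ∀ r, o.gain I (G r) S v = logLik (o.drift I S) v - base r S v := fun r => rfl
    simp only [e]
    rw [← Finset.sum_mul, ← Finset.mul_sum, Finset.sum_add_distrib, Finset.sum_sub_distrib,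
      Finset.sum_sub_distrib, Finset.sum_sub_distrib]
    simp only [Finset.sum_const, Finset.card_univ, Fintype.card_fin, nsmul_eq_mul]
    generalize ∑ r, base r S v = B
    generalize logLik (o.drift I S) v = H
    generalize ∑ r, Real.log (M r S v) = L
    have : (H + θ * (g * H - B)) * (1 - s * g) =
        H * (1 - s * g) + (1 - s * g) * θ * (g * H - B) := by ring
    rw [this, hθs]
    ring
  have hA0 : ∫⁻ p, f₀ p ∂((whiteNoise d K).prod (Measure.pi fun _ : Fin n => P)) ≤
      ENNReal.ofReal (Real.exp (θ ^ 2 / 2 * (K * (m * b) ^ 2) + θ / 2 * (b ^ 2 * Q))) := by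
    rw [lintegral_prod_symm _ hf₀m.aemeasurable]
    have : ∀ S, ∫⁻ v, f₀ (v, S) ∂(whiteNoise d K) ≤
        ENNReal.ofReal (Real.exp (θ ^ 2 / 2 * (K * (m * b) ^ 2) + θ / 2 * (b ^ 2 * Q))) := by
      intro S
      have e : ∀ v, f₀ (v, S) ≤
          ENNReal.ofReal (Real.exp (logLik (fun k v => (1 + θ) • o.drift I S k v) v)) *
          ENNReal.ofReal (Real.exp (θ ^ 2 / 2 * (K * (m * b) ^ 2) + θ / 2 * (b ^ 2 * Q))) :=
        fun v => by
          rw [ofReal_exp_mul]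
          exact ENNReal.ofReal_le_ofReal (Real.exp_le_exp.2
            (o.logLik_add_sum_gain_le I hcard col hθ0 hcol S v))
      refine (lintegral_mono e).trans ?_
      rw [lintegral_mul_const' _ _ ENNReal.ofReal_ne_top]
      exact (mul_le_mul_left (o.lintegral_exp_logLik_le I S) _).trans_eq (one_mul _)
    refine (lintegral_mono this).trans ?_
    simp
  have hA : ∀ r, ∫⁻ p, f r p ∂((whiteNoise d K).prod (Measure.pi fun _ : Fin n => P)) ≤ 1 := by
    intro r
    rw [lintegral_prod _ (hfm r).aemeasurable]
    have e : ∀ v, ∫⁻ S, f r (v, S) ∂(Measure.pi fun _ : Fin n => P) =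
        ∫⁻ S, ENNReal.ofReal (Real.exp (base r S v)) ∂(Measure.pi fun _ : Fin n => P) := fun v =>
      lintegral_exp_add_sub_log_expMean (P := P) (φ := fun S => logLik (o.drift I S) v)
        (by fun_prop) (fun S => o.abs_logLik_drift_le I S v) (G r)
        (base := fun S => base r S v) (by simp only [hbase]; fun_prop) fun S S' h => by
          simp only [hbase]
          rw [o.drift_congr (fun k => I k \ G r) fun k i hi => h i (Finset.mem_sdiff.1 hi).2]
    have hbm : Measurable fun p : (Fin K → V) × (Fin n → 𝒳) =>
        ENNReal.ofReal (Real.exp (base r p.2 p.1)) := by simp only [hbase]; fun_prop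
    simp only [e]
    rw [lintegral_lintegral_swap hbm.aemeasurable]
    refine (lintegral_mono fun S => ?_).trans (le_of_eq (lintegral_one.trans measure_univ))
    simpa using o.lintegral_exp_logLik_le (fun k => I k \ G r) (α := 1) S
  refine (lintegral_mono step1).trans ?_
  have hFm : Measurable fun p => f₀ p ^ (1 - s * g) * ∏ r, f r p ^ s := by fun_prop
  rw [← lintegral_prod (fun p => f₀ p ^ (1 - s * g) * ∏ r, f r p ^ s) hFm.aemeasurable]
  refine (ENNReal.lintegral_mul_prod_norm_pow_le Finset.univ hf₀m.aemeasurable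
    (fun r _ => (hfm r).aemeasurable) (1 - s * g) (p := fun _ => s)
    (by simp; ring) h1.le fun _ _ => hs.le).trans ?_
  refine (mul_le_mul' (ENNReal.rpow_le_rpow hA0 h1.le) (Finset.prod_le_one' fun r _ =>
    (ENNReal.rpow_le_rpow (hA r) hs.le).trans_eq (ENNReal.one_rpow s))).trans (le_of_eq ?_)
  rw [mul_one, ofReal_exp_rpow]
  congr 2
  have : (θ ^ 2 / 2 * (K * (m * b) ^ 2) + θ / 2 * (b ^ 2 * Q)) * (1 - s * g) =
      (1 - s * g) * θ / 2 * (θ * (K * (m * b) ^ 2) + b ^ 2 * Q) := by ring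
  rw [this, hθs]

end PathField

/-! ### Elementary inequalities for the choice of parameters -/

/-- This is y ≤ sinh y at y = -log(1 - x). -/
theorem neg_log_one_sub_le {x : ℝ} (h0 : 0 ≤ x) (h1 : x < 1) :
    -Real.log (1 - x) ≤ (x - x ^ 2 / 2) / (1 - x) := by
  have h2 : 0 < 1 - x := by linarith
  have h3 : 0 ≤ -Real.log (1 - x) := by
    rw [neg_nonneg]; exact Real.log_nonpos h2.le (by linarith)
  have h := Real.self_le_sinh_iff.2 h3
  rw [← Real.log_inv, Real.sinh_log (inv_pos.2 h2)] at h
  rw [← Real.log_inv]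
  refine h.trans (le_of_eq ?_)
  field_simp
  ring

theorem neg_log_one_sub_le_div {x : ℝ} (h0 : 0 ≤ x) (h1 : x < 1) :
    -Real.log (1 - x) ≤ x / (1 - x) := by
  refine (neg_log_one_sub_le h0 h1).trans ?_
  have : 0 < 1 - x := by linarith
  gcongr
  nlinarith [sq_nonneg x]

theorem add_sq_mul_lt_one_of_lt_rNu {ν l : ℝ} (hν : 0 < ν) (hl : 0 < l) (h : l < rNu ν) :
    ν * (l + l ^ 2) < 1 := by
  have h1 : l + 1 / 2 < √(1 / ν + 1 / 4) := by unfold rNu at h; linarith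
  have h2 : (l + 1 / 2) ^ 2 < 1 / ν + 1 / 4 := by
    rw [← Real.sq_sqrt (show 0 ≤ 1 / ν + 1 / 4 by positivity)]
    exact pow_lt_pow_left₀ h1 (by positivity) (by norm_num)
  have h3 : l + l ^ 2 < 1 / ν := by nlinarith
  rw [lt_div_iff₀ hν] at h3
  linarith

/-- In a = ν(l + l²) the value of F is (4a² + a/2)/(1 - a). Splitting off the linear part leaves the
excess 9a²/(1 - a), to which all bounds for several epochs are compared. -/
theorem half_mul_add_bernsteinF {ν l : ℝ} (h : ν * (l + l ^ 2) < 1) :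
    1 / 2 * l * ν + bernsteinF ν ((l + l ^ 2) / 2) =
      1 / 2 * (l * ν * (2 + l) + 9 * (ν * (l + l ^ 2)) ^ 2 / (1 - ν * (l + l ^ 2))) := by
  unfold bernsteinF
  have h1 : 1 - ν * (l + l ^ 2) ≠ 0 := by linarith
  have h2 : 1 - 2 * ν * ((l + l ^ 2) / 2) = 1 - ν * (l + l ^ 2) := by ring
  have h3 : 16 * ν ^ 2 * ((l + l ^ 2) / 2) ^ 2 + ν * ((l + l ^ 2) / 2) =
      4 * (ν * (l + l ^ 2)) ^ 2 + ν * (l + l ^ 2) / 2 := by ring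
  have h4 : l * ν * (2 + l) = l * ν + ν * (l + l ^ 2) := by ring
  rw [h2, h3, h4]
  generalize ν * (l + l ^ 2) = a at h1
  field_simp
  ring

/-- The target is at least what is shown for two or more epochs. -/
theorem target_le {E ν l s d ξ : ℝ} (hE : 2 ≤ E) (hν : 0 < ν) (hl : 0 < l)
    (h : ν * (l + l ^ 2) < 1) (hs : s = l / E) (hd : d = s * (1 + s) * E * ν)
    (hξ : ξ = (1 + l) / (1 + s)) :
    1 / 2 * (d * (2 + 9 * ξ ^ 2 * d / (1 - ξ * d))) ≤
      1 / 2 * l * ν + bernsteinF ν ((l + l ^ 2) / 2) := by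
  rw [half_mul_add_bernsteinF h]
  have hs0 : 0 < s := by rw [hs]; positivity
  have hsE : s * E = l := by rw [hs]; field_simp
  have hd' : d = l * ν * (1 + s) := by rw [hd, ← hsE]; ring
  have hξd : ξ * d = ν * (l + l ^ 2) := by rw [hξ, hd']; field_simp
  have e : d * (2 + 9 * ξ ^ 2 * d / (1 - ξ * d)) = 2 * d + 9 * (ξ * d) ^ 2 / (1 - ξ * d) := by ring
  rw [e, hξd, hd']
  have hsl : 2 * s ≤ l := by nlinarith
  have : 2 * (l * ν * (1 + s)) ≤ l * ν * (2 + l) := by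
    have := mul_pos hl hν
    nlinarith
  linarith

theorem excess_mono {ξ ξ₀ d : ℝ} (hξ₀ : 0 ≤ ξ₀) (h : ξ₀ ≤ ξ) (hd : 0 ≤ d) (hlt : ξ * d < 1) :
    9 * ξ₀ ^ 2 * d / (1 - ξ₀ * d) ≤ 9 * ξ ^ 2 * d / (1 - ξ * d) := by
  have h1 : 0 < 1 - ξ * d := by linarith
  have h2 : ξ₀ * d ≤ ξ * d := mul_le_mul_of_nonneg_right h hd
  gcongr

/-- The target has its pole at d = 3/4, and D is affine with 1 - D = (1 - 4d/3)/2, so that the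
logarithm is singular at the same place. With η = 1/8 one has θ(1 + η)d = D and 1 + 1/η = 9. -/
theorem param_large {d D θ e : ℝ} (hd0 : 0 < d) (hd1 : d < 3 / 4) (he : e ≤ 4 / 9 * d)
    (hD : D = 1 / 2 + 2 * d / 3) (hθ : θ = 8 / 9 * D / d) :
    1 / (θ - 1) * (-Real.log (1 - D) + θ * d * 9 * (11 / 12) * e) ≤
      d * (2 + 16 * d / (1 - 4 / 3 * d)) := by
  have h1 : 0 < 12 - 11 * d := by linarith
  have h2 : 0 < 1 - 4 / 3 * d := by linarith
  have hD0 : 0 < D := by rw [hD]; positivity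
  have hD1 : D < 1 := by rw [hD]; linarith
  have hθ1 : θ - 1 = (12 - 11 * d) / 27 / d := by
    rw [hθ, hD]; field_simp; ring
  have hθd : θ * d = 8 / 9 * D := by rw [hθ]; field_simp
  have hlog := neg_log_one_sub_le hD0.le hD1
  have e1 : (D - D ^ 2 / 2) / (1 - D) = D * (2 - D) / (1 - 4 / 3 * d) := by
    have h3 : 1 - D ≠ 0 := by linarith
    have h4 : 1 - D = (1 - 4 / 3 * d) / 2 := by rw [hD]; ring
    rw [h4]; field_simp
  rw [e1] at hlog
  have e2 : θ * d * 9 * (11 / 12) * e ≤ 88 / 27 * D * d := by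
    rw [hθd]; nlinarith
  have e3 : 1 / (θ - 1) = d * (27 / (12 - 11 * d)) := by rw [hθ1]; field_simp
  rw [e3, mul_assoc]
  refine mul_le_mul_of_nonneg_left ?_ hd0.le
  calc _ ≤ 27 / (12 - 11 * d) * (D * (2 - D) / (1 - 4 / 3 * d) + 88 / 27 * D * d) := by gcongr
    _ ≤ _ := by
      rw [div_mul_eq_mul_div, div_le_iff₀ h1, ← sub_nonneg]
      have : (2 + 16 * d / (1 - 4 / 3 * d)) * (12 - 11 * d) -
          27 * (D * (2 - D) / (1 - 4 / 3 * d) + 88 / 27 * D * d) =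
          ((2 * (1 - 4 / 3 * d) + 16 * d) * (12 - 11 * d) - 27 * (D * (2 - D)) -
            88 * D * d * (1 - 4 / 3 * d)) / (1 - 4 / 3 * d) := by
        generalize 1 - 4 / 3 * d = y at h2
        field_simp
        ring
      rw [this]
      refine div_nonneg ?_ h2.le
      rw [hD]
      nlinarith [mul_nonneg hd0.le (sq_nonneg (d - 0.86)), mul_pos hd0 hd0]

/-- For η = (1 - d)/4 the argument 1 - (1 + η)d factors as (1 - d)(4 - d)/4: the pole stays at d = 1
although η is positive. -/
theorem neg_log_quad_le {d : ℝ} (hd0 : 0 < d) (hd1 : d < 1) :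
    -Real.log (1 - (1 + (1 - d) / 4) * d) ≤ d * ((5 - d) / ((1 - d) * (4 - d))) := by
  have h : 1 - (1 + (1 - d) / 4) * d = (1 - d) * (4 - d) / 4 := by ring
  have h1 : 0 < (1 - d) * (4 - d) := mul_pos (by linarith) (by linarith)
  have h2 := neg_log_one_sub_le_div (x := (1 + (1 - d) / 4) * d)
    (mul_nonneg (by linarith) hd0.le) (by linarith)
  refine h2.trans (le_of_eq ?_)
  rw [h]
  have h3 : 1 - d ≠ 0 := by linarith
  have h4 : 4 - d ≠ 0 := by linarith
  field_simp
  ring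

theorem div_four_sub_le {d : ℝ} (hd0 : 0 < d) (hd1 : d < 1) :
    (5 - d) / (4 - d) ≤ 5 / 4 + d / 12 := by
  rw [div_le_iff₀ (by linarith)]
  nlinarith

/-- Reduction of the bound with `θ = ω = 1`. -/
theorem param_one {d α e R : ℝ} (hd0 : 0 < d) (hd1 : d < 1) (hα : 0 < α)
    (h : α * ((5 - d) / (4 - d)) + (5 - d) * (11 / 12) * (α * e) ≤ (2 + R) * (1 - d)) :
    α * (-Real.log (1 - (1 + (1 - d) / 4) * d) + d * (1 + 1 / ((1 - d) / 4)) * (11 / 12) * e) ≤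
      d * (2 + R) := by
  have h1 : 0 < 1 - d := by linarith
  have h2 : 0 < 4 - d := by linarith
  have h3 : 1 + 1 / ((1 - d) / 4) = (5 - d) / (1 - d) := by field_simp; ring
  rw [h3]
  calc _ ≤ α * (d * ((5 - d) / ((1 - d) * (4 - d))) + d * ((5 - d) / (1 - d)) * (11 / 12) * e) := by
        gcongr; exact neg_log_quad_le hd0 hd1
    _ = d * ((α * ((5 - d) / (4 - d)) + (5 - d) * (11 / 12) * (α * e)) / (1 - d)) := by
        field_simp
    _ ≤ _ := by
        refine mul_le_mul_of_nonneg_left ?_ hd0.le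
        rw [div_le_iff₀ h1]; exact h

/-- Here s ≥ 1/5 and `he`, which comes from m ≥ 3, bound (1 + s)e by 5d/3; the constant 7/6 is a
lower bound for ξ in this range of s. A polynomial inequality in d remains. -/
theorem param_medium {d s e R : ℝ} (hd0 : 0 < d) (hd1 : d < 1) (hs : 1 / 5 ≤ s) (hs' : s < 1 / 2)
    (he : 3 * s * ((1 + s) * e) ≤ d) (hR : 9 * (7 / 6) ^ 2 * d / (1 - d) ≤ R) :
    (1 + s) * ((5 - d) / (4 - d)) + (5 - d) * (11 / 12) * ((1 + s) * e) ≤ (2 + R) * (1 - d) := by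
  have h1 : 0 < 1 - d := by linarith
  have h2 := div_four_sub_le hd0 hd1
  have h0 : 0 ≤ (5 - d) / (4 - d) := div_nonneg (by linarith) (by linarith)
  rw [div_le_iff₀ h1] at hR
  have h3 : (1 + s) * e ≤ 5 / 3 * d := by
    by_contra hc
    push Not at hc
    nlinarith
  have h4 : (5 - d) * (11 / 12) * ((1 + s) * e) ≤ (5 - d) * (11 / 12) * (5 / 3 * d) :=
    mul_le_mul_of_nonneg_left h3 (mul_nonneg (by linarith) (by norm_num))
  have h5 : (1 + s) * ((5 - d) / (4 - d)) ≤ 3 / 2 * (5 / 4 + d / 12) := by gcongr; linarith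
  nlinarith

/-- For small s the batch size gives no useful bound on e. The hypothesis `he` takes its place: it
is the complement of the case in which resampling groups suffices. -/
theorem param_small {d s e R : ℝ} (hd0 : 0 < d) (hd1 : d < 1) (hs : 0 < s) (hs' : s < 1 / 5)
    (he : (1 + s) * e * (1 + R) ≤ 9 / 2 * d) (hR : 9 * d / (1 - d) ≤ R) :
    (1 + s) * ((5 - d) / (4 - d)) + (5 - d) * (11 / 12) * ((1 + s) * e) ≤ (2 + R) * (1 - d) := by
  have h1 : 0 < 1 - d := by linarith
  have h2 := div_four_sub_le hd0 hd1
  have h0 : 0 ≤ (5 - d) / (4 - d) := div_nonneg (by linarith) (by linarith)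
  have hR0 : 0 ≤ R := le_trans (by positivity) hR
  have hR1 : (1 + 8 * d) / (1 - d) ≤ 1 + R := by
    refine le_trans (le_of_eq ?_) (add_le_add_right hR 1)
    field_simp; ring
  have h3 : (1 + s) * e ≤ 9 / 2 * d * ((1 - d) / (1 + 8 * d)) := by
    have h4 : (1 + s) * e ≤ 9 / 2 * d / (1 + R) := by rwa [le_div_iff₀ (by linarith)]
    refine h4.trans ?_
    rw [div_eq_mul_inv]
    gcongr
    rw [inv_le_comm₀ (by linarith) (by positivity), inv_div]
    exact hR1
  have h4 : (5 - d) * (11 / 12) * ((1 + s) * e) ≤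
      (5 - d) * (11 / 12) * (9 / 2 * d * ((1 - d) / (1 + 8 * d))) :=
    mul_le_mul_of_nonneg_left h3 (mul_nonneg (by linarith) (by norm_num))
  have h5 : (1 + s) * ((5 - d) / (4 - d)) ≤ 6 / 5 * (5 / 4 + d / 12) := by gcongr; linarith
  rw [div_le_iff₀ h1] at hR
  have h6 : (5 - d) * (11 / 12) * (9 / 2 * d * ((1 - d) / (1 + 8 * d))) ≤ 1 / 2 + 6.9 * d := by
    have : (5 - d) * (11 / 12) * (9 / 2 * d * ((1 - d) / (1 + 8 * d))) =
        ((5 - d) * (11 / 12) * (9 / 2 * d * (1 - d))) / (1 + 8 * d) := by ring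
    rw [this, div_le_iff₀ (by positivity)]
    nlinarith [mul_pos hd0 hd0, sq_nonneg (d - 0.09), mul_nonneg hd0.le (sq_nonneg d)]
  nlinarith

/-- With g = ⌊1/(2s)⌋ the product sg is at most 1/2, and at least 1/3 because g ≥ 2. On [1/3, 1/2]
the sum of reciprocals is largest at 1/3, with value 9/2. -/
theorem exists_group_number {s : ℝ} (hs : 0 < s) (hs' : s < 1 / 5) :
    ∃ g : ℕ, 0 < g ∧ s * g < 1 ∧ 1 / (1 - s * g) + 1 / (s * g) ≤ 9 / 2 := by
  have hy : 5 / 2 < 1 / (2 * s) := by rw [lt_div_iff₀ (by positivity)]; linarith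
  obtain ⟨g, hg⟩ : ∃ g, g = ⌊1 / (2 * s)⌋₊ := ⟨_, rfl⟩
  have h1 : (g : ℝ) ≤ 1 / (2 * s) := by rw [hg]; exact Nat.floor_le (by positivity)
  have h2 : 1 / (2 * s) < g + 1 := by rw [hg]; exact Nat.lt_floor_add_one _
  have h3 : 2 ≤ g := by rw [hg]; exact Nat.le_floor (by push_cast; linarith)
  have h3' : (2 : ℝ) ≤ g := by exact_mod_cast h3
  have h4 : 2 * (s * g) ≤ 1 := by
    rw [le_div_iff₀ (by positivity)] at h1; linarith
  have h5 : 1 < 2 * (s * g) + 2 * s := by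
    rw [div_lt_iff₀ (by positivity)] at h2; linarith
  have h6 : 1 / 3 ≤ s * g := by nlinarith
  refine ⟨g, by omega, by linarith, ?_⟩
  generalize s * (g : ℝ) = x at h4 h6
  have hx : 0 < x := by linarith
  have hx' : 0 < 1 - x := by linarith
  rw [div_add_div _ _ hx'.ne' hx.ne', div_le_iff₀ (mul_pos hx' hx)]
  nlinarith

/-! ### The Rényi bound for all parameters -/

namespace PathField

variable {𝒳 : Type*} [MeasurableSpace 𝒳] {d K n : ℕ} {b : ℝ}

/-- The bound from `infoWeight` in normalized parameters. -/
theorem hasRenyiBound_normalized (o : PathField 𝒳 d K b) (P : Measure 𝒳) [IsProbabilityMeasure P]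
    (I : Fin K → Finset (Fin n)) {T E m : ℕ} (hT : 0 < T) (hK : K = E * T)
    (hcard : ∀ k, (I k).card = m)
    (hI : ∀ k k' : Fin K, k ≠ k' → k.val / T = k'.val / T → Disjoint (I k) (I k'))
    {ν s D e θ η ω : ℝ} (hν : ν = m * b ^ 2) (hs : 0 < s) (hD : D = s * (1 + s) * E * ν)
    (he : e = E * b ^ 2) (hη : 0 < η) (hlt : θ * (1 + η) * D < 1) (hω0 : 0 ≤ ω) (hω1 : ω ≤ 1)
    (hθω : ω = 1 ∧ θ = 1 ∨ 1 < θ ∧ 1 ≤ ω * ((θ - 1) * (1 + s))) :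
    HasRenyiBound (Measure.pi fun _ : Fin n => P) (whiteNoise d K)
      (fun S v => lik (o.drift I S) v) s (T / 2 * ((1 + s) * ω *
        (-Real.log (1 - θ * (1 + η) * D) + θ * D * (1 + 1 / η) * (11 / 12) * e))) := by
  have hθ0 : 0 ≤ θ := by rcases hθω with ⟨_, h⟩ | ⟨h, _⟩ <;> linarith
  have h := o.hasRenyiBound_of_infoWeight P I (s := s) (κ := θ * (s * (1 + s))) (ω := ω) hs hω0 hω1
    (by
      have hα : 0 < (1 + s) * s := by positivity
      rcases hθω with ⟨h1, h2⟩ | ⟨h1, h2⟩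
      · left; exact ⟨h1, by rw [h2]; ring⟩
      · right
        refine ⟨by nlinarith, ?_⟩
        have := mul_le_mul_of_nonneg_left h2 hs.le
        nlinarith)
    fun S => o.lintegral_lik_mul_exp_infoWeight_le P I S hT hK hcard hI hν (by positivity) hη (by
      refine lt_of_eq_of_lt ?_ hlt
      rw [hD]; ring)
  refine h.mono (le_of_eq ?_)
  have e1 : θ * (s * (1 + s)) * (1 + η) * E * ν = θ * (1 + η) * D := by rw [hD]; ring
  rw [e1, he, hD]
  ring

set_option maxHeartbeats 1000000 in
-- With e = Eb² one has D = s(1 + s)me, so e/D measures the bounded part of the gains against their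
-- noise. For m ≤ 2 the worst case is enough. For larger m and s ≥ 1/5 the ratio is small, and the
-- bound by `infoWeight` works; near s ≥ 1/2 it may need interpolation. For s < 1/5 the ratio can be
-- large; then sm is small and the groups take over.
theorem hasRenyiBound_of_two_le (o : PathField 𝒳 d K b) (P : Measure 𝒳) [IsProbabilityMeasure P]
    (I : Fin K → Finset (Fin n)) {T E m : ℕ} (hT : 0 < T) (hE : 2 ≤ E) (hm : 0 < m) (hb : 0 < b)
    (hK : K = E * T) (hcard : ∀ k, (I k).card = m)
    (hI : ∀ k k' : Fin K, k ≠ k' → k.val / T = k'.val / T → Disjoint (I k) (I k'))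
    {ν s D l ξ : ℝ} (hν : ν = m * b ^ 2) (hl : 0 < l) (hlν : ν * (l + l ^ 2) < 1) (hs : s = l / E)
    (hD : D = s * (1 + s) * E * ν) (hξ : ξ = (1 + l) / (1 + s)) :
    HasRenyiBound (Measure.pi fun _ : Fin n => P) (whiteNoise d K)
      (fun S v => lik (o.drift I S) v) s
      (T / 2 * (D * (2 + 9 * ξ ^ 2 * D / (1 - ξ * D)))) := by
  have hm0 : (0 : ℝ) < m := by exact_mod_cast hm
  have hT0 : (0 : ℝ) < T := by exact_mod_cast hT
  have hE2 : (2 : ℝ) ≤ E := by exact_mod_cast hE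
  have hν0 : 0 < ν := by rw [hν]; positivity
  have hs0 : 0 < s := by rw [hs]; positivity
  have hD0 : 0 < D := by rw [hD]; positivity
  have hsE : s * E = l := by rw [hs]; field_simp
  have hξD : ξ * D = ν * (l + l ^ 2) := by rw [hξ, hD, ← hsE]; field_simp
  have hξD1 : ξ * D < 1 := hξD ▸ hlν
  have hsl : 2 * s ≤ l := by nlinarith
  have hξge : (1 + 2 * s) / (1 + s) ≤ ξ := by rw [hξ]; gcongr
  have hξ1 : 1 ≤ ξ := le_trans (by rw [le_div_iff₀ (by linarith)]; linarith) hξge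
  have hD1 : D < 1 := by nlinarith
  obtain ⟨R, hR⟩ : ∃ R, R = 9 * ξ ^ 2 * D / (1 - ξ * D) := ⟨_, rfl⟩
  have hRmono : ∀ ξ₀ : ℝ, 0 ≤ ξ₀ → ξ₀ ≤ ξ → 9 * ξ₀ ^ 2 * D / (1 - ξ₀ * D) ≤ R := fun ξ₀ h0 h =>
    hR ▸ excess_mono h0 h hD0.le hξD1
  have hR0 : 0 ≤ R := by simpa using hRmono 0 le_rfl (by linarith)
  rw [← hR]
  obtain ⟨e, he⟩ : ∃ e, e = E * b ^ 2 := ⟨_, rfl⟩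
  have he0 : 0 < e := by rw [he]; positivity
  have hDe : D = s * (1 + s) * m * e := by rw [hD, hν, he]; ring
  have hKT : (K : ℝ) = E * T := by rw [hK]; push_cast; ring
  by_cases hm3 : m ≤ 2
  · refine (o.hasRenyiBound_worstCase P I hcard hs0.le).mono ?_
    have hm2 : (m : ℝ) ≤ 2 := by exact_mod_cast hm3
    have e1 : (1 + s) * s / 2 * (K * (m * b) ^ 2) = T / 2 * (D * m) := by
      rw [hKT, hD, hν]; ring
    rw [e1]
    gcongr
    linarith
  have hm3 : (3 : ℝ) ≤ m := by exact_mod_cast (by omega : 3 ≤ m)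
  have he3 : 3 * s * ((1 + s) * e) ≤ D := by
    rw [hDe]
    have : 0 ≤ s * (1 + s) * e := by positivity
    nlinarith
  rcases le_or_gt (1 / 2) s with hs2 | hs2
  · have hξ43 : 4 / 3 ≤ ξ := le_trans (by
      rw [div_le_div_iff₀ (by norm_num) (by linarith)]; linarith) hξge
    have hD34 : D < 3 / 4 := by nlinarith
    have he' : e ≤ 4 / 9 * D := by
      have h1 : 3 / 4 ≤ s * (1 + s) := by nlinarith
      have h2 := mul_le_mul_of_nonneg_right h1 he0.le
      linarith
    obtain ⟨D', hD'⟩ : ∃ D', D' = 1 / 2 + 2 * D / 3 := ⟨_, rfl⟩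
    obtain ⟨θ, hθ⟩ : ∃ θ, θ = 8 / 9 * D' / D := ⟨_, rfl⟩
    have hθD : θ * (1 + 1 / 8) * D = D' := by rw [hθ]; field_simp; ring
    have hD'1 : D' < 1 := by rw [hD']; linarith
    have hD'D : 9 / 8 * D < D' := by rw [hD']; linarith
    have hθ1 : 1 < θ := by
      by_contra hc
      push Not at hc
      have := mul_le_mul_of_nonneg_right hc hD0.le
      linarith
    have hpar := param_large hD0 hD34 he' hD' hθ
    have hR' : 16 * D / (1 - 4 / 3 * D) ≤ R := by
      refine le_trans (le_of_eq ?_) (hRmono (4 / 3) (by norm_num) hξ43)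
      ring
    have hfin : D * (2 + 16 * D / (1 - 4 / 3 * D)) ≤ D * (2 + R) := by gcongr
    -- The least admissible ω is 1/((θ - 1)(1 + s)). If it exceeds one, then 1 + s < 1/(θ - 1), and
    -- the bound with θ = ω = 1 is even smaller.
    rcases le_or_gt 1 ((θ - 1) * (1 + s)) with hω | hω
    · have hω0 : 0 < (θ - 1) * (1 + s) := by linarith
      have h := o.hasRenyiBound_normalized P I hT hK hcard hI (θ := θ) (η := 1 / 8)
        (ω := 1 / ((θ - 1) * (1 + s))) hν hs0 hD he (by norm_num) (by rw [hθD]; exact hD'1)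
        (by positivity) (by rw [div_le_one hω0]; exact hω) (Or.inr ⟨hθ1, by
          rw [one_div_mul_cancel hω0.ne']⟩)
      refine h.mono (mul_le_mul_of_nonneg_left (le_trans (le_of_eq ?_) (hpar.trans hfin))
        (by positivity))
      rw [hθD]
      have h1 : (1 + s) * (1 / ((θ - 1) * (1 + s))) = 1 / (θ - 1) := by
        have : 1 + s ≠ 0 := by positivity
        have : θ - 1 ≠ 0 := by linarith
        field_simp
      rw [h1]
      norm_num
    · have h := o.hasRenyiBound_normalized P I hT hK hcard hI (θ := 1) (η := 1 / 8)
        (ω := 1) hν hs0 hD he (by norm_num) (by linarith)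
        (by norm_num) le_rfl (Or.inl ⟨rfl, rfl⟩)
      refine h.mono (mul_le_mul_of_nonneg_left (le_trans ?_ (hpar.trans hfin)) (by positivity))
      have hθ0 : 0 < θ - 1 := by linarith
      have h1 : 1 + s ≤ 1 / (θ - 1) := by
        rw [le_div_iff₀ hθ0]; linarith
      have h2 : -Real.log (1 - 1 * (1 + 1 / 8) * D) ≤ -Real.log (1 - D') :=
        neg_le_neg (Real.log_le_log (by linarith) (by linarith))
      have h3 : 1 * D * (1 + 1 / (1 / 8)) * (11 / 12) * e ≤ θ * D * 9 * (11 / 12) * e := by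
        have h4 : 0 ≤ D * e := by positivity
        nlinarith
      have h0 : 0 ≤ -Real.log (1 - D') := by
        rw [neg_nonneg]; exact Real.log_nonpos (by linarith) (by linarith)
      rw [mul_one]
      refine mul_le_mul h1 (add_le_add h2 h3) (add_nonneg ?_ (by positivity)) (by positivity)
      rw [neg_nonneg]; exact Real.log_nonpos (by linarith) (by linarith)
  · have hη : 0 < (1 - D) / 4 := by linarith
    have hlt : 1 * (1 + (1 - D) / 4) * D < 1 := by nlinarith
    have hW : (1 + s) * ((5 - D) / (4 - D)) + (5 - D) * (11 / 12) * ((1 + s) * e) ≤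
        (2 + R) * (1 - D) → HasRenyiBound (Measure.pi fun _ : Fin n => P) (whiteNoise d K)
      (fun S v => lik (o.drift I S) v) s (T / 2 * (D * (2 + R))) := fun hpar => by
      refine (o.hasRenyiBound_normalized P I hT hK hcard hI (θ := 1) (η := (1 - D) / 4)
        (ω := 1) hν hs0 hD he hη hlt (by norm_num) le_rfl (Or.inl ⟨rfl, rfl⟩)).mono ?_
      have := param_one hD0 hD1 (by linarith : 0 < 1 + s) hpar
      simp only [mul_one, one_mul]
      gcongr
    rcases le_or_gt (1 / 5) s with hs5 | hs5
    · refine hW (param_medium hD0 hD1 hs5 hs2 he3 ?_)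
      have hξ76 : 7 / 6 ≤ ξ := le_trans (by
        rw [div_le_div_iff₀ (by norm_num) (by linarith)]; linarith) hξge
      refine le_trans ?_ (hRmono (7 / 6) (by norm_num) hξ76)
      gcongr
      · nlinarith
      · nlinarith
    · rcases le_or_gt ((1 + s) * e * (1 + R)) (9 / 2 * D) with hc | hc
      · refine hW (param_small hD0 hD1 hs0 hs5 hc ?_)
        refine le_trans (le_of_eq ?_) (hRmono 1 (by norm_num) hξ1)
        ring
      -- Since D = s(1 + s)me, the failure of the comparison means sm · 9/2 < 1 + R, which is what
      -- the group bound asks for.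
      · obtain ⟨g, hg, hsg, hg92⟩ := exists_group_number hs0 hs5
        refine (o.hasRenyiBound_groups P I hcard hg hs0 hsg).mono ?_
        have hg0 : (0 : ℝ) < g := by exact_mod_cast hg
        have hx : 0 < 1 - s * g := by linarith
        have e1 : (1 + s) * (s / 2 * (s / (1 - s * g) * (K * (m * b) ^ 2) +
            b ^ 2 * (K * (m + m * (m - 1) / g)))) = T / 2 * (D * (1 + s * m *
              (1 / (1 - s * g) + 1 / (s * g)) - 1 / g)) := by
          rw [hKT, hD, hν]; field_simp; ring
        rw [e1]
        have h2 : s * m * (1 / (1 - s * g) + 1 / (s * g)) ≤ s * m * (9 / 2) := by gcongr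
        have h3 : s * m * (9 / 2) ≤ 1 + R := by
          have h4 : 0 < (1 + s) * e := by positivity
          by_contra hcon
          push Not at hcon
          have := mul_lt_mul_of_pos_left hcon h4
          nlinarith
        have h4 : 0 ≤ 1 / (g : ℝ) := by positivity
        gcongr
        linarith

/-- The Rényi divergence bound for every admissible `l`. -/
theorem hasRenyiBound (o : PathField 𝒳 d K b) (P : Measure 𝒳) [IsProbabilityMeasure P]
    (I : Fin K → Finset (Fin n)) {T E m : ℕ} (hT : 0 < T) (hE : 0 < E) (hm : 0 < m) (hb : 0 < b)
    (hK : K = E * T) (hcard : ∀ k, (I k).card = m)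
    (hI : ∀ k k' : Fin K, k ≠ k' → k.val / T = k'.val / T → Disjoint (I k) (I k'))
    {ν l : ℝ} (hν : ν = m * b ^ 2) (hl : 0 < l) (hlr : l < rNu ν) :
    HasRenyiBound (Measure.pi fun _ : Fin n => P) (whiteNoise d K)
      (fun S v => lik (o.drift I S) v) (l / E)
      (T * (1 / 2 * l * ν + bernsteinF ν ((l + l ^ 2) / 2))) := by
  have hm0 : (0 : ℝ) < m := by exact_mod_cast hm
  have hν0 : 0 < ν := by rw [hν]; positivity
  have hlν := add_sq_mul_lt_one_of_lt_rNu hν0 hl hlr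
  by_cases hE1 : E = 1
  · subst hE1
    rw [one_mul] at hK
    subst hK
    have hx : (1 + l) * l * (m * b ^ 2) = ν * (l + l ^ 2) := by rw [hν]; ring
    have hx0 : 0 ≤ ν * (l + l ^ 2) := by positivity
    -- With one epoch all steps have quotient zero, so all batches are disjoint.
    have h := o.hasRenyiBound_single_epoch P I hcard (fun k k' h => hI k k' h (by
      rw [Nat.div_eq_of_lt k.isLt, Nat.div_eq_of_lt k'.isLt])) hl.le (by rw [hx]; exact hlν)
    rw [Nat.cast_one, div_one]
    refine h.mono ?_
    rw [hx, half_mul_add_bernsteinF hlν]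
    have h1 := neg_log_one_sub_le_div hx0 hlν
    have h2 : ν * (l + l ^ 2) / (1 - ν * (l + l ^ 2)) ≤
        l * ν * (2 + l) + 9 * (ν * (l + l ^ 2)) ^ 2 / (1 - ν * (l + l ^ 2)) := by
      have h3 : ν * (l + l ^ 2) ≤ l * ν * (2 + l) := by nlinarith [mul_pos hl hν0]
      have h4 : 0 < 1 - ν * (l + l ^ 2) := by linarith
      rw [← sub_nonneg]
      have : l * ν * (2 + l) + 9 * (ν * (l + l ^ 2)) ^ 2 / (1 - ν * (l + l ^ 2)) -
          ν * (l + l ^ 2) / (1 - ν * (l + l ^ 2)) =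
          (l * ν * (2 + l) - ν * (l + l ^ 2)) + 8 * (ν * (l + l ^ 2)) ^ 2 / (1 - ν * (l + l ^ 2)) := by
        generalize ν * (l + l ^ 2) = a at h4
        field_simp
        ring
      rw [this]
      have h5 : 0 ≤ 8 * (ν * (l + l ^ 2)) ^ 2 / (1 - ν * (l + l ^ 2)) := by positivity
      linarith
    have hT0 : (0 : ℝ) ≤ K := Nat.cast_nonneg K
    nlinarith
  · have hE2 : 2 ≤ E := by omega
    have h := o.hasRenyiBound_of_two_le P I hT hE2 hm hb hK hcard hI hν hl hlν rfl rfl rfl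
    refine h.mono ?_
    have h1 := target_le (E := E) (by exact_mod_cast hE2) hν0 hl hlν rfl rfl rfl
    have hT0 : (0 : ℝ) ≤ T := Nat.cast_nonneg T
    have h2 := mul_le_mul_of_nonneg_left h1 hT0
    refine le_trans (le_of_eq ?_) h2
    ring

end PathField

/-! ### The explicit bound on κ -/

theorem rNu_pos {ν : ℝ} (hν : 0 < ν) : 0 < rNu ν := by
  unfold rNu
  rw [sub_pos, Real.lt_sqrt (by norm_num)]
  have : 0 < 1 / ν := by positivity
  linarith

theorem mul_rNu_add_sq {ν : ℝ} (hν : 0 < ν) : ν * (rNu ν + rNu ν ^ 2) = 1 := by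
  have h : (rNu ν + 1 / 2) ^ 2 = 1 / ν + 1 / 4 := by
    unfold rNu
    rw [sub_add_cancel, Real.sq_sqrt (by positivity)]
  have h2 : rNu ν + rNu ν ^ 2 = 1 / ν := by linarith
  rw [h2]; field_simp

theorem mul_rNu_le {ν : ℝ} (hν : 0 < ν) : ν * rNu ν ≤ √ν := by
  have h := mul_rNu_add_sq hν
  have h0 := rNu_pos hν
  refine Real.le_sqrt_of_sq_le ?_
  nlinarith [mul_pos hν h0]

theorem bernsteinF_nonneg {ν l : ℝ} (hν : 0 < ν) (hl : 0 < l) (h : l < rNu ν) :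
    0 ≤ bernsteinF ν ((l + l ^ 2) / 2) := by
  have h1 := add_sq_mul_lt_one_of_lt_rNu hν hl h
  unfold bernsteinF
  refine div_nonneg (by positivity) ?_
  linarith

/-- As ν(r + r²) = 1 for r = r_ν, at l = τr the number a = ν(l + l²)/2 satisfies 2a ≤ τ, which keeps
the denominator above 1 - τ. Moreover a/l = (ν + τνr)/2 with νr ≤ √ν. -/
theorem bernsteinF_div_le {ν τ : ℝ} (hν : 0 < ν) (hτ : 0 < τ) (hτ1 : τ < 1) :
    1 / (τ * rNu ν) * bernsteinF ν ((τ * rNu ν + (τ * rNu ν) ^ 2) / 2) ≤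
      1 / 2 * (ν + τ * √ν) * ((1 + 8 * τ) / (1 - τ)) := by
  have hr := rNu_pos hν
  have h1 := mul_rNu_add_sq hν
  have h2 := mul_rNu_le hν
  generalize rNu ν = r at hr h1 h2
  obtain ⟨a, ha⟩ : ∃ a, a = ν * (τ * r + (τ * r) ^ 2) / 2 := ⟨_, rfl⟩
  have ha0 : 0 ≤ a := by rw [ha]; positivity
  have haτ : 2 * a ≤ τ := by
    have h3 : 2 * a = τ * (ν * (r + τ * r ^ 2)) := by rw [ha]; ring
    have h4 : ν * (r + τ * r ^ 2) ≤ 1 := by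
      rw [← h1]; gcongr; nlinarith [sq_nonneg r]
    rw [h3]; nlinarith
  have e1 : bernsteinF ν ((τ * r + (τ * r) ^ 2) / 2) = a * ((1 + 16 * a) / (1 - 2 * a)) := by
    unfold bernsteinF
    rw [← mul_div_assoc]
    rw [ha]; ring
  have e2 : 1 / (τ * r) * (a * ((1 + 16 * a) / (1 - 2 * a))) =
      1 / 2 * (ν + τ * (ν * r)) * ((1 + 16 * a) / (1 - 2 * a)) := by
    have : 1 / (τ * r) * a = 1 / 2 * (ν + τ * (ν * r)) := by rw [ha]; field_simp
    rw [← mul_assoc, this]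
  rw [e1, e2]
  have h5 : 0 < 1 - τ := by linarith
  have h6 : (1 + 16 * a) / (1 - 2 * a) ≤ (1 + 8 * τ) / (1 - τ) :=
    div_le_div₀ (by positivity) (by linarith) h5 (by linarith)
  have h7 : 0 ≤ (1 + 16 * a) / (1 - 2 * a) := div_nonneg (by positivity) (by linarith)
  exact mul_le_mul (by gcongr) h6 h7 (by positivity)

theorem inv_rNu_le {ν : ℝ} (hν : 0 < ν) : 1 / rNu ν ≤ ν + √ν := by
  have hr := rNu_pos hν
  have h1 := mul_rNu_add_sq hν
  have h2 := mul_rNu_le hν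
  rw [div_le_iff₀ hr, ← h1]
  nlinarith

/-- The value of the objective at a convenient point. -/
theorem exists_kappa_le {ν T L q : ℝ} (hν : 0 < ν) (hT : 0 < T) (hq : 0 < q)
    (hL : L = T * q ^ 2 / 2) : ∃ l, 0 < l ∧ l < rNu ν ∧
      1 / 2 * T * ν + 1 / l * (T * bernsteinF ν ((l + l ^ 2) / 2) + L) ≤
        T * ν * (1 + 3 * q + 1 / 2 * q ^ 2) + T * √ν * (1 / 2 + 3 * q + 1 / 2 * q ^ 2) := by
  have hr := rNu_pos hν
  have hτ : 0 < q / (3 + q) := by positivity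
  have hτ1 : q / (3 + q) < 1 := by rw [div_lt_one (by positivity)]; linarith
  -- For τ = q/(3 + q) the factor (1 + 8τ)/(1 - τ) is exactly 1 + 3q, and q²/(2τ) = q²/2 + 3q/2.
  refine ⟨q / (3 + q) * rNu ν, by positivity, by nlinarith, ?_⟩
  have h1 := bernsteinF_div_le hν hτ hτ1
  have e1 : (1 + 8 * (q / (3 + q))) / (1 - q / (3 + q)) = 1 + 3 * q := by
    field_simp; ring
  rw [e1] at h1
  have h2 : 1 / (q / (3 + q) * rNu ν) * L ≤ T * (1 / 2 * q ^ 2 + 3 / 2 * q) * (ν + √ν) := by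
    have h3 := inv_rNu_le hν
    have e2 : 1 / (q / (3 + q) * rNu ν) * L =
        T * (1 / 2 * q ^ 2 + 3 / 2 * q) * (1 / rNu ν) := by
      rw [hL]; field_simp; ring
    rw [e2]; gcongr
  generalize 1 / (q / (3 + q) * rNu ν) = y at h1 h2 ⊢
  generalize bernsteinF ν ((q / (3 + q) * rNu ν + (q / (3 + q) * rNu ν) ^ 2) / 2) = F at h1 ⊢
  have h4 : 1 / 2 * (ν + q / (3 + q) * √ν) * (1 + 3 * q) ≤ 1 / 2 * (ν + 1 * √ν) * (1 + 3 * q) := by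
    gcongr
  have h5 := mul_le_mul_of_nonneg_left (h1.trans h4) hT.le
  calc _ = 1 / 2 * T * ν + T * (y * F) + y * L := by ring
    _ ≤ 1 / 2 * T * ν + T * (1 / 2 * (ν + 1 * √ν) * (1 + 3 * q)) +
        T * (1 / 2 * q ^ 2 + 3 / 2 * q) * (ν + √ν) := by gcongr
    _ = _ := by ring

namespace DPSGD

variable {𝒳 𝒲 𝒮 : Type*} [MeasurableSpace 𝒳] [MeasurableSpace 𝒲] [MeasurableSpace 𝒮] {d n : ℕ}

theorem ν_pos (A : DPSGD 𝒳 𝒲 𝒮 d n) : 0 < A.ν := by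
  have := A.ζ_pos
  have := A.σ_pos
  have : (0 : ℝ) < A.m := by exact_mod_cast A.m_pos
  unfold ν
  positivity

theorem log_two_mul_div_pos (A : DPSGD 𝒳 𝒲 𝒮 d n) {δ : ℝ} (hδ : δ ∈ Set.Ioo (0 : ℝ) 1) :
    0 < Real.log (2 * A.E / δ) := by
  have hE : (1 : ℝ) ≤ A.E := by exact_mod_cast A.E_pos
  refine Real.log_pos ?_
  rw [lt_div_iff₀ hδ.1]
  linarith [hδ.2]

theorem bddBelow_kappa (A : DPSGD 𝒳 𝒲 𝒮 d n) {δ : ℝ} (hδ : δ ∈ Set.Ioo (0 : ℝ) 1) :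
    BddBelow ((fun l : ℝ => 1 / l * (A.T * bernsteinF A.ν ((l + l ^ 2) / 2) +
      Real.log (2 * A.E / δ))) '' Set.Ioo 0 (rNu A.ν)) := by
  refine ⟨0, ?_⟩
  rintro _ ⟨l, hl, rfl⟩
  have h1 := bernsteinF_nonneg A.ν_pos hl.1 hl.2
  have h2 := A.log_two_mul_div_pos hδ
  have := hl.1
  positivity

theorem kappa_le (A : DPSGD 𝒳 𝒲 𝒮 d n) {δ : ℝ} (hδ : δ ∈ Set.Ioo (0 : ℝ) 1) :
    A.kappa δ ≤ A.kappaExplicit δ := by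
  have hE : (0 : ℝ) < A.E := by exact_mod_cast A.E_pos
  have hT : (0 : ℝ) < A.T := by exact_mod_cast A.T_pos
  have hL := A.log_two_mul_div_pos hδ
  have hq : 0 < A.q δ := Real.sqrt_pos.2 (by positivity)
  have hq2 : A.q δ ^ 2 = 2 / A.T * Real.log (2 * A.E / δ) := Real.sq_sqrt (by positivity)
  obtain ⟨l, hl0, hlr, hl⟩ := exists_kappa_le (L := Real.log (2 * A.E / δ)) A.ν_pos hT hq
    (by rw [hq2]; field_simp)
  have h := csInf_le (A.bddBelow_kappa hδ) ⟨l, ⟨hl0, hlr⟩, rfl⟩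
  have hν : √A.ν = √A.m * (A.ζ / A.σ) := by
    have := A.ζ_pos
    have := A.σ_pos
    rw [ν, Real.sqrt_mul (by positivity), ← div_pow, Real.sqrt_sq (by positivity)]
  rw [hν] at hl
  unfold kappa kappaExplicit
  have h2 := mul_le_mul_of_nonneg_left h hE.le
  have h3 := mul_le_mul_of_nonneg_left hl hE.le
  calc _ ≤ 1 / 2 * A.E * A.T * A.ν + _ := add_le_add le_rfl h2
    _ = A.E * (1 / 2 * A.T * A.ν + 1 / l * (A.T * bernsteinF A.ν ((l + l ^ 2) / 2) +
        Real.log (2 * A.E / δ))) := by ring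
    _ ≤ _ := h3
    _ = _ := by
      have : A.ν = A.m * (A.ζ ^ 2 / A.σ ^ 2) := rfl
      rw [this]; ring

theorem exists_lt_kappa_add (A : DPSGD 𝒳 𝒲 𝒮 d n) (δ : ℝ) {ε : ℝ} (hε : 0 < ε) :
    ∃ l, 0 < l ∧ l < rNu A.ν ∧ 1 / 2 * A.E * A.T * A.ν + A.E * (1 / l *
      (A.T * bernsteinF A.ν ((l + l ^ 2) / 2) + Real.log (2 * A.E / δ))) < A.kappa δ + ε := by
  have hE : (0 : ℝ) < A.E := by exact_mod_cast A.E_pos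
  have hne : (Set.Ioo 0 (rNu A.ν)).Nonempty := Set.nonempty_Ioo.2 (rNu_pos A.ν_pos)
  obtain ⟨_, ⟨l, hl, rfl⟩, h⟩ := Real.lt_sInf_add_pos (hne.image (fun l : ℝ => 1 / l *
      (A.T * bernsteinF A.ν ((l + l ^ 2) / 2) + Real.log (2 * A.E / δ)))) (div_pos hε hE)
  refine ⟨l, hl.1, hl.2, ?_⟩
  have h2 := mul_lt_mul_of_pos_left h hE
  rw [mul_add, mul_div_cancel₀ _ hE.ne'] at h2
  unfold kappa
  linarith

end DPSGD

/-! ### The constant 2√n in Maurer's bound -/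

/-- `C(2k,k) / 4^k`. -/
noncomputable def centralProb (k : ℕ) : ℝ := k.centralBinom / 4 ^ k

theorem centralProb_pos (k : ℕ) : 0 < centralProb k := by
  have := Nat.centralBinom_pos k
  unfold centralProb
  positivity

theorem succ_mul_centralProb_succ (k : ℕ) :
    ((k : ℝ) + 1) * centralProb (k + 1) = (k + 1 / 2) * centralProb k := by
  have h : ((k : ℝ) + 1) * (k + 1).centralBinom = 2 * (2 * k + 1) * k.centralBinom := by
    exact_mod_cast Nat.succ_mul_centralBinom_succ k
  unfold centralProb
  rw [mul_div_assoc', h, pow_succ]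
  field_simp
  ring

/-- These are the coefficients of (1 - x)^(-1/2), and those of its square are all one. The induction
replaces the series: the sum weighted with the first index is symmetrized, and the recursion lowers
n. -/
theorem sum_antidiagonal_centralProb (n : ℕ) :
    ∑ p ∈ Finset.HasAntidiagonal.antidiagonal n, centralProb p.1 * centralProb p.2 = 1 := by
  induction n with
  | zero => simp [centralProb]
  | succ n ih =>
    have hn : (0 : ℝ) < n + 1 := by positivity
    have hsymm : ∀ (n : ℕ) (f : ℕ → ℕ → ℝ), ∑ p ∈ Finset.HasAntidiagonal.antidiagonal n, f p.1 p.2 =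
        ∑ p ∈ Finset.HasAntidiagonal.antidiagonal n, f p.2 p.1 := fun n f => by
      rw [← Finset.Nat.sum_antidiagonal_swap (n := n) (f := fun p => f p.1 p.2)]
      rfl
    have h1 : ((n : ℝ) + 1) * ∑ p ∈ Finset.HasAntidiagonal.antidiagonal (n + 1), centralProb p.1 * centralProb p.2 =
        2 * ∑ p ∈ Finset.HasAntidiagonal.antidiagonal (n + 1), (p.1 : ℝ) * centralProb p.1 * centralProb p.2 := by
      rw [two_mul]
      nth_rewrite 2 [hsymm (n + 1) fun a b => (a : ℝ) * centralProb a * centralProb b]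
      rw [← Finset.sum_add_distrib, Finset.mul_sum]
      refine Finset.sum_congr rfl fun p hp => ?_
      have : (p.1 : ℝ) + p.2 = n + 1 := by exact_mod_cast Finset.HasAntidiagonal.mem_antidiagonal.1 hp
      rw [← this]; ring
    have h2 : ∑ p ∈ Finset.HasAntidiagonal.antidiagonal (n + 1), (p.1 : ℝ) * centralProb p.1 * centralProb p.2 =
        ∑ p ∈ Finset.HasAntidiagonal.antidiagonal n, ((p.1 : ℝ) + 1 / 2) * (centralProb p.1 * centralProb p.2) := by
      rw [Finset.Nat.sum_antidiagonal_succ]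
      simp only [Nat.cast_zero, zero_mul, zero_add]
      refine Finset.sum_congr rfl fun p _ => ?_
      push_cast
      rw [succ_mul_centralProb_succ, mul_assoc]
    have h3 : 2 * ∑ p ∈ Finset.HasAntidiagonal.antidiagonal n,
        ((p.1 : ℝ) + 1 / 2) * (centralProb p.1 * centralProb p.2) = (n + 1) *
          ∑ p ∈ Finset.HasAntidiagonal.antidiagonal n, centralProb p.1 * centralProb p.2 := by
      rw [two_mul]
      nth_rewrite 2 [hsymm n fun a b => ((a : ℝ) + 1 / 2) * (centralProb a * centralProb b)]
      rw [← Finset.sum_add_distrib, Finset.mul_sum]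
      refine Finset.sum_congr rfl fun p hp => ?_
      have : (p.1 : ℝ) + p.2 = n := by exact_mod_cast Finset.HasAntidiagonal.mem_antidiagonal.1 hp
      rw [← this]; ring
    rw [h2, h3, ih] at h1
    exact mul_left_cancel₀ hn.ne' h1

/-- 4n c_n² increases in n and equals one at n = 1, where c is `centralProb`. -/
theorem one_le_two_mul_sqrt_mul_centralProb {n : ℕ} (hn : 1 ≤ n) :
    1 ≤ 2 * √(n : ℝ) * centralProb n := by
  have h : 1 ≤ 4 * (n : ℝ) * centralProb n ^ 2 := by
    induction n, hn using Nat.le_induction with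
    | base => norm_num [centralProb, Nat.centralBinom, Nat.choose]
    | succ n hn ih =>
      have h := succ_mul_centralProb_succ n
      have hn0 : (0 : ℝ) < n := by exact_mod_cast hn
      have h1 : centralProb (n + 1) = (n + 1 / 2) / (n + 1) * centralProb n := by
        field_simp at h ⊢; linarith
      rw [h1]
      push_cast
      have h2 : 4 * ((n : ℝ) + 1) * ((n + 1 / 2) / (n + 1) * centralProb n) ^ 2 =
          (4 * n * centralProb n ^ 2) * ((n + 1 / 2) ^ 2 / (n * (n + 1))) := by
        field_simp
      rw [h2]
      have h3 : 1 ≤ ((n : ℝ) + 1 / 2) ^ 2 / (n * (n + 1)) := by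
        rw [le_div_iff₀ (by positivity)]; nlinarith
      nlinarith
  have h0 := centralProb_pos n
  have h1 : (2 * √(n : ℝ) * centralProb n) ^ 2 = 4 * (n : ℝ) * centralProb n ^ 2 := by
    rw [mul_pow, mul_pow, Real.sq_sqrt (by positivity)]; ring
  rw [← h1] at h
  exact (one_le_sq_iff₀ (by positivity)).1 h

/-- The ratio of consecutive values of `C(2k,k) k! / (4k)^k`. -/
noncomputable def stirlingRatio (x : ℝ) : ℝ := (2 * x + 1) / (2 * x + 2) * (x / (x + 1)) ^ x

/-- After taking logarithms the derivative is 2/(2x + 1) - log(1 + 1/x), which is not positive. -/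
theorem stirlingRatio_antitone : AntitoneOn stirlingRatio (Set.Ioi 0) := by
  have hlog : AntitoneOn (fun x : ℝ => Real.log (2 * x + 1) - Real.log (2 * x + 2) +
      x * (Real.log x - Real.log (x + 1))) (Set.Ioi 0) := by
    have hd : ∀ x ∈ Set.Ioi (0 : ℝ), HasDerivAt (fun x : ℝ => Real.log (2 * x + 1) -
        Real.log (2 * x + 2) + x * (Real.log x - Real.log (x + 1)))
        (2 / (2 * x + 1) - 2 / (2 * x + 2) + (1 * (Real.log x - Real.log (x + 1)) +
          x * (1 / x - 1 / (x + 1)))) x := fun x hx => by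
      have hx' : 0 < x := hx
      have e : ∀ c, HasDerivAt (fun x : ℝ => 2 * x + c) 2 x := fun c => by
        simpa using ((hasDerivAt_id x).const_mul 2).add_const c
      exact (((e 1).log (by positivity)).sub ((e 2).log (by positivity))).add
        ((hasDerivAt_id x).mul (((hasDerivAt_id x).log hx'.ne').sub
          (((hasDerivAt_id x).add_const 1).log (by simp; positivity))))
    refine antitoneOn_of_deriv_nonpos (convex_Ioi 0)
      (fun x hx => (hd x hx).continuousAt.continuousWithinAt)
      (fun x hx => (hd x (interior_subset hx)).differentiableAt.differentiableWithinAt)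
      fun x hx => ?_
    have hx' : 0 < x := interior_subset hx
    rw [(hd x hx').deriv]
    have h := Real.le_log_one_add_of_nonneg (x := 1 / x) (by positivity)
    have h2 : Real.log (1 + 1 / x) = Real.log (x + 1) - Real.log x := by
      rw [← Real.log_div (by positivity) (by positivity)]
      congr 1; field_simp
    rw [h2] at h
    have h3 : 2 * (1 / x) / (1 / x + 2) = 2 / (2 * x + 1) := by field_simp; ring
    have h4 : 2 / (2 * x + 2) = 1 / (x + 1) := by field_simp
    have h5 : x * (1 / x - 1 / (x + 1)) = 1 / (x + 1) := by field_simp; ring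
    rw [h3] at h
    rw [h4, h5]
    linarith
  have he : ∀ x ∈ Set.Ioi (0 : ℝ), stirlingRatio x = Real.exp (Real.log (2 * x + 1) -
      Real.log (2 * x + 2) + x * (Real.log x - Real.log (x + 1))) := fun x hx => by
    have hx' : 0 < x := hx
    rw [Real.exp_add, Real.exp_sub, Real.exp_log (by positivity), Real.exp_log (by positivity),
      ← Real.log_div hx'.ne' (by positivity), mul_comm x, ← Real.rpow_def_of_pos (by positivity)]
    rfl
  intro x hx y hy hxy
  rw [he x hx, he y hy]
  exact Real.exp_le_exp.2 (hlog hx hy hxy)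

/-- `k^k / k!`. -/
noncomputable def powDivFact (k : ℕ) : ℝ := (k : ℝ) ^ k / k.factorial

theorem powDivFact_pos (k : ℕ) : 0 < powDivFact k := by
  unfold powDivFact
  rcases Nat.eq_zero_or_pos k with rfl | h
  · simp
  · positivity

theorem centralProb_div_powDivFact_succ (k : ℕ) :
    centralProb (k + 1) / powDivFact (k + 1) =
      stirlingRatio k * (centralProb k / powDivFact k) := by
  have h := succ_mul_centralProb_succ k
  have h1 : centralProb (k + 1) = (2 * k + 1) / (2 * k + 2) * centralProb k := by
    field_simp at h ⊢; linarith
  have h2 := powDivFact_pos k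
  have h3 : powDivFact (k + 1) * ((k : ℝ) / (k + 1)) ^ k = powDivFact k := by
    unfold powDivFact
    rw [Nat.factorial_succ, div_pow]
    push_cast
    field_simp
    ring
  rw [stirlingRatio, Real.rpow_natCast, h1, ← h3]
  have h4 := powDivFact_pos (k + 1)
  have h5 : ((k : ℝ) / (k + 1)) ^ k ≠ 0 := fun h => by rw [h, mul_zero] at h3; linarith
  field_simp

theorem stirlingRatio_natCast_antitone : Antitone fun k : ℕ => stirlingRatio k := by
  refine antitone_nat_of_succ_le fun k => ?_
  rcases Nat.eq_zero_or_pos k with rfl | h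
  -- At zero the convention 0 ^ 0 = 1 gives the value 1/2, against 3/8 at one.
  · norm_num [stirlingRatio]
  · exact stirlingRatio_antitone (by simpa using h) (by simp; positivity) (by simp)

/-- The sequence starts at one and its consecutive ratios decrease, hence it is submultiplicative.
-/
theorem centralProb_div_powDivFact_mul_le (k j : ℕ) :
    centralProb (k + j) / powDivFact (k + j) ≤
      centralProb k / powDivFact k * (centralProb j / powDivFact j) := by
  induction k with
  | zero => simp [centralProb, powDivFact]
  | succ k ih =>
    have e : k + 1 + j = k + j + 1 := by omega
    rw [e, centralProb_div_powDivFact_succ, centralProb_div_powDivFact_succ, mul_assoc]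
    have h0 : 0 < centralProb (k + j) / powDivFact (k + j) :=
      div_pos (centralProb_pos _) (powDivFact_pos _)
    have h1 : 0 ≤ stirlingRatio k := by unfold stirlingRatio; positivity
    have h2 : stirlingRatio (k + j : ℕ) ≤ stirlingRatio k :=
      stirlingRatio_natCast_antitone (by omega)
    exact mul_le_mul h2 ih h0.le h1

/-- The expected inverse likelihood of a binomial variable. -/
theorem sum_choose_mul_pow_le {n : ℕ} (hn : 1 ≤ n) :
    ∑ k ∈ Finset.range (n + 1), (n.choose k : ℝ) * ((k / n : ℝ) ^ k * (1 - k / n : ℝ) ^ (n - k)) ≤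
      2 * √(n : ℝ) := by
  have hn0 : (0 : ℝ) < n := by exact_mod_cast hn
  -- With p = `powDivFact`, c = `centralProb` and j = n - k, the term is p_k p_j / p_n.
  -- Submultiplicativity of c/p and 1 ≤ 2√n c_n bound it by 2√n c_k c_j, and these products sum to
  -- 2√n.
  have hterm : ∀ k ∈ Finset.range (n + 1),
      (n.choose k : ℝ) * ((k / n : ℝ) ^ k * (1 - k / n : ℝ) ^ (n - k)) ≤
        2 * √(n : ℝ) * (centralProb k * centralProb (n - k)) := by
    intro k hk
    have hkn : k ≤ n := by simpa [Nat.lt_succ_iff] using hk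
    obtain ⟨j, rfl⟩ := Nat.exists_eq_add_of_le hkn
    rw [Nat.add_sub_cancel_left]
    have e : ((k + j).choose k : ℝ) * ((k / (k + j : ℕ) : ℝ) ^ k *
        (1 - k / (k + j : ℕ) : ℝ) ^ j) = powDivFact k * powDivFact j / powDivFact (k + j) := by
      have h1 : (1 - k / (k + j : ℕ) : ℝ) = j / (k + j : ℕ) := by
        field_simp; push_cast; ring
      rw [h1, Nat.cast_add_choose, div_pow, div_pow]
      unfold powDivFact
      push_cast
      push_cast at hn0
      rw [pow_add]
      field_simp
    rw [e]
    have h2 := centralProb_div_powDivFact_mul_le k j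
    have h3 := one_le_two_mul_sqrt_mul_centralProb hn
    have p1 := powDivFact_pos k
    have p2 := powDivFact_pos j
    have p3 := powDivFact_pos (k + j)
    calc powDivFact k * powDivFact j / powDivFact (k + j)
        ≤ powDivFact k * powDivFact j / powDivFact (k + j) *
          (2 * √((k + j : ℕ) : ℝ) * centralProb (k + j)) := le_mul_of_one_le_right (by positivity) h3
      _ = 2 * √((k + j : ℕ) : ℝ) * (powDivFact k * powDivFact j) *
          (centralProb (k + j) / powDivFact (k + j)) := by ring
      _ ≤ 2 * √((k + j : ℕ) : ℝ) * (powDivFact k * powDivFact j) *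
          (centralProb k / powDivFact k * (centralProb j / powDivFact j)) := by gcongr
      _ = _ := by field_simp
  refine (Finset.sum_le_sum hterm).trans (le_of_eq ?_)
  rw [← Finset.mul_sum, ← Finset.Nat.sum_antidiagonal_eq_sum_range_succ
    (fun a b => centralProb a * centralProb b), sum_antidiagonal_centralProb, mul_one]

/-! ### Maurer's bound on the exponential moment of kl -/

open scoped Classical in
/-- `exp (n * klBer a p)`. -/
noncomputable def expKl (n : ℕ) (a p : ℝ) : ℝ≥0∞ :=
  if (p = 0 ∧ a ≠ 0) ∨ (p = 1 ∧ a ≠ 1) then ∞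
  else ENNReal.ofReal (Real.exp
    (n * (a * Real.log (a / p) + (1 - a) * Real.log ((1 - a) / (1 - p)))))

theorem measurable_expKl (n : ℕ) : Measurable fun x : ℝ × ℝ => expKl n x.1 x.2 := by
  unfold expKl
  refine Measurable.ite ?_ measurable_const (by fun_prop)
  have h1 : MeasurableSet {x : ℝ × ℝ | x.2 = 0} := measurableSet_eq_fun (by fun_prop) (by fun_prop)
  have h2 : MeasurableSet {x : ℝ × ℝ | x.1 = 0} := measurableSet_eq_fun (by fun_prop) (by fun_prop)
  have h3 : MeasurableSet {x : ℝ × ℝ | x.2 = 1} := measurableSet_eq_fun (by fun_prop) (by fun_prop)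
  have h4 : MeasurableSet {x : ℝ × ℝ | x.1 = 1} := measurableSet_eq_fun (by fun_prop) (by fun_prop)
  exact (h1.inter h2.compl).union (h3.inter h4.compl)

theorem expKl_one_sub (n : ℕ) (a p : ℝ) : expKl n (1 - a) (1 - p) = expKl n a p := by
  unfold expKl
  have h1 : (1 - p = 0 ∧ 1 - a ≠ 0 ∨ 1 - p = 1 ∧ 1 - a ≠ 1) ↔ (p = 0 ∧ a ≠ 0 ∨ p = 1 ∧ a ≠ 1) := by
    have e1 : ∀ x : ℝ, 1 - x = 0 ↔ x = 1 := fun x => by constructor <;> intro h <;> linarith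
    have e2 : ∀ x : ℝ, 1 - x = 1 ↔ x = 0 := fun x => by constructor <;> intro h <;> linarith
    simp only [ne_eq, e1, e2]
    tauto
  simp only [h1, sub_sub_cancel]
  rw [add_comm ((1 - a) * _)]

theorem expKl_zero_zero (n : ℕ) : expKl n 0 0 = 1 := by simp [expKl]

theorem expKl_eq {n : ℕ} {a p : ℝ} (hp : p ∈ Set.Ioo (0 : ℝ) 1) :
    expKl n a p = ENNReal.ofReal (Real.exp
      (n * (-Real.binEntropy a + a * (-Real.log p) + (1 - a) * (-Real.log (1 - p))))) := by
  unfold expKl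
  have h1 : 0 < 1 - p := by linarith [hp.2]
  rw [if_neg (by
    rintro (⟨h, _⟩ | ⟨h, _⟩)
    · exact hp.1.ne' h
    · exact hp.2.ne h)]
  have e : ∀ x q : ℝ, 0 < q → x * Real.log (x / q) = x * Real.log x - x * Real.log q :=
    fun x q hq => by
      by_cases hx : x = 0
      · simp [hx]
      · rw [Real.log_div hx hq.ne']; ring
  rw [e a p hp.1, e _ _ h1, Real.binEntropy, Real.log_inv, Real.log_inv]
  congr 3
  ring

theorem convexOn_exp_neg_binEntropy (n : ℕ) (u v : ℝ) :
    ConvexOn ℝ (Set.Icc 0 1) fun a =>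
      Real.exp (n * (-Real.binEntropy a + a * u + (1 - a) * v)) := by
  have h1 : ConvexOn ℝ (Set.Icc (0 : ℝ) 1) fun a => -Real.binEntropy a :=
    Real.strictConcave_binEntropy.concaveOn.neg
  have h2 : ConvexOn ℝ (Set.Icc (0 : ℝ) 1) fun a : ℝ => a * u + (1 - a) * v :=
    ⟨convex_Icc 0 1, fun x _ y _ s t _ _ hst => le_of_eq (by
      simp only [smul_eq_mul]
      have : t = 1 - s := by linarith
      rw [this]; ring)⟩
  have h3 : ConvexOn ℝ (Set.Icc (0 : ℝ) 1) fun a =>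
      n * (-Real.binEntropy a + a * u + (1 - a) * v) := by
    have := (h1.add h2).smul (Nat.cast_nonneg n : (0 : ℝ) ≤ n)
    refine this.congr fun a _ => ?_
    simp only [Pi.add_apply, smul_eq_mul]
    ring
  exact ⟨h3.1, fun x hx y hy s t hs ht hst => (Real.exp_le_exp.2 (h3.2 hx hy hs ht hst)).trans
    (convexOn_exp.2 (Set.mem_univ _) (Set.mem_univ _) hs ht hst)⟩

/-- The probability that independent coins with biases `x i` show heads exactly on `b`. -/
noncomputable def coinWeight {n : ℕ} (x : Fin n → ℝ) (b : Finset (Fin n)) : ℝ :=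
  ∏ i, if i ∈ b then x i else 1 - x i

theorem coinWeight_nonneg {n : ℕ} {x : Fin n → ℝ} (hx : ∀ i, x i ∈ Set.Icc (0 : ℝ) 1)
    (b : Finset (Fin n)) : 0 ≤ coinWeight x b :=
  Finset.prod_nonneg fun i _ => by
    split_ifs
    · exact (hx i).1
    · linarith [(hx i).2]

theorem sum_prod_ite {n : ℕ} (f g : Fin n → ℝ) :
    ∑ b : Finset (Fin n), ∏ i, (if i ∈ b then f i else g i) = ∏ i, (f i + g i) := by
  rw [Finset.prod_add, Finset.powerset_univ]
  refine Finset.sum_congr rfl fun b _ => ?_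
  rw [Finset.prod_ite]
  congr 1
  · refine Finset.prod_congr ?_ fun _ _ => rfl
    ext i; simp
  · refine Finset.prod_congr ?_ fun _ _ => rfl
    ext i; simp

theorem sum_coinWeight {n : ℕ} (x : Fin n → ℝ) : ∑ b, coinWeight x b = 1 := by
  unfold coinWeight
  rw [sum_prod_ite]
  simp

theorem sum_coinWeight_mul_card {n : ℕ} (x : Fin n → ℝ) :
    ∑ b, coinWeight x b * (b.card : ℝ) = ∑ i, x i := by
  have h1 : ∀ b : Finset (Fin n), (b.card : ℝ) = ∑ i, if i ∈ b then 1 else 0 := fun b => by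
    simp
  have h2 : ∀ i, ∑ b : Finset (Fin n), coinWeight x b * (if i ∈ b then 1 else 0) = x i := by
    intro i
    have e : ∀ b : Finset (Fin n), coinWeight x b * (if i ∈ b then 1 else 0) =
        ∏ j, if j ∈ b then x j else if j = i then 0 else 1 - x j := by
      intro b
      by_cases hb : i ∈ b
      · rw [if_pos hb, mul_one]
        refine Finset.prod_congr rfl fun j _ => ?_
        by_cases hj : j ∈ b
        · simp [hj]
        · have : j ≠ i := fun h => hj (h ▸ hb)
          simp [hj, this]
      · rw [if_neg hb, mul_zero]
        exact (Finset.prod_eq_zero (Finset.mem_univ i) (by simp [hb])).symm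
    simp only [e]
    rw [sum_prod_ite]
    have e2 : ∀ j, x j + (if j = i then 0 else 1 - x j) = if j = i then x j else 1 := fun j => by
      split_ifs <;> ring
    simp only [e2]
    rw [Finset.prod_ite_eq' Finset.univ i]
    simp
  simp only [h1, Finset.mul_sum]
  rw [Finset.sum_comm]
  exact Finset.sum_congr rfl fun i _ => h2 i

theorem exp_natCast_mul_log {x : ℝ} (hx : 0 ≤ x) {k : ℕ} (h : x = 0 → k = 0) :
    Real.exp (k * Real.log x) = x ^ k := by
  rcases hx.eq_or_lt with h0 | h0
  · rw [h h0.symm]; simp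
  · rw [Real.exp_nat_mul, Real.exp_log h0]

/-- exp(n kl(k/n ‖ p)) is the binomial likelihood at the empirical parameter divided by the one at
p. So p cancels, and the moment bound is uniform in p. -/
theorem pow_mul_pow_mul_exp_binEntropy {n k : ℕ} (hn : 1 ≤ n) (hk : k ≤ n) {p : ℝ}
    (hp : p ∈ Set.Ioo (0 : ℝ) 1) :
    p ^ k * (1 - p) ^ (n - k) * Real.exp (n * (-Real.binEntropy (k / n) +
      (k / n : ℝ) * (-Real.log p) + (1 - k / n) * (-Real.log (1 - p)))) =
        (k / n : ℝ) ^ k * (1 - k / n : ℝ) ^ (n - k) := by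
  have hn0 : (0 : ℝ) < n := by exact_mod_cast hn
  have hp1 : 0 < 1 - p := by linarith [hp.2]
  obtain ⟨j, rfl⟩ := Nat.exists_eq_add_of_le hk
  rw [Nat.add_sub_cancel_left]
  have h1 : (1 - k / (k + j : ℕ) : ℝ) = j / (k + j : ℕ) := by
    field_simp; push_cast; ring
  have e1 := exp_natCast_mul_log (x := (k / (k + j : ℕ) : ℝ)) (k := k) (by positivity) fun h => by
    have := (div_eq_zero_iff.1 h).resolve_right hn0.ne'
    exact_mod_cast this
  have e2 := exp_natCast_mul_log (x := (j / (k + j : ℕ) : ℝ)) (k := j) (by positivity) fun h => by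
    have := (div_eq_zero_iff.1 h).resolve_right hn0.ne'
    exact_mod_cast this
  have e3 := exp_natCast_mul_log hp.1.le (k := k) fun h => absurd h hp.1.ne'
  have e4 := exp_natCast_mul_log hp1.le (k := j) fun h => absurd h hp1.ne'
  rw [Real.binEntropy, h1, Real.log_inv, Real.log_inv, ← e1, ← e2, ← e3, ← e4, ← Real.exp_add,
    ← Real.exp_add, ← Real.exp_add]
  congr 1
  generalize Real.log ((k : ℝ) / (k + j : ℕ)) = A
  generalize Real.log ((j : ℝ) / (k + j : ℕ)) = B
  field_simp
  ring

/-- The mean of the `x i` is the expected fraction of heads of independent coins with these biases.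
Jensen's inequality for a convex function of this fraction reduces losses in [0,1] to losses in
{0,1}. -/
theorem exp_mean_le_sum_coinWeight {n : ℕ} (hn : 1 ≤ n) (u v : ℝ) {x : Fin n → ℝ}
    (hx : ∀ i, x i ∈ Set.Icc (0 : ℝ) 1) :
    Real.exp (n * (-Real.binEntropy (1 / n * ∑ i, x i) + (1 / n * ∑ i, x i) * u +
      (1 - 1 / n * ∑ i, x i) * v)) ≤
      ∑ b : Finset (Fin n), coinWeight x b * Real.exp (n * (-Real.binEntropy (b.card / n) +
        (b.card / n : ℝ) * u + (1 - b.card / n) * v)) := by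
  have hn0 : (0 : ℝ) < n := by exact_mod_cast hn
  have h := (convexOn_exp_neg_binEntropy n u v).map_sum_le (t := Finset.univ)
    (w := coinWeight x) (p := fun b : Finset (Fin n) => (b.card / n : ℝ))
    (fun b _ => coinWeight_nonneg hx b) (sum_coinWeight x) (fun b _ => by
      refine ⟨by positivity, ?_⟩
      rw [div_le_one hn0]
      exact_mod_cast (Finset.card_le_univ b).trans_eq (Fintype.card_fin n))
  have e : ∑ b : Finset (Fin n), coinWeight x b • (b.card / n : ℝ) = 1 / n * ∑ i, x i := by
    rw [← sum_coinWeight_mul_card x, Finset.mul_sum]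
    refine Finset.sum_congr rfl fun b _ => ?_
    rw [smul_eq_mul]; ring
  rw [e] at h
  simpa only [smul_eq_mul] using h

section

variable {𝒳 : Type*} [MeasurableSpace 𝒳] (P : Measure 𝒳) [IsProbabilityMeasure P] {f : 𝒳 → ℝ}
  (hf : Measurable f) (hf01 : ∀ x, f x ∈ Set.Icc (0 : ℝ) 1)

include hf hf01

theorem integrable_of_mem_Icc : Integrable f P :=
  integrable_of_abs_le P hf 1 fun x => abs_le.2 ⟨by linarith [(hf01 x).1], (hf01 x).2⟩

theorem integral_mem_Icc : ∫ x, f x ∂P ∈ Set.Icc (0 : ℝ) 1 := by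
  refine ⟨integral_nonneg fun x => (hf01 x).1, ?_⟩
  have h := integral_mono (integrable_of_mem_Icc P hf hf01) (integrable_const 1) fun x => (hf01 x).2
  simpa using h

theorem integral_coinWeight {n : ℕ} (b : Finset (Fin n)) :
    ∫ S : Fin n → 𝒳, coinWeight (fun i => f (S i)) b ∂(Measure.pi fun _ => P) =
      (∫ x, f x ∂P) ^ b.card * (1 - ∫ x, f x ∂P) ^ (n - b.card) := by
  have h1 : ∀ S : Fin n → 𝒳, coinWeight (fun i => f (S i)) b =
      ∏ i, (fun (i : Fin n) (x : 𝒳) => if i ∈ b then f x else 1 - f x) i (S i) := fun S => rfl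
  simp only [h1]
  rw [integral_fintype_prod_eq_prod (fun (i : Fin n) (x : 𝒳) => if i ∈ b then f x else 1 - f x)]
  have h2 : ∀ i : Fin n, ∫ x, (if i ∈ b then f x else 1 - f x) ∂P =
      if i ∈ b then ∫ x, f x ∂P else 1 - ∫ x, f x ∂P := fun i => by
    split_ifs
    · rfl
    · rw [integral_sub (integrable_const 1) (integrable_of_mem_Icc P hf hf01)]
      simp
  simp only [h2]
  rw [Finset.prod_ite]
  simp only [Finset.prod_const]
  congr 2
  · congr 1; ext i; simp
  · have : Finset.univ.filter (fun i => i ∉ b) = bᶜ := by ext i; simp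
    rw [this, Finset.card_compl, Fintype.card_fin]

theorem lintegral_expKl_le_of_eq_zero {n : ℕ} (hp : ∫ x, f x ∂P = 0) :
    ∫⁻ S : Fin n → 𝒳, expKl n (1 / n * ∑ i, f (S i)) (∫ x, f x ∂P) ∂(Measure.pi fun _ => P) ≤ 1 := by
  have h0 : f =ᵐ[P] 0 :=
    (integral_eq_zero_iff_of_nonneg (fun x => (hf01 x).1) (integrable_of_mem_Icc P hf hf01)).1 hp
  have h1 : ∀ᵐ S : Fin n → 𝒳 ∂(Measure.pi fun _ => P), ∀ i, f (S i) = 0 :=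
    ae_all_iff.2 fun i =>
      (measurePreserving_eval (fun _ : Fin n => P) i).quasiMeasurePreserving.ae h0
  refine (lintegral_congr_ae (g := fun _ => 1) ?_).trans_le (by simp)
  filter_upwards [h1] with S hS
  simp [hS, hp, expKl_zero_zero]

/-- Maurer's bound. -/
theorem lintegral_expKl_le {n : ℕ} (hn : 1 ≤ n) :
    ∫⁻ S : Fin n → 𝒳, expKl n (1 / n * ∑ i, f (S i)) (∫ x, f x ∂P) ∂(Measure.pi fun _ => P) ≤
      ENNReal.ofReal (2 * √(n : ℝ)) := by
  have hn0 : (0 : ℝ) < n := by exact_mod_cast hn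
  have h12 : (1 : ℝ≥0∞) ≤ ENNReal.ofReal (2 * √(n : ℝ)) := by
    rw [ENNReal.one_le_ofReal]
    have : (1 : ℝ) ≤ √(n : ℝ) := Real.one_le_sqrt.2 (by exact_mod_cast hn)
    linarith
  obtain ⟨hp0, hp1⟩ := integral_mem_Icc P hf hf01
  rcases hp0.eq_or_lt with h | h
  · exact (lintegral_expKl_le_of_eq_zero P hf hf01 h.symm).trans h12
  rcases hp1.eq_or_lt with h' | h'
  -- The case of mean one is the case of mean zero for 1 - f.
  · have h01 : ∀ x, 1 - f x ∈ Set.Icc (0 : ℝ) 1 := fun x =>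
      ⟨by linarith [(hf01 x).2], by linarith [(hf01 x).1]⟩
    have e1 : ∫ x, (1 - f x) ∂P = 1 - ∫ x, f x ∂P := by
      rw [integral_sub (integrable_const 1) (integrable_of_mem_Icc P hf hf01)]
      simp
    have h2 := lintegral_expKl_le_of_eq_zero P (f := fun x => 1 - f x) (by fun_prop) h01 (n := n)
      (by rw [e1, h', sub_self])
    have e2 : ∀ S : Fin n → 𝒳, 1 / (n : ℝ) * ∑ i, (1 - f (S i)) = 1 - 1 / n * ∑ i, f (S i) :=
      fun S => by
        rw [Finset.sum_sub_distrib]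
        simp
        field_simp
    simp only [e1, e2, expKl_one_sub] at h2
    exact h2.trans h12
  have hp : ∫ x, f x ∂P ∈ Set.Ioo (0 : ℝ) 1 := ⟨h, h'⟩
  have hcw : ∀ b : Finset (Fin n), Measurable fun S : Fin n → 𝒳 => coinWeight (fun i => f (S i)) b :=
    fun b => by
      unfold coinWeight
      refine Finset.measurable_fun_prod _ fun i _ => ?_
      split_ifs <;> fun_prop
  have hcI : ∀ b : Finset (Fin n), Integrable (fun S : Fin n → 𝒳 => coinWeight (fun i => f (S i)) b)
      (Measure.pi fun _ => P) := fun b =>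
    integrable_of_abs_le _ (hcw b) 1 fun S => by
      rw [abs_of_nonneg (coinWeight_nonneg (fun i => hf01 (S i)) b)]
      refine Finset.prod_le_one (fun i _ => ?_) fun i _ => ?_ <;> split_ifs <;>
        linarith [(hf01 (S i)).1, (hf01 (S i)).2]
  set p := ∫ x, f x ∂P with hpdef
  set c : ℕ → ℝ := fun k => Real.exp (n * (-Real.binEntropy (k / n) +
        (k / n : ℝ) * (-Real.log p) + (1 - k / n) * (-Real.log (1 - p)))) with hc
  calc _ ≤ ∫⁻ S : Fin n → 𝒳, ENNReal.ofReal (∑ b : Finset (Fin n),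
        coinWeight (fun i => f (S i)) b * c b.card) ∂(Measure.pi fun _ => P) := by
        refine lintegral_mono fun S => ?_
        rw [expKl_eq hp]
        exact ENNReal.ofReal_le_ofReal (exp_mean_le_sum_coinWeight hn _ _ fun i => hf01 (S i))
    _ = ENNReal.ofReal (∫ S : Fin n → 𝒳, ∑ b : Finset (Fin n),
        coinWeight (fun i => f (S i)) b * c b.card ∂(Measure.pi fun _ => P)) := by
        rw [ofReal_integral_eq_lintegral_ofReal
          (integrable_finsetSum _ fun b _ => (hcI b).mul_const _)
          (Filter.Eventually.of_forall fun S => Finset.sum_nonneg fun b _ =>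
            mul_nonneg (coinWeight_nonneg (fun i => hf01 (S i)) b) (Real.exp_pos _).le)]
    _ = ENNReal.ofReal (∑ b : Finset (Fin n), p ^ b.card * (1 - p) ^ (n - b.card) * c b.card) := by
        rw [integral_finsetSum _ fun b _ => (hcI b).mul_const _]
        congr 1
        refine Finset.sum_congr rfl fun b _ => ?_
        rw [integral_mul_const, integral_coinWeight P hf hf01]
    _ = ENNReal.ofReal (∑ k ∈ Finset.range (n + 1),
        (n.choose k : ℝ) * ((k / n : ℝ) ^ k * (1 - k / n : ℝ) ^ (n - k))) := by
        congr 1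
        have h3 := Finset.sum_powerset_apply_card (x := (Finset.univ : Finset (Fin n)))
          (fun k => p ^ k * (1 - p) ^ (n - k) * c k)
        rw [Finset.powerset_univ] at h3
        rw [h3, Finset.card_univ, Fintype.card_fin]
        refine Finset.sum_congr rfl fun k hk => ?_
        rw [nsmul_eq_mul, pow_mul_pow_mul_exp_binEntropy hn (by
          simpa [Nat.lt_succ_iff] using hk) hp]
    _ ≤ _ := ENNReal.ofReal_le_ofReal (sum_choose_mul_pow_le hn)

end

/-! ### The PAC-Bayesian inequality -/

/-- The linear functional in the variational formula for `klBer`. -/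
noncomputable def klVar (θ a p : ℝ) : ℝ := a * θ - Real.log (1 - p + p * Real.exp θ)

theorem one_sub_add_mul_exp_pos {p : ℝ} (hp : p ∈ Set.Icc (0 : ℝ) 1) (θ : ℝ) :
    0 < 1 - p + p * Real.exp θ := by
  have h := Real.exp_pos θ
  rcases hp.1.eq_or_lt with h0 | h0
  · rw [← h0]; norm_num
  · have := mul_pos h0 h
    linarith [hp.2]

/-- The supremum over θ is attained at log(a/p) - log((1-a)/(1-p)). For a = 0 or a = 1 the optimum
is at infinity, and a limit is taken. If p is 0 or 1 and differs from a, the family is unbounded in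
θ, which the hypothesis excludes. -/
theorem klBer_le_of_klVar_le {a p c : ℝ} (ha : a ∈ Set.Icc (0 : ℝ) 1) (hp : p ∈ Set.Icc (0 : ℝ) 1)
    (h : ∀ θ, klVar θ a p ≤ c) : klBer a p ≤ ENNReal.ofReal c := by
  have hc0 : 0 ≤ c := by simpa [klVar] using h 0
  have hno : ¬((p = 0 ∧ a ≠ 0) ∨ (p = 1 ∧ a ≠ 1)) := by
    rintro (⟨h0, h1⟩ | ⟨h0, h1⟩)
    · have h2 := h ((c + 1) / a)
      rw [klVar, h0, mul_div_cancel₀ _ h1] at h2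
      norm_num at h2
    · have h2 := h ((c + 1) / (a - 1))
      have h3 : a - 1 ≠ 0 := sub_ne_zero.2 h1
      have h4 : a * ((c + 1) / (a - 1)) - (c + 1) / (a - 1) = c + 1 := by field_simp
      rw [klVar, h0, sub_self, zero_add, one_mul, Real.log_exp, h4] at h2
      linarith
  rw [klBer, if_neg hno]
  refine ENNReal.ofReal_le_ofReal ?_
  rcases hp.1.eq_or_lt with h0 | hp0
  · have : a = 0 := by
      by_contra h1
      exact hno (Or.inl ⟨h0.symm, h1⟩)
    simpa [← h0, this] using hc0
  rcases hp.2.eq_or_lt with h0 | hp1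
  · have : a = 1 := by
      by_contra h1
      exact hno (Or.inr ⟨h0, h1⟩)
    simpa [h0, this] using hc0
  have hq : 0 < 1 - p := by linarith
  rcases ha.1.eq_or_lt with h0 | ha0
  · have hlim : Filter.Tendsto (fun θ : ℝ => klVar θ a p) Filter.atBot
        (nhds (-Real.log (1 - p + p * 0))) := by
      have e : (fun θ : ℝ => klVar θ a p) = fun θ => -Real.log (1 - p + p * Real.exp θ) := by
        funext θ; rw [klVar, ← h0]; ring
      rw [e]
      exact (((Real.tendsto_exp_atBot.const_mul p).const_add (1 - p)).log (by simpa using hq.ne')).neg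
    have := le_of_tendsto' hlim h
    rw [← h0]
    simpa [Real.log_inv] using this
  rcases ha.2.eq_or_lt with h0 | ha1
  · have hlim : Filter.Tendsto (fun θ : ℝ => klVar θ a p) Filter.atTop
        (nhds (-Real.log ((1 - p) * 0 + p))) := by
      have e : (fun θ : ℝ => klVar θ a p) =
          fun θ => -Real.log ((1 - p) * Real.exp (-θ) + p) := by
        funext θ
        have h1 : 1 - p + p * Real.exp θ = Real.exp θ * ((1 - p) * Real.exp (-θ) + p) := by
          rw [Real.exp_neg]
          have := (Real.exp_pos θ).ne'
          field_simp
        have h2 : 0 < (1 - p) * Real.exp (-θ) + p := by positivity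
        rw [klVar, h0, h1, Real.log_mul (Real.exp_pos θ).ne' h2.ne', Real.log_exp]; ring
      rw [e]
      exact ((((Real.tendsto_exp_neg_atTop_nhds_zero).const_mul (1 - p)).add_const p).log
        (by simpa using hp0.ne')).neg
    have := le_of_tendsto' hlim h
    rw [h0]
    simpa [Real.log_inv] using this
  have hb : 0 < 1 - a := by linarith
  have h1 := h (Real.log (a / p) - Real.log ((1 - a) / (1 - p)))
  have h2 : 1 - p + p * Real.exp (Real.log (a / p) - Real.log ((1 - a) / (1 - p))) =
      ((1 - a) / (1 - p))⁻¹ := by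
    rw [Real.exp_sub, Real.exp_log (by positivity), Real.exp_log (by positivity)]
    field_simp
    ring
  rw [klVar, h2, Real.log_inv] at h1
  linarith

theorem mul_log_div_le {a x : ℝ} (ha : 0 ≤ a) (hx : 0 < x) : a * Real.log (x / a) ≤ x - a := by
  rcases ha.eq_or_lt with h | h
  · rw [← h]; simpa using hx.le
  · have h1 := Real.log_le_sub_one_of_pos (div_pos hx h)
    calc _ ≤ a * (x / a - 1) := by gcongr
      _ = _ := by field_simp

theorem mul_log_div_add {a p y : ℝ} (hp : 0 < p) (hy : 0 < y) :
    a * Real.log (a / p) = a * Real.log y - a * Real.log (p * y / a) := by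
  by_cases h : a = 0
  · simp [h]
  · rw [Real.log_div h hp.ne', Real.log_div (mul_pos hp hy).ne' h, Real.log_mul hp.ne' hy.ne']
    ring

/-- Weak duality: tilting Ber(p) by θ and normalizing by Z gives another Bernoulli law, and the gap
is the divergence from that law, which is nonnegative by log x ≤ x - 1. -/
theorem ofReal_exp_klVar_le_expKl {a p : ℝ} (ha : a ∈ Set.Icc (0 : ℝ) 1)
    (hp : p ∈ Set.Icc (0 : ℝ) 1) (n : ℕ) (θ : ℝ) :
    ENNReal.ofReal (Real.exp (n * klVar θ a p)) ≤ expKl n a p := by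
  unfold expKl
  split_ifs with hno
  · exact le_top
  refine ENNReal.ofReal_le_ofReal (Real.exp_le_exp.2 (mul_le_mul_of_nonneg_left ?_
    (Nat.cast_nonneg n)))
  rcases hp.1.eq_or_lt with h0 | hp0
  · have : a = 0 := by
      by_contra h1
      exact hno (Or.inl ⟨h0.symm, h1⟩)
    simp [klVar, ← h0, this]
  rcases hp.2.eq_or_lt with h0 | hp1
  · have : a = 1 := by
      by_contra h1
      exact hno (Or.inr ⟨h0, h1⟩)
    simp [klVar, h0, this]
  have hq : 0 < 1 - p := by linarith
  have hZ := one_sub_add_mul_exp_pos hp θ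
  unfold klVar
  generalize hZd : 1 - p + p * Real.exp θ = Z at hZ
  have hy : 0 < Real.exp θ / Z := by positivity
  have hi : 0 < Z⁻¹ := by positivity
  rw [mul_log_div_add (a := a) hp0 hy, mul_log_div_add (a := 1 - a) hq hi,
    Real.log_div (Real.exp_pos θ).ne' hZ.ne', Real.log_exp, Real.log_inv]
  have h1 := mul_log_div_le ha.1 (mul_pos hp0 hy)
  have h2 := mul_log_div_le (a := 1 - a) (by linarith [ha.2]) (mul_pos hq hi)
  have h3 : p * (Real.exp θ / Z) + (1 - p) * Z⁻¹ = 1 := by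
    field_simp; linarith
  linarith

/-- The Donsker-Varadhan inequality for bounded functions. -/
theorem integral_le_klDiv_add_log {𝒴 : Type*} [MeasurableSpace 𝒴] {ρ π : Measure 𝒴}
    [IsProbabilityMeasure ρ] [IsProbabilityMeasure π] (h : klDiv ρ π ≠ ∞) {f : 𝒴 → ℝ}
    (hf : Measurable f) {C : ℝ} (hC : ∀ y, |f y| ≤ C) :
    ∫ y, f y ∂ρ ≤ (klDiv ρ π).toReal + Real.log (∫ y, Real.exp (f y) ∂π) := by
  obtain ⟨hac, hint⟩ := klDiv_ne_top_iff.1 h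
  have hfρ : Integrable f ρ := integrable_of_abs_le ρ hf C hC
  have hfπ : Integrable (fun y => Real.exp (f y)) π := integrable_exp_of_abs_le π hf hC
  have h1 := integral_llr_tilted_right hac hfρ hfπ hint
  have hprob : IsProbabilityMeasure (π.tilted f) := isProbabilityMeasure_tilted hfπ
  have h2 : ρ ≪ π.tilted f := hac.trans (absolutelyContinuous_tilted hfπ)
  -- The divergence of ρ from the law π tilted by f is nonnegative.
  have h3 := integral_llr_add_sub_measure_univ_nonneg h2
    (integrable_llr_tilted_right hac hfρ hint hfπ)
  have h4 := toReal_klDiv_of_measure_eq hac (by simp)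
  rw [h1] at h3
  simp only [probReal_univ] at h3
  rw [h4]
  linarith

/-- At fixed θ the functional is linear in a and, the logarithm being concave, convex in p. It is
also bounded, unlike kl itself, so no integrability has to be assumed. -/
theorem klVar_integral_le {𝒴 : Type*} [MeasurableSpace 𝒴] (ρ : Measure 𝒴) [IsProbabilityMeasure ρ]
    {a p : 𝒴 → ℝ} (ham : Measurable a) (hpm : Measurable p) (ha : ∀ y, a y ∈ Set.Icc (0 : ℝ) 1)
    (hp : ∀ y, p y ∈ Set.Icc (0 : ℝ) 1) (θ : ℝ) :
    klVar θ (∫ y, a y ∂ρ) (∫ y, p y ∂ρ) ≤ ∫ y, klVar θ (a y) (p y) ∂ρ := by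
  have ia := integrable_of_mem_Icc ρ ham ha
  have ip := integrable_of_mem_Icc ρ hpm hp
  have hP := integral_mem_Icc ρ hpm hp
  have hZ := one_sub_add_mul_exp_pos hP θ
  set z : 𝒴 → ℝ := fun y => 1 - p y + p y * Real.exp θ with hz
  have hz0 : ∀ y, 0 < z y := fun y => one_sub_add_mul_exp_pos (hp y) θ
  have hzm : Measurable z := by fun_prop
  have iz : Integrable z ρ := ((integrable_const 1).sub ip).add (ip.mul_const _)
  have ez : ∫ y, z y ∂ρ = 1 - ∫ y, p y ∂ρ + (∫ y, p y ∂ρ) * Real.exp θ := by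
    have i1 : Integrable (fun y => 1 - p y) ρ := (integrable_const 1).sub ip
    simp only [hz]
    rw [integral_add i1 (ip.mul_const _),
      integral_sub (integrable_const 1) ip, integral_mul_const]
    simp
  have hlb : ∀ y, |Real.log (z y)| ≤ |θ| := fun y => by
    have h0 := (hp y).1
    have h1 := (hp y).2
    have h2 : Real.exp (-|θ|) ≤ Real.exp θ := Real.exp_le_exp.2 (neg_abs_le θ)
    have h3 : Real.exp θ ≤ Real.exp |θ| := Real.exp_le_exp.2 (le_abs_self θ)
    have h4 : Real.exp (-|θ|) ≤ 1 := Real.exp_le_one_iff.2 (by simp)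
    have h5 : 1 ≤ Real.exp |θ| := Real.one_le_exp (abs_nonneg θ)
    refine abs_le.2 ⟨(Real.le_log_iff_exp_le (hz0 y)).2 ?_, (Real.log_le_iff_le_exp (hz0 y)).2 ?_⟩
    · simp only [hz]; nlinarith
    · simp only [hz]; nlinarith
  have il : Integrable (fun y => Real.log (z y)) ρ := integrable_of_abs_le ρ hzm.log _ hlb
  have hj : ∫ y, Real.log (z y) ∂ρ ≤ Real.log (∫ y, z y ∂ρ) := by
    rw [← ez] at hZ
    generalize hZd : ∫ y, z y ∂ρ = Z at hZ
    have pt : ∀ y, Real.log (z y) ≤ Real.log Z + (z y / Z - 1) := fun y => by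
      have := Real.log_le_sub_one_of_pos (div_pos (hz0 y) hZ)
      rw [Real.log_div (hz0 y).ne' hZ.ne'] at this
      linarith
    have i2 : Integrable (fun y => z y / Z - 1) ρ := (iz.div_const Z).sub (integrable_const 1)
    have h := integral_mono il ((integrable_const (Real.log Z)).add i2) pt
    rw [integral_add' (integrable_const _) i2, integral_sub (iz.div_const Z) (integrable_const 1),
      integral_div, hZd, div_self hZ.ne'] at h
    simpa using h
  unfold klVar
  rw [integral_sub (ia.mul_const θ) il, integral_mul_const]
  rw [ez] at hj
  linarith

/-- The PAC-Bayesian change of measure, simultaneously for all posteriors. -/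
theorem klBer_le_of_lintegral_expKl_le {𝒴 : Type*} [MeasurableSpace 𝒴] {n : ℕ} (hn : 1 ≤ n)
    {a p : 𝒴 → ℝ} (ham : Measurable a) (hpm : Measurable p) (ha : ∀ y, a y ∈ Set.Icc (0 : ℝ) 1)
    (hp : ∀ y, p y ∈ Set.Icc (0 : ℝ) 1) (π ρ : Measure 𝒴) [IsProbabilityMeasure π]
    [IsProbabilityMeasure ρ] {c : ℝ}
    (hB : ∫⁻ y, expKl n (a y) (p y) ∂π ≤ ENNReal.ofReal (Real.exp c)) :
    klBer (∫ y, a y ∂ρ) (∫ y, p y ∂ρ) ≤ (klDiv ρ π + ENNReal.ofReal c) / (n : ℝ≥0∞) := by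
  have hn0 : (0 : ℝ) < n := by exact_mod_cast hn
  by_cases hK : klDiv ρ π = ∞
  · rw [hK, top_add, ENNReal.top_div_of_ne_top (ENNReal.natCast_ne_top n)]
    exact le_top
  -- Donsker-Varadhan at each fixed θ, with the supremum over θ taken only afterwards. The moment
  -- `hB` involves neither θ nor ρ.
  have key : ∀ θ, klVar θ (∫ y, a y ∂ρ) (∫ y, p y ∂ρ) ≤ ((klDiv ρ π).toReal + c) / n := fun θ => by
    have hm : Measurable fun y => n * klVar θ (a y) (p y) := by unfold klVar; fun_prop
    have hb : ∀ y, |n * klVar θ (a y) (p y)| ≤ n * (2 * |θ|) := fun y => by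
      rw [abs_mul, abs_of_pos hn0]
      refine mul_le_mul_of_nonneg_left ?_ hn0.le
      have hz0 := one_sub_add_mul_exp_pos (hp y) θ
      have h0 := (hp y).1
      have h1 := (hp y).2
      have h2 : Real.exp (-|θ|) ≤ Real.exp θ := Real.exp_le_exp.2 (neg_abs_le θ)
      have h3 : Real.exp θ ≤ Real.exp |θ| := Real.exp_le_exp.2 (le_abs_self θ)
      have h4 : Real.exp (-|θ|) ≤ 1 := Real.exp_le_one_iff.2 (by simp)
      have h5 : 1 ≤ Real.exp |θ| := Real.one_le_exp (abs_nonneg θ)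
      have h6 : |Real.log (1 - p y + p y * Real.exp θ)| ≤ |θ| :=
        abs_le.2 ⟨(Real.le_log_iff_exp_le hz0).2 (by nlinarith),
          (Real.log_le_iff_le_exp hz0).2 (by nlinarith)⟩
      have h7 : |a y * θ| ≤ |θ| := by
        rw [abs_mul, abs_of_nonneg (ha y).1]
        exact mul_le_of_le_one_left (abs_nonneg θ) (ha y).2
      refine (abs_sub _ _).trans ?_
      linarith
    have h1 := integral_le_klDiv_add_log hK hm hb
    have i1 : Integrable (fun y => Real.exp (n * klVar θ (a y) (p y))) π :=
      integrable_exp_of_abs_le π hm hb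
    have h2 : Real.log (∫ y, Real.exp (n * klVar θ (a y) (p y)) ∂π) ≤ c := by
      rw [Real.log_le_iff_le_exp (integral_exp_pos i1), ← ENNReal.ofReal_le_ofReal_iff
        (Real.exp_pos c).le, ofReal_integral_eq_lintegral_ofReal i1
        (Filter.Eventually.of_forall fun x => (Real.exp_pos _).le)]
      exact (lintegral_mono fun y => ofReal_exp_klVar_le_expKl (ha y) (hp y) n θ).trans hB
    have h3 := klVar_integral_le ρ ham hpm ha hp θ
    rw [integral_const_mul] at h1
    rw [le_div_iff₀ hn0]
    nlinarith
  refine (klBer_le_of_klVar_le (integral_mem_Icc ρ ham ha) (integral_mem_Icc ρ hpm hp) key).trans ?_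
  rw [ENNReal.ofReal_div_of_pos hn0, ENNReal.ofReal_natCast]
  refine ENNReal.div_le_div_right (ENNReal.ofReal_add_le.trans (le_of_eq ?_)) _
  rw [ENNReal.ofReal_toReal hK]

/-! ### Change of measure -/

/-- Change of measure from dependent to independent data: an event that is unlikely by Markov's
inequality for independent data stays unlikely under a law with bounded Rényi divergence. -/
theorem HasRenyiBound.lintegral_le {Ω Ω' : Type*} [MeasurableSpace Ω] [MeasurableSpace Ω']
    {Q : Measure Ω} [IsProbabilityMeasure Q] {γ : Measure Ω'} [SFinite γ] {p : Ω → Ω' → ℝ≥0∞}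
    {s ψ : ℝ} (h : HasRenyiBound Q γ p s ψ) (hs : 0 < s)
    (hp : Measurable fun z : Ω' × Ω => p z.2 z.1) {B : Ω → Ω' → ℝ≥0∞}
    (hB : Measurable fun z : Ω' × Ω => B z.2 z.1) {β δ k : ℝ} (hβ : 0 < β) (hδ : 0 < δ)
    (hBβ : ∀ v, ∫⁻ x, B x v ∂Q ≤ ENNReal.ofReal β) (hk : ψ + Real.log (2 / δ) ≤ s * k) :
    ∫⁻ v, ∫⁻ x, p x v * (if ENNReal.ofReal (Real.exp k * (2 * β / δ)) < B x v then 1 else 0) ∂Q ∂γ ≤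
      ENNReal.ofReal δ := by
  obtain ⟨q, hqm, hq0, hqtop, hq1, hq⟩ := h
  obtain ⟨t, ht⟩ : ∃ t, t = ENNReal.ofReal (Real.exp k * (2 * β / δ)) := ⟨_, rfl⟩
  have ht0 : t ≠ 0 := by
    rw [ht]; exact (ENNReal.ofReal_pos.2 (by positivity)).ne'
  have htop : t ≠ ∞ := by rw [ht]; exact ENNReal.ofReal_ne_top
  rw [← ht]
  -- If p ≥ e^k q, then p ≤ e^(-sk) p^(1+s) q^(-s), which integrates to at most e^(ψ - sk).
  -- Otherwise p is at most e^k q, and the indicator is at most B/t. The threshold t and the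
  -- condition on k make either part at most δ/2.
  have pt : ∀ x v, p x v * (if t < B x v then 1 else 0) ≤
      ENNReal.ofReal (Real.exp (-(s * k))) * (p x v ^ (1 + s) * q v ^ (-s)) +
        (q v * (ENNReal.ofReal (Real.exp k) / t)) * B x v := by
    intro x v
    split_ifs with hc
    · rw [mul_one]
      rcases le_total (ENNReal.ofReal (Real.exp k) * q v) (p x v) with h1 | h1
      · refine le_trans ?_ le_self_add
        have h2 := ENNReal.rpow_le_rpow h1 hs.le
        rw [ENNReal.mul_rpow_of_nonneg _ _ hs.le, ofReal_exp_rpow] at h2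
        have hqs0 : q v ^ s ≠ 0 := by
          rw [Ne, ENNReal.rpow_eq_zero_iff_of_pos hs]; exact hq0 v
        have hqst : q v ^ s ≠ ∞ := ENNReal.rpow_ne_top_of_nonneg hs.le (hqtop v)
        rw [ENNReal.rpow_add_of_nonneg _ _ zero_le_one hs.le, ENNReal.rpow_one, ENNReal.rpow_neg]
        calc p x v = p x v * ((ENNReal.ofReal (Real.exp (-(s * k))) *
              ENNReal.ofReal (Real.exp (k * s))) * (q v ^ s * (q v ^ s)⁻¹)) := by
              rw [ofReal_exp_mul, ENNReal.mul_inv_cancel hqs0 hqst]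
              have : -(s * k) + k * s = 0 := by ring
              rw [this]; simp
          _ = ENNReal.ofReal (Real.exp (-(s * k))) * (p x v *
              (ENNReal.ofReal (Real.exp (k * s)) * q v ^ s) * (q v ^ s)⁻¹) := by ring
          _ ≤ _ := by gcongr
      · refine le_trans ?_ le_add_self
        refine h1.trans ?_
        calc _ = q v * (ENNReal.ofReal (Real.exp k) / t) * t := by
              rw [mul_assoc, ENNReal.div_mul_cancel ht0 htop, mul_comm]
          _ ≤ _ := by gcongr
    · simp
  have hpq : Measurable fun z : Ω' × Ω => p z.2 z.1 ^ (1 + s) * q z.1 ^ (-s) :=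
    (hp.pow_const _).mul ((hqm.comp measurable_fst).pow_const _)
  have hpqv : Measurable fun v => ∫⁻ x, p x v ^ (1 + s) * q v ^ (-s) ∂Q :=
    Measurable.lintegral_prod_right (f := fun v x => p x v ^ (1 + s) * q v ^ (-s)) hpq
  have hm1 : ∀ v, Measurable fun x => p x v ^ (1 + s) * q v ^ (-s) := fun v =>
    hpq.comp (measurable_prodMk_left (x := v))
  have hm2 : ∀ v, Measurable fun x => B x v := fun v => hB.comp (measurable_prodMk_left (x := v))
  have hct : ENNReal.ofReal (Real.exp k) / t ≠ ∞ := ENNReal.div_ne_top ENNReal.ofReal_ne_top ht0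
  calc _ ≤ ∫⁻ v, (ENNReal.ofReal (Real.exp (-(s * k))) * ∫⁻ x, p x v ^ (1 + s) * q v ^ (-s) ∂Q +
        q v * (ENNReal.ofReal (Real.exp k) / t * ENNReal.ofReal β)) ∂γ := by
        refine lintegral_mono fun v => ?_
        refine (lintegral_mono fun x => pt x v).trans ?_
        rw [lintegral_add_right _ ((hm2 v).const_mul _), lintegral_const_mul _ (hm1 v),
          lintegral_const_mul _ (hm2 v), mul_assoc]
        gcongr
        exact hBβ v
    _ = ENNReal.ofReal (Real.exp (-(s * k))) *
          ∫⁻ v, ∫⁻ x, p x v ^ (1 + s) * q v ^ (-s) ∂Q ∂γ +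
        (∫⁻ v, q v ∂γ) * (ENNReal.ofReal (Real.exp k) / t * ENNReal.ofReal β) := by
        rw [lintegral_add_left (hpqv.const_mul _), lintegral_const_mul _ hpqv,
          lintegral_mul_const _ hqm]
    _ ≤ ENNReal.ofReal (Real.exp (-(s * k))) * ENNReal.ofReal (Real.exp ψ) +
        1 * (ENNReal.ofReal (Real.exp k) / t * ENNReal.ofReal β) := by gcongr
    _ ≤ ENNReal.ofReal (δ / 2) + ENNReal.ofReal (δ / 2) := by
        refine add_le_add ?_ (le_of_eq ?_)
        · rw [ofReal_exp_mul]
          refine ENNReal.ofReal_le_ofReal ?_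
          have h1 : -(s * k) + ψ ≤ Real.log (δ / 2) := by
            rw [← inv_div 2 δ, Real.log_inv]; linarith
          exact (Real.exp_le_exp.2 h1).trans_eq (Real.exp_log (by positivity))
        · rw [one_mul, ht, ← ENNReal.ofReal_div_of_pos (by positivity),
            ← ENNReal.ofReal_mul (by positivity)]
          congr 1
          have := (Real.exp_pos k).ne'
          field_simp
    _ = _ := by
        rw [← ENNReal.ofReal_add (by positivity) (by positivity)]
        congr 1; ring

/-! ### DP-SGD as a Gaussian process -/

theorem norm_clip_le {d : ℕ} (g : EuclideanSpace ℝ (Fin d)) {ζ : ℝ} (hζ : 0 < ζ) :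
    ‖clip g ζ‖ ≤ ζ := by
  unfold clip
  split_ifs with h
  · exact h
  · push Not at h
    have h0 : 0 < ‖g‖ := hζ.trans h
    rw [norm_smul, Real.norm_eq_abs, abs_of_pos (div_pos hζ h0), div_mul_cancel₀ _ h0.ne']

@[fun_prop]
theorem measurable_clip {d : ℕ} (ζ : ℝ) {X : Type*} [MeasurableSpace X]
    {g : X → EuclideanSpace ℝ (Fin d)} (hg : Measurable g) : Measurable fun x => clip (g x) ζ := by
  unfold clip
  refine Measurable.ite (measurableSet_le (by fun_prop) (by fun_prop)) hg (by fun_prop)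

namespace DPSGD

variable {𝒳 𝒲 𝒮 : Type*} [MeasurableSpace 𝒳] [MeasurableSpace 𝒲] [MeasurableSpace 𝒮] {d n : ℕ}

local notation "V" => EuclideanSpace ℝ (Fin d)

/-- A path as a sequence. -/
def extend {K : ℕ} (v : Fin K → EuclideanSpace ℝ (Fin d)) (k : ℕ) : EuclideanSpace ℝ (Fin d) :=
  if h : k < K then v ⟨k, h⟩ else 0

theorem measurable_extend {K : ℕ} (k : ℕ) :
    Measurable fun v : Fin K → V => extend v k := by
  unfold extend
  split_ifs <;> fun_prop

/-- The state after `k` steps, as a function of the noise, without the division into epochs. -/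
noncomputable def run (A : DPSGD 𝒳 𝒲 𝒮 d n) (S : Fin n → 𝒳) (w : 𝒲)
    (z : Fin (A.E * A.T) → EuclideanSpace ℝ (Fin d)) : ℕ → 𝒮
  | 0 => A.init w
  | k + 1 => A.gradientUpdate (k / A.T) (k % A.T) (A.η (k % A.T))
      (A.updateVector S (A.createBatches w (k / A.T) (k % A.T)) (extend z k)
        (A.param (A.run S w z k))) (A.run S w z k)

/-- The state after `k` steps, as a function of the normalized update vectors. -/
noncomputable def replay (A : DPSGD 𝒳 𝒲 𝒮 d n) (w : 𝒲)
    (v : Fin (A.E * A.T) → EuclideanSpace ℝ (Fin d)) : ℕ → 𝒮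
  | 0 => A.init w
  | k + 1 => A.gradientUpdate (k / A.T) (k % A.T) (A.η (k % A.T)) (A.σ • extend v k)
      (A.replay w v k)

theorem mul_add_lt (A : DPSGD 𝒳 𝒲 𝒮 d n) {e t : ℕ} (he : e < A.E) (ht : t < A.T) :
    e * A.T + t < A.E * A.T := by
  have h : (e + 1) * A.T ≤ A.E * A.T := Nat.mul_le_mul_right _ he
  rw [add_mul, one_mul] at h
  omega

theorem mul_add_div (A : DPSGD 𝒳 𝒲 𝒮 d n) (e : ℕ) {t : ℕ} (ht : t < A.T) :
    (e * A.T + t) / A.T = e := by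
  rw [add_comm, Nat.add_mul_div_right _ _ A.T_pos, Nat.div_eq_of_lt ht, zero_add]

theorem mul_add_mod (A : DPSGD 𝒳 𝒲 𝒮 d n) (e : ℕ) {t : ℕ} (ht : t < A.T) :
    (e * A.T + t) % A.T = t := by
  rw [add_comm, Nat.add_mul_mod_self_right, Nat.mod_eq_of_lt ht]

/-- Step t of epoch e has the number eT + t. Including t = T identifies the end of an epoch with the
start of the next, which closes the induction over the epochs. -/
theorem run_eq_stateInEpoch (A : DPSGD 𝒳 𝒲 𝒮 d n) (S : Fin n → 𝒳) (w : 𝒲)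
    (z : ℕ → ℕ → EuclideanSpace ℝ (Fin d)) :
    ∀ e < A.E, ∀ t ≤ A.T, A.run S w (fun k => z (k / A.T) (k % A.T)) (e * A.T + t) =
      A.stateInEpoch S w z e (A.epochStart S w z e) t := by
  have hstep : ∀ e < A.E, A.run S w (fun k => z (k / A.T) (k % A.T)) (e * A.T) =
      A.epochStart S w z e → ∀ t ≤ A.T,
      A.run S w (fun k => z (k / A.T) (k % A.T)) (e * A.T + t) =
        A.stateInEpoch S w z e (A.epochStart S w z e) t := by
    intro e he h0 t
    induction t with
    | zero => intro _; exact h0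
    | succ t ih =>
      intro ht
      have ht' : t < A.T := ht
      rw [← add_assoc, run, stateInEpoch, ih ht'.le, A.mul_add_div e ht', A.mul_add_mod e ht']
      congr 2
      rw [extend, dif_pos (A.mul_add_lt he ht')]
      simp only [A.mul_add_div e ht', A.mul_add_mod e ht']
  intro e
  induction e with
  | zero => intro he; exact hstep 0 he (by rw [zero_mul]; rfl)
  | succ e ih =>
    intro he
    refine hstep (e + 1) he ?_
    rw [add_mul, one_mul, ih (by omega) A.T le_rfl]
    rfl

theorem stream_eq (A : DPSGD 𝒳 𝒲 𝒮 d n) (S : Fin n → 𝒳) (w : 𝒲)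
    (z : ℕ → ℕ → EuclideanSpace ℝ (Fin d)) :
    A.stream S w z = fun (e : Fin A.E) (t : Fin A.T) =>
      A.param (A.run S w (fun k => z (k / A.T) (k % A.T)) (e * A.T + (t + 1))) := by
  funext e t
  rw [A.run_eq_stateInEpoch S w z e e.isLt (t + 1) t.isLt]
  rfl

theorem measurable_replay (A : DPSGD 𝒳 𝒲 𝒮 d n) (w : 𝒲) (k : ℕ) :
    Measurable fun v => A.replay w v k := by
  induction k with
  | zero => exact measurable_const
  | succ k ih =>
    have h1 : Measurable fun v : Fin (A.E * A.T) → V => A.σ • extend v k :=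
      (measurable_extend k).const_smul A.σ
    exact (A.measurable_gradientUpdate (k / A.T) (k % A.T)).comp (h1.prodMk ih)

theorem replay_congr (A : DPSGD 𝒳 𝒲 𝒮 d n) (w : 𝒲) {v v' : Fin (A.E * A.T) → V} {k : ℕ}
    (h : ∀ j : Fin (A.E * A.T), j.val < k → v j = v' j) : A.replay w v k = A.replay w v' k := by
  induction k with
  | zero => rfl
  | succ k ih =>
    have e : extend v k = extend v' k := by
      unfold extend
      split_ifs with hk
      · exact h ⟨k, hk⟩ (Nat.lt_succ_self k)
      · rfl
    rw [replay, replay, ih fun j hj => h j (by omega), e]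

/-- The clipped gradients, normalized by the noise strength, as functions of the path. -/
noncomputable def pathField (A : DPSGD 𝒳 𝒲 𝒮 d n) (w : 𝒲) :
    PathField 𝒳 d (A.E * A.T) (A.ζ / A.σ) where
  toFun k x v := A.σ⁻¹ • clip (gradient (A.trainLoss x) (A.param (A.replay w v k))) A.ζ
  past x k v v' h := by
    simp only [A.replay_congr w (k := k.val) fun j hj => h j hj]
  meas k := by
    have h1 : Measurable fun p : 𝒳 × (Fin (A.E * A.T) → V) =>
        gradient (A.trainLoss p.1) (A.param (A.replay w p.2 k)) :=
      A.measurable_gradient.comp (measurable_fst.prodMk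
        (A.measurable_param.comp ((A.measurable_replay w k).comp measurable_snd)))
    fun_prop
  bound k x v := by
    rw [norm_smul, norm_inv, Real.norm_eq_abs, abs_of_pos A.σ_pos, div_eq_inv_mul]
    exact mul_le_mul_of_nonneg_left (norm_clip_le _ A.ζ_pos) (inv_nonneg.2 A.σ_pos.le)

/-- The batch of a step. -/
def batch (A : DPSGD 𝒳 𝒲 𝒮 d n) (w : 𝒲) (k : Fin (A.E * A.T)) : Finset (Fin n) :=
  A.createBatches w (k / A.T) (k % A.T)

theorem div_lt (A : DPSGD 𝒳 𝒲 𝒮 d n) (k : Fin (A.E * A.T)) : k.val / A.T < A.E :=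
  Nat.div_lt_of_lt_mul (k.isLt.trans_eq (mul_comm _ _))

theorem mod_lt (A : DPSGD 𝒳 𝒲 𝒮 d n) (k : ℕ) : k % A.T < A.T := Nat.mod_lt _ A.T_pos

theorem card_batch_eq (A : DPSGD 𝒳 𝒲 𝒮 d n) (w : 𝒲) (k : Fin (A.E * A.T)) :
    (A.batch w k).card = A.m := A.card_batch w _ (A.div_lt k) _ (A.mod_lt k)

theorem disjoint_batch_of_ne (A : DPSGD 𝒳 𝒲 𝒮 d n) (w : 𝒲) (k k' : Fin (A.E * A.T)) (h : k ≠ k')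
    (hk : k.val / A.T = k'.val / A.T) : Disjoint (A.batch w k) (A.batch w k') := by
  have hne : k.val % A.T ≠ k'.val % A.T := fun hm => h (Fin.ext (by
    rw [← Nat.div_add_mod k.val A.T, ← Nat.div_add_mod k'.val A.T, hk, hm]))
  have := A.disjoint_batch w _ (A.div_lt k) _ (A.mod_lt k) _ (A.mod_lt k') hne
  unfold batch
  rwa [← hk]

/-- The run of the algorithm replays the path of the Gaussian process with data-dependent drift. -/
theorem run_eq_replay (A : DPSGD 𝒳 𝒲 𝒮 d n) (S : Fin n → 𝒳) (w : 𝒲)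
    (z : Fin (A.E * A.T) → V) {k : ℕ} (hk : k ≤ A.E * A.T) : A.run S w z k =
      A.replay w (driftUpTo ((A.pathField w).drift (A.batch w) S) (A.E * A.T) z) k := by
  induction k with
  | zero => rfl
  | succ k ih =>
    have hk' : k < A.E * A.T := hk
    rw [run, replay, ih hk'.le]
    congr 1
    rw [extend, dif_pos hk', extend, dif_pos hk',
      driftUpTo_apply ((A.pathField w).past_drift (A.batch w) S) z ⟨k, hk'⟩, updateVector,
      PathField.drift, smul_add, Finset.smul_sum, add_comm]
    congr 1
    refine Finset.sum_congr rfl fun i _ => ?_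
    simp only [pathField]
    rw [smul_inv_smul₀ A.σ_pos.ne']

theorem measurable_run (A : DPSGD 𝒳 𝒲 𝒮 d n) (k : ℕ) :
    Measurable fun p : (Fin n → 𝒳) × (Fin (A.E * A.T) → V) × 𝒲 => A.run p.1 p.2.2 p.2.1 k := by
  induction k with
  | zero => exact A.measurable_init.comp (measurable_snd.comp measurable_snd)
  | succ k ih =>
    have hz : Measurable fun p : (Fin n → 𝒳) × (Fin (A.E * A.T) → V) × 𝒲 => extend p.2.1 k :=
      (measurable_extend k).comp (measurable_fst.comp measurable_snd)
    have hu : Measurable fun p : (Fin n → 𝒳) × (Fin (A.E * A.T) → V) × 𝒲 =>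
        A.updateVector p.1 (A.createBatches p.2.2 (k / A.T) (k % A.T)) (extend p.2.1 k)
          (A.param (A.run p.1 p.2.2 p.2.1 k)) := by
      unfold updateVector
      refine Measurable.add ?_ (hz.const_smul A.σ)
      have e : ∀ (p : (Fin n → 𝒳) × (Fin (A.E * A.T) → V) × 𝒲),
          ∑ i ∈ A.createBatches p.2.2 (k / A.T) (k % A.T),
            clip (gradient (A.trainLoss (p.1 i)) (A.param (A.run p.1 p.2.2 p.2.1 k))) A.ζ =
          ∑ i, if i ∈ A.createBatches p.2.2 (k / A.T) (k % A.T) then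
            clip (gradient (A.trainLoss (p.1 i)) (A.param (A.run p.1 p.2.2 p.2.1 k))) A.ζ else 0 :=
        fun p => by rw [Finset.sum_ite_mem, Finset.univ_inter]
      simp only [e]
      refine Finset.measurable_fun_sum _ fun i _ => Measurable.ite ?_ ?_ measurable_const
      · exact (measurable_snd.comp measurable_snd) (A.measurableSet_batch (k / A.T) (k % A.T) i)
      · refine measurable_clip A.ζ (A.measurable_gradient.comp
          (Measurable.prodMk ?_ (A.measurable_param.comp ih)))
        exact (measurable_pi_apply i).comp measurable_fst
    exact (A.measurable_gradientUpdate (k / A.T) (k % A.T)).comp (hu.prodMk ih)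

theorem one_le_size (A : DPSGD 𝒳 𝒲 𝒮 d n) [Nonempty 𝒲] : 1 ≤ n := by
  obtain ⟨w⟩ := ‹Nonempty 𝒲›
  have h := A.card_batch w 0 A.E_pos 0 A.T_pos
  have h2 := Finset.card_le_univ (A.createBatches w 0 0)
  rw [Fintype.card_fin, h] at h2
  exact le_trans A.m_pos h2

end DPSGD

/-! ### Probability of the exceptional event -/

section

variable {𝒳 𝒴 : Type*} [MeasurableSpace 𝒳] [MeasurableSpace 𝒴] {n : ℕ} {loss : 𝒳 → 𝒴 → ℝ}
  (hloss : Measurable fun p : 𝒳 × 𝒴 => loss p.1 p.2)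
  (hloss01 : ∀ x y, loss x y ∈ Set.Icc (0 : ℝ) 1) (P : Measure 𝒳) [IsProbabilityMeasure P]

include hloss in
theorem measurable_empirical :
    Measurable fun p : (Fin n → 𝒳) × 𝒴 => 1 / (n : ℝ) * ∑ i, loss (p.1 i) p.2 := by
  have h : ∀ i, Measurable fun p : (Fin n → 𝒳) × 𝒴 => loss (p.1 i) p.2 := fun i =>
    hloss.comp (f := fun p : (Fin n → 𝒳) × 𝒴 => (p.1 i, p.2)) (by fun_prop)
  fun_prop

include hloss in
theorem measurable_integral_loss : Measurable fun y => ∫ x, loss x y ∂P :=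
  measurable_integral_right P (f := fun y x => loss x y) (hloss.comp measurable_swap)

include hloss in
theorem measurable_expKl_loss : Measurable fun p : (Fin n → 𝒳) × 𝒴 =>
    expKl n (1 / (n : ℝ) * ∑ i, loss (p.1 i) p.2) (∫ x, loss x p.2 ∂P) :=
  (measurable_expKl n).comp ((measurable_empirical hloss).prodMk
    ((measurable_integral_loss hloss P).comp measurable_snd))

include hloss hloss01 in
theorem lintegral_lintegral_expKl_le (hn : 1 ≤ n) (π : Measure 𝒴) [IsProbabilityMeasure π] :
    ∫⁻ S : Fin n → 𝒳, ∫⁻ y, expKl n (1 / (n : ℝ) * ∑ i, loss (S i) y) (∫ x, loss x y ∂P) ∂π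
      ∂(Measure.pi fun _ => P) ≤ ENNReal.ofReal (2 * √(n : ℝ)) := by
  rw [lintegral_lintegral_swap (measurable_expKl_loss hloss P).aemeasurable]
  refine (lintegral_mono fun y => lintegral_expKl_le P (f := fun x => loss x y)
    (hloss.comp (measurable_prodMk_right (y := y))) (fun x => hloss01 x y) hn).trans ?_
  simp

end

namespace DPSGD

variable {𝒳 𝒴 𝒲 𝒮 : Type*} [MeasurableSpace 𝒳] [MeasurableSpace 𝒴] [MeasurableSpace 𝒲]
  [MeasurableSpace 𝒮] {d n : ℕ}

local notation "V" => EuclideanSpace ℝ (Fin d)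

/-- The exponential moment of the deviation of the risks under the prior. -/
noncomputable def priorMoment (A : DPSGD 𝒳 𝒲 𝒮 d n) (loss : 𝒳 → 𝒴 → ℝ) (P : Measure 𝒳)
    (prior : Kernel (𝒲 × (Fin A.E → Fin A.T → EuclideanSpace ℝ (Fin d))) 𝒴)
    (S : Fin n → 𝒳) (o : 𝒲 × (Fin A.E → Fin A.T → EuclideanSpace ℝ (Fin d))) : ℝ≥0∞ :=
  ∫⁻ y, expKl n (1 / (n : ℝ) * ∑ i, loss (S i) y) (∫ x, loss x y ∂P) ∂(prior o)

/-- The output as a function of the noise. -/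
noncomputable def outRun (A : DPSGD 𝒳 𝒲 𝒮 d n) (S : Fin n → 𝒳) (w : 𝒲)
    (z : Fin (A.E * A.T) → EuclideanSpace ℝ (Fin d)) (e : Fin A.E) (t : Fin A.T) :
    EuclideanSpace ℝ (Fin d) := A.param (A.run S w z (e * A.T + (t + 1)))

/-- The output as a function of the normalized update vectors. -/
noncomputable def outReplay (A : DPSGD 𝒳 𝒲 𝒮 d n) (w : 𝒲)
    (v : Fin (A.E * A.T) → EuclideanSpace ℝ (Fin d)) (e : Fin A.E) (t : Fin A.T) :
    EuclideanSpace ℝ (Fin d) := A.param (A.replay w v (e * A.T + (t + 1)))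

theorem measurable_outReplay (A : DPSGD 𝒳 𝒲 𝒮 d n) (w : 𝒲) : Measurable (A.outReplay w) :=
  measurable_pi_lambda _ fun _ => measurable_pi_lambda _ fun _ =>
    A.measurable_param.comp (A.measurable_replay w _)

theorem measurable_outRun (A : DPSGD 𝒳 𝒲 𝒮 d n) :
    Measurable fun p : (Fin n → 𝒳) × (Fin (A.E * A.T) → V) × 𝒲 => A.outRun p.1 p.2.2 p.2.1 :=
  measurable_pi_lambda _ fun _ => measurable_pi_lambda _ fun _ =>
    A.measurable_param.comp (A.measurable_run _)

theorem outRun_eq_outReplay (A : DPSGD 𝒳 𝒲 𝒮 d n) (S : Fin n → 𝒳) (w : 𝒲)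
    (z : Fin (A.E * A.T) → V) : A.outRun S w z =
      A.outReplay w (driftUpTo ((A.pathField w).drift (A.batch w) S) (A.E * A.T) z) := by
  funext e t
  unfold outRun outReplay
  rw [A.run_eq_replay S w z]
  have := A.mul_add_lt e.isLt t.isLt
  omega

variable {loss : 𝒳 → 𝒴 → ℝ} (hloss : Measurable fun p : 𝒳 × 𝒴 => loss p.1 p.2)
  (hloss01 : ∀ x y, loss x y ∈ Set.Icc (0 : ℝ) 1) (P : Measure 𝒳) [IsProbabilityMeasure P]

include hloss in
theorem measurable_priorMoment (A : DPSGD 𝒳 𝒲 𝒮 d n)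
    (prior : Kernel (𝒲 × (Fin A.E → Fin A.T → EuclideanSpace ℝ (Fin d))) 𝒴) [IsMarkovKernel prior] :
    Measurable fun p : (Fin n → 𝒳) × (𝒲 × (Fin A.E → Fin A.T → EuclideanSpace ℝ (Fin d))) =>
      A.priorMoment loss P prior p.1 p.2 := by
  have h := Measurable.lintegral_kernel_prod_right' (κ := prior.comap
    (Prod.snd : (Fin n → 𝒳) × (𝒲 × (Fin A.E → Fin A.T → EuclideanSpace ℝ (Fin d))) → _)
    measurable_snd)
    (f := fun q => expKl n (1 / (n : ℝ) * ∑ i, loss (q.1.1 i) q.2) (∫ x, loss x q.2 ∂P))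
    ((measurable_expKl_loss hloss P).comp
      (f := fun q : ((Fin n → 𝒳) × (𝒲 × (Fin A.E → Fin A.T → EuclideanSpace ℝ (Fin d)))) × 𝒴 =>
        (q.1.1, q.2)) (by fun_prop))
  exact h

set_option maxHeartbeats 1000000 in
include hloss hloss01 in
/-- The exceptional event is unlikely, for fixed initialization and batches. -/
theorem lintegral_lintegral_outRun_le (A : DPSGD 𝒳 𝒲 𝒮 d n)
    (prior : Kernel (𝒲 × (Fin A.E → Fin A.T → EuclideanSpace ℝ (Fin d))) 𝒴) [IsMarkovKernel prior]
    {δ ε : ℝ} (hδ : δ ∈ Set.Ioo (0 : ℝ) 1) (hε : 0 < ε) (w : 𝒲) :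
    ∫⁻ S : Fin n → 𝒳, ∫⁻ z, (if ENNReal.ofReal (Real.exp
        (A.kappa δ + Real.log (4 * √(n : ℝ) / δ) + ε)) <
          A.priorMoment loss P prior S (w, A.outRun S w z) then 1 else 0)
        ∂(whiteNoise d (A.E * A.T)) ∂(Measure.pi fun _ => P) ≤ ENNReal.ofReal δ := by
  have : Nonempty 𝒲 := ⟨w⟩
  have hn := A.one_le_size
  have hn0 : (0 : ℝ) < n := by exact_mod_cast hn
  have hE : (1 : ℝ) ≤ A.E := by exact_mod_cast A.E_pos
  have hE0 : (0 : ℝ) < A.E := by linarith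
  have hδ0 := hδ.1
  -- The infimum in κ need not be attained, hence the margin ε.
  obtain ⟨l, hl0, hlr, hl⟩ := A.exists_lt_kappa_add δ hε
  have hν : A.ν = A.m * (A.ζ / A.σ) ^ 2 := by rw [ν, div_pow]
  have hren := (A.pathField w).hasRenyiBound P (A.batch w) A.T_pos A.E_pos A.m_pos
    (div_pos A.ζ_pos A.σ_pos) rfl (A.card_batch_eq w) (A.disjoint_batch_of_ne w) hν hl0 hlr
  set k := 1 / 2 * A.E * A.T * A.ν + A.E * (1 / l *
    (A.T * bernsteinF A.ν ((l + l ^ 2) / 2) + Real.log (2 * A.E / δ))) with hk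
  have hmB := A.measurable_priorMoment hloss P prior
  have hmBv : Measurable fun q : (Fin (A.E * A.T) → V) × (Fin n → 𝒳) =>
      A.priorMoment loss P prior q.2 (w, A.outReplay w q.1) :=
    hmB.comp (f := fun q : (Fin (A.E * A.T) → V) × (Fin n → 𝒳) => (q.2, (w, A.outReplay w q.1)))
      (measurable_snd.prodMk (measurable_const.prodMk
        ((A.measurable_outReplay w).comp measurable_fst)))
  have hlik : Measurable fun q : (Fin (A.E * A.T) → V) × (Fin n → 𝒳) =>
      lik ((A.pathField w).drift (A.batch w) q.2) q.1 := by fun_prop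
  have hmain := hren.lintegral_le (div_pos hl0 hE0) hlik
    (B := fun S v => A.priorMoment loss P prior S (w, A.outReplay w v)) hmBv
    (β := 2 * √(n : ℝ)) (δ := δ) (k := k) (by positivity) hδ0
    (fun v => lintegral_lintegral_expKl_le hloss hloss01 P hn _) (by
      have h1 : l / A.E * k = A.T * (1 / 2 * l * A.ν + bernsteinF A.ν ((l + l ^ 2) / 2)) +
          Real.log (2 * A.E / δ) := by rw [hk]; field_simp; ring
      rw [h1]
      -- All epochs are treated jointly, so log(2/δ) would be enough; the factor E inside the
      -- logarithm is slack.
      have h2 : Real.log (2 / δ) ≤ Real.log (2 * A.E / δ) :=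
        Real.log_le_log (by positivity) (by gcongr; linarith)
      linarith)
  have hthr : ENNReal.ofReal (Real.exp k * (2 * (2 * √(n : ℝ)) / δ)) ≤
      ENNReal.ofReal (Real.exp (A.kappa δ + Real.log (4 * √(n : ℝ) / δ) + ε)) := by
    refine ENNReal.ofReal_le_ofReal ?_
    have h3 : 2 * (2 * √(n : ℝ)) / δ = Real.exp (Real.log (4 * √(n : ℝ) / δ)) := by
      rw [Real.exp_log (by positivity)]; ring
    rw [h3, ← Real.exp_add]
    exact Real.exp_le_exp.2 (by linarith)
  generalize ENNReal.ofReal (Real.exp k * (2 * (2 * √(n : ℝ)) / δ)) = t at hmain hthr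
  have hind : Measurable fun q : (Fin (A.E * A.T) → V) × (Fin n → 𝒳) =>
      (if t < A.priorMoment loss P prior q.2 (w, A.outReplay w q.1) then 1 else 0 : ℝ≥0∞) :=
    Measurable.ite (measurableSet_lt measurable_const hmBv) measurable_const measurable_const
  have hswap : Measurable fun q : (Fin (A.E * A.T) → V) × (Fin n → 𝒳) =>
      lik ((A.pathField w).drift (A.batch w) q.2) q.1 *
        (if t < A.priorMoment loss P prior q.2 (w, A.outReplay w q.1) then 1 else 0) :=
    hlik.mul hind
  -- For each fixed data set Girsanov's formula replaces the noise by the path, weighted with its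
  -- density; the threshold may be lowered from κ to k.
  refine le_trans (lintegral_mono fun S => ?_)
    ((lintegral_lintegral_swap hswap.aemeasurable).symm.trans_le hmain)
  rw [← lintegral_comp_driftUpTo ((A.pathField w).past_drift (A.batch w) S)
    (fun k => by fun_prop) (F := fun v =>
      (if t < A.priorMoment loss P prior S (w, A.outReplay w v) then 1 else 0 : ℝ≥0∞))
    (hind.comp (measurable_prodMk_right (y := S)))]
  refine lintegral_mono fun z => ?_
  rw [A.outRun_eq_outReplay S w z]
  split_ifs with h1 h2
  · exact le_rfl
  · exact absurd (hthr.trans_lt h1) h2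
  · exact bot_le
  · exact le_rfl

end DPSGD

namespace DPSGD

variable {𝒳 𝒴 𝒲 𝒮 : Type*} [MeasurableSpace 𝒳] [MeasurableSpace 𝒴] [MeasurableSpace 𝒲]
  [MeasurableSpace 𝒮] {d n : ℕ}

/-- The epoch and the step within the epoch, of a step counted from the start. -/
def epochStep (A : DPSGD 𝒳 𝒲 𝒮 d n) (k : Fin (A.E * A.T)) : Fin A.E × Fin A.T :=
  (⟨k / A.T, A.div_lt k⟩, ⟨k % A.T, A.mod_lt k⟩)

theorem epochStep_injective (A : DPSGD 𝒳 𝒲 𝒮 d n) : Function.Injective A.epochStep := by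
  intro j k h
  simp only [epochStep, Prod.mk.injEq, Fin.mk.injEq] at h
  ext
  rw [← Nat.div_add_mod (j : ℕ) A.T, ← Nat.div_add_mod (k : ℕ) A.T, h.1, h.2]

variable {Ω : Type*} [MeasurableSpace Ω] {μ : Measure Ω} [IsProbabilityMeasure μ]
  {P : Measure 𝒳} {X : Fin n → Ω → 𝒳} {A : DPSGD 𝒳 𝒲 𝒮 d n}
  {Z : ℕ → ℕ → Ω → EuclideanSpace ℝ (Fin d)} {W : Ω → 𝒲}

/-- Data, noise and remaining randomness have a product law. -/
theorem map_data_noise_randomness (hX : ∀ i, Measurable (X i)) (hX_law : ∀ i, μ.map (X i) = P)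
    (hX_indep : iIndepFun X μ) (hZ : ∀ e t, Measurable (Z e t))
    (hZ_law : ∀ (e : Fin A.E) (t : Fin A.T),
      μ.map (Z e t) = stdGaussian (EuclideanSpace ℝ (Fin d)))
    (hZ_indep : iIndepFun (fun (p : Fin A.E × Fin A.T) ω => Z p.1 p.2 ω) μ) (hW : Measurable W)
    (hZW_indep : IndepFun (fun ω (p : Fin A.E × Fin A.T) => Z p.1 p.2 ω) W μ)
    (hX_ZW_indep : IndepFun (fun ω i => X i ω)
      (fun ω => ((fun (p : Fin A.E × Fin A.T) => Z p.1 p.2 ω), W ω)) μ) :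
    μ.map (fun ω => ((fun i => X i ω),
      ((fun k : Fin (A.E * A.T) => Z (k / A.T) (k % A.T) ω), W ω))) =
      (Measure.pi fun _ : Fin n => P).prod ((whiteNoise d (A.E * A.T)).prod (μ.map W)) := by
  have hXm : Measurable fun ω i => X i ω := measurable_pi_lambda _ hX
  have hzm : Measurable fun ω (k : Fin (A.E * A.T)) => Z (k / A.T) (k % A.T) ω :=
    measurable_pi_lambda _ fun k => hZ _ _
  have hXl : μ.map (fun ω i => X i ω) = Measure.pi fun _ => P := by
    rw [(iIndepFun_iff_map_fun_eq_pi_map fun i => (hX i).aemeasurable).1 hX_indep]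
    simp_rw [hX_law]
  have hzl : μ.map (fun ω (k : Fin (A.E * A.T)) => Z (k / A.T) (k % A.T) ω) =
      whiteNoise d (A.E * A.T) := by
    have h := hZ_indep.precomp A.epochStep_injective
    rw [(iIndepFun_iff_map_fun_eq_pi_map
      (f := fun (k : Fin (A.E * A.T)) ω => Z (k / A.T) (k % A.T) ω)
      fun k => (hZ _ _).aemeasurable).1 h]
    exact congrArg Measure.pi (funext fun k => hZ_law (A.epochStep k).1 (A.epochStep k).2)
  have hre : Measurable fun (z : Fin A.E × Fin A.T → EuclideanSpace ℝ (Fin d)) k =>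
      z (A.epochStep k) := by fun_prop
  have h1 : IndepFun (fun ω (k : Fin (A.E * A.T)) => Z (k / A.T) (k % A.T) ω) W μ :=
    hZW_indep.comp hre measurable_id
  have h2 : IndepFun (fun ω i => X i ω)
      (fun ω => ((fun k : Fin (A.E * A.T) => Z (k / A.T) (k % A.T) ω), W ω)) μ :=
    hX_ZW_indep.comp measurable_id (hre.prodMap measurable_id)
  rw [(indepFun_iff_map_prod_eq_prod_map_map hXm.aemeasurable
    (hzm.prodMk hW).aemeasurable).1 h2, (indepFun_iff_map_prod_eq_prod_map_map hzm.aemeasurable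
    hW.aemeasurable).1 h1, hXl, hzl]

/-- The exceptional event is unlikely. -/
theorem measure_lt_priorMoment_le [IsProbabilityMeasure P]
    (hX : ∀ i, Measurable (X i)) (hX_law : ∀ i, μ.map (X i) = P)
    (hX_indep : iIndepFun X μ) (hZ : ∀ e t, Measurable (Z e t))
    (hZ_law : ∀ (e : Fin A.E) (t : Fin A.T),
      μ.map (Z e t) = stdGaussian (EuclideanSpace ℝ (Fin d)))
    (hZ_indep : iIndepFun (fun (p : Fin A.E × Fin A.T) ω => Z p.1 p.2 ω) μ) (hW : Measurable W)
    (hZW_indep : IndepFun (fun ω (p : Fin A.E × Fin A.T) => Z p.1 p.2 ω) W μ)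
    (hX_ZW_indep : IndepFun (fun ω i => X i ω)
      (fun ω => ((fun (p : Fin A.E × Fin A.T) => Z p.1 p.2 ω), W ω)) μ)
    {loss : 𝒳 → 𝒴 → ℝ} (hloss : Measurable fun p : 𝒳 × 𝒴 => loss p.1 p.2)
    (hloss01 : ∀ x y, loss x y ∈ Set.Icc (0 : ℝ) 1)
    (prior : Kernel (𝒲 × (Fin A.E → Fin A.T → EuclideanSpace ℝ (Fin d))) 𝒴) [IsMarkovKernel prior]
    {δ ε : ℝ} (hδ : δ ∈ Set.Ioo (0 : ℝ) 1) (hε : 0 < ε) :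
    μ {ω | ENNReal.ofReal (Real.exp (A.kappa δ + Real.log (4 * √(n : ℝ) / δ) + ε)) <
      A.priorMoment loss P prior (fun i => X i ω)
        (W ω, A.stream (fun i => X i ω) (W ω) (fun e t => Z e t ω))} ≤ ENNReal.ofReal δ := by
  have hbound := A.lintegral_lintegral_outRun_le hloss hloss01 P prior hδ hε
  have hlaw := map_data_noise_randomness hX hX_law hX_indep hZ hZ_law hZ_indep hW hZW_indep
    hX_ZW_indep
  generalize ENNReal.ofReal (Real.exp (A.kappa δ + Real.log (4 * √(n : ℝ) / δ) + ε)) = t at *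
  have hφ : Measurable fun ω => ((fun i => X i ω),
      ((fun k : Fin (A.E * A.T) => Z (k / A.T) (k % A.T) ω), W ω)) :=
    (measurable_pi_lambda _ hX).prodMk ((measurable_pi_lambda _ fun k => hZ _ _).prodMk hW)
  have hB : Measurable fun p : (Fin n → 𝒳) ×
      (Fin (A.E * A.T) → EuclideanSpace ℝ (Fin d)) × 𝒲 =>
      A.priorMoment loss P prior p.1 (p.2.2, A.outRun p.1 p.2.2 p.2.1) :=
    (A.measurable_priorMoment hloss P prior).comp
      (measurable_fst.prodMk (measurable_snd.snd.prodMk A.measurable_outRun))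
  have hD : MeasurableSet {p : (Fin n → 𝒳) ×
      (Fin (A.E * A.T) → EuclideanSpace ℝ (Fin d)) × 𝒲 |
      t < A.priorMoment loss P prior p.1 (p.2.2, A.outRun p.1 p.2.2 p.2.1)} :=
    measurableSet_lt measurable_const hB
  have hg : Measurable fun p : (Fin n → 𝒳) ×
      (Fin (A.E * A.T) → EuclideanSpace ℝ (Fin d)) × 𝒲 =>
      (if t < A.priorMoment loss P prior p.1 (p.2.2, A.outRun p.1 p.2.2 p.2.1) then 1 else 0 :
        ℝ≥0∞) := Measurable.ite hD measurable_const measurable_const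
  have hWp : IsProbabilityMeasure (μ.map W) := Measure.isProbabilityMeasure_map hW.aemeasurable
  have hset : {ω | t < A.priorMoment loss P prior (fun i => X i ω)
      (W ω, A.stream (fun i => X i ω) (W ω) (fun e t => Z e t ω))} =
      (fun ω => ((fun i => X i ω),
      ((fun k : Fin (A.E * A.T) => Z (k / A.T) (k % A.T) ω), W ω))) ⁻¹' {p |
        t < A.priorMoment loss P prior p.1 (p.2.2, A.outRun p.1 p.2.2 p.2.1)} := by
    ext ω
    simp only [Set.mem_ofPred_eq, Set.mem_preimage, A.stream_eq]
    rfl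
  rw [hset, ← Measure.map_apply hφ hD, hlaw, ← lintegral_indicator_one hD]
  have hind : ∀ p, ({p : (Fin n → 𝒳) × (Fin (A.E * A.T) → EuclideanSpace ℝ (Fin d)) × 𝒲 |
      t < A.priorMoment loss P prior p.1 (p.2.2, A.outRun p.1 p.2.2 p.2.1)}.indicator
        (1 : (Fin n → 𝒳) × (Fin (A.E * A.T) → EuclideanSpace ℝ (Fin d)) × 𝒲 → ℝ≥0∞) p) =
      if t < A.priorMoment loss P prior p.1 (p.2.2, A.outRun p.1 p.2.2 p.2.1) then 1 else 0 :=
    fun p => by simp only [Set.indicator_apply, Set.mem_ofPred_eq, Pi.one_apply]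
  rw [lintegral_congr hind, lintegral_prod _ hg.aemeasurable]
  have hg' : Measurable fun q : ((Fin n → 𝒳) × 𝒲) ×
      (Fin (A.E * A.T) → EuclideanSpace ℝ (Fin d)) =>
      (if t < A.priorMoment loss P prior q.1.1 (q.1.2, A.outRun q.1.1 q.1.2 q.2) then 1 else 0 :
        ℝ≥0∞) :=
    hg.comp (f := fun q : ((Fin n → 𝒳) × 𝒲) ×
      (Fin (A.E * A.T) → EuclideanSpace ℝ (Fin d)) => (q.1.1, q.2, q.1.2)) (by fun_prop)
  -- The remaining randomness is moved to the outermost integral, because the bound holds for each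
  -- fixed value of it.
  refine (lintegral_congr fun S => lintegral_prod_symm _
    (hg.comp (measurable_prodMk_left (x := S))).aemeasurable).trans_le ?_
  refine (lintegral_lintegral_swap hg'.lintegral_prod_right'.aemeasurable).trans_le ?_
  refine (lintegral_mono hbound).trans ?_
  simp

end DPSGD

theorem theorem2
    {Ω 𝒳 𝒴 𝒲 𝒮 : Type*} [MeasurableSpace Ω] [MeasurableSpace 𝒳] [MeasurableSpace 𝒴]
    [MeasurableSpace 𝒲] [MeasurableSpace 𝒮] {d n : ℕ}
    -- the probability space
    (μ : Measure Ω) [IsProbabilityMeasure μ]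
    -- the training set: `n` i.i.d. data points with law `P`
    (P : Measure 𝒳) [IsProbabilityMeasure P] (X : Fin n → Ω → 𝒳)
    (hX : ∀ i, Measurable (X i)) (hX_law : ∀ i, μ.map (X i) = P) (hX_indep : iIndepFun X μ)
    -- the DP-SGD algorithm, its independent standard Gaussian noise `Z`, and its other randomness `W`
    (A : DPSGD 𝒳 𝒲 𝒮 d n)
    (Z : ℕ → ℕ → Ω → EuclideanSpace ℝ (Fin d)) (hZ : ∀ e t, Measurable (Z e t))
    (hZ_law : ∀ (e : Fin A.E) (t : Fin A.T),
      μ.map (Z e t) = stdGaussian (EuclideanSpace ℝ (Fin d)))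
    (hZ_indep : iIndepFun (fun (p : Fin A.E × Fin A.T) ω => Z p.1 p.2 ω) μ)
    (W : Ω → 𝒲) (hW : Measurable W)
    -- the training set, the noise and the other randomness are mutually independent
    (hZW_indep : IndepFun (fun ω (p : Fin A.E × Fin A.T) => Z p.1 p.2 ω) W μ)
    (hX_ZW_indep : IndepFun (fun ω i => X i ω)
      (fun ω => ((fun (p : Fin A.E × Fin A.T) => Z p.1 p.2 ω), W ω)) μ)
    -- the bounded loss
    (loss : 𝒳 → 𝒴 → ℝ) (hloss : Measurable (fun p : 𝒳 × 𝒴 => loss p.1 p.2))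
    (hloss_mem : ∀ x y, loss x y ∈ Set.Icc (0 : ℝ) 1)
    -- the prior: any (possibly randomized) post-processing of the output of DP-SGD
    (prior : Kernel (𝒲 × (Fin A.E → Fin A.T → EuclideanSpace ℝ (Fin d))) 𝒴) [IsMarkovKernel prior]
    (δ : ℝ) (hδ : δ ∈ Set.Ioo (0 : ℝ) 1) :
    μ {ω | ¬ ∀ ρ : Measure 𝒴, IsProbabilityMeasure ρ →
        klBer (empRisk loss (fun i => X i ω) ρ) (trueRisk loss P ρ) ≤
          (klDiv ρ (prior (W ω, A.stream (fun i => X i ω) (W ω) (fun e t => Z e t ω))) +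
            ENNReal.ofReal (A.kappa δ + Real.log (4 * √(n : ℝ) / δ))) / (n : ℝ≥0∞)}
      ≤ ENNReal.ofReal δ ∧
    A.kappa δ ≤ A.kappaExplicit δ := by
  refine ⟨?_, A.kappa_le hδ⟩
  have hΩ : Nonempty Ω := nonempty_of_isProbabilityMeasure μ
  have h𝒲 : Nonempty 𝒲 := hΩ.map W
  have hn := A.one_le_size
  set c := A.kappa δ + Real.log (4 * √(n : ℝ) / δ) with hc
  set B : Ω → ℝ≥0∞ := fun ω => A.priorMoment loss P prior (fun i => X i ω)
        (W ω, A.stream (fun i => X i ω) (W ω) (fun e t => Z e t ω)) with hB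
  -- The failure event quantifies over all ρ and need not be measurable. It is covered by events on
  -- the prior moment alone, one for each margin 1/(j + 1); outside all of them the moment is at
  -- most exp c in the limit.
  have hsub : {ω | ¬ ∀ ρ : Measure 𝒴, IsProbabilityMeasure ρ →
        klBer (empRisk loss (fun i => X i ω) ρ) (trueRisk loss P ρ) ≤
          (klDiv ρ (prior (W ω, A.stream (fun i => X i ω) (W ω) (fun e t => Z e t ω))) +
            ENNReal.ofReal c) / (n : ℝ≥0∞)} ⊆
      ⋃ j : ℕ, {ω | ENNReal.ofReal (Real.exp (c + 1 / ((j : ℝ) + 1))) < B ω} := by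
    intro ω hω
    by_contra hcon
    refine hω fun ρ hρ => ?_
    simp only [Set.mem_iUnion, Set.mem_ofPred_eq, not_exists, not_lt] at hcon
    have hle : B ω ≤ ENNReal.ofReal (Real.exp c) := by
      refine ge_of_tendsto' (f := fun j : ℕ => ENNReal.ofReal (Real.exp (c + 1 / ((j : ℝ) + 1))))
        (x := Filter.atTop) ?_ hcon
      refine ENNReal.tendsto_ofReal ((Real.continuous_exp.tendsto c).comp ?_)
      simpa using (tendsto_one_div_add_atTop_nhds_zero_nat (𝕜 := ℝ)).const_add c
    have hmem : ∀ y, 1 / (n : ℝ) * ∑ i, loss (X i ω) y ∈ Set.Icc (0 : ℝ) 1 := by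
      intro y
      have hn0 : (0 : ℝ) < n := by exact_mod_cast hn
      have h0 : 0 ≤ ∑ i, loss (X i ω) y := Finset.sum_nonneg fun i _ => (hloss_mem _ _).1
      have h1 : ∑ i, loss (X i ω) y ≤ n := by
        simpa using Finset.sum_le_sum fun i (_ : i ∈ Finset.univ) => (hloss_mem (X i ω) y).2
      refine ⟨by positivity, ?_⟩
      rw [one_div, inv_mul_le_iff₀ hn0]
      linarith
    exact klBer_le_of_lintegral_expKl_le hn
      ((measurable_empirical hloss).comp (measurable_prodMk_left (x := fun i => X i ω)))
      (measurable_integral_loss hloss P) hmem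
      (fun y => integral_mem_Icc P (hloss.comp measurable_prodMk_right) fun x => hloss_mem x y)
      _ ρ hle
  -- The covering events increase as the margin shrinks, so their union has probability at most δ
  -- without a union bound.
  have hmono : Monotone fun j : ℕ =>
      {ω | ENNReal.ofReal (Real.exp (c + 1 / ((j : ℝ) + 1))) < B ω} := by
    intro i j hij ω hω
    refine lt_of_le_of_lt (ENNReal.ofReal_le_ofReal (Real.exp_le_exp.2 ?_)) hω
    gcongr
  refine (measure_mono hsub).trans ?_
  rw [hmono.measure_iUnion]
  exact iSup_le fun j => DPSGD.measure_lt_priorMoment_le hX hX_law hX_indep hZ hZ_law hZ_indep hW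
    hZW_indep hX_ZW_indep hloss hloss_mem prior hδ Nat.one_div_pos_of_nat
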